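/- **Setting.** Let $d\ge 1$, $p\ge 2$, let $\Omega\subset\mathbb R^d$ be a bounded domain, $T>0$, $Q=\Omega\times(0,T)\subset\mathbb R^{d+1}$, $\Sigma=\partial\Omega\times(0,T)$, $\Sigma_0=\Omega\times\{0\}$, $\Sigma_T=\Omega\times\{T\}$. Let $\hat R_i$ be tensor-product NURBS of degree $p$ on $[0,1]^{d+1}$ (B-splines if all weights are equal), with positive weights $w_i$, weighting function $W=\sum_i w_i\hat B_i$ and open knot vectors whose inner knots have multiplicity at most $p-1$. Let $\hat{\mathcal S}$ be a linear subspace of $\operatorname{span}\{\hat R_i\}$ and let $\hat{\mathcal K}_h$ be a mesh for it, i.e. a finite partition of the cube into open axis-parallel boxes $\hat K$ (pairwise disjoint, with closures covering the cube) on each of which $W$ and all $W\hat s$, $\hat s\in\hat{\mathcal S}$, are polynomials of degree at most $p$ in each variable. (Examples: the whole NURBS space with the mesh of knot spans; spaces of truncated hierarchical B-splines with their hierarchical meshes.) Let $\Phi=\sum_i\hat R_i\mathbf P_i$ be a geometrical map with components in $\hat{\mathcal S}$, injective on $[0,1]^{d+1}$, with nonsingular Jacobian there, and $\Phi((0,1)^{d+1})=Q$.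 Put $\mathcal K_h=\{K=\Phi(\hat K)\}$, $h_K=\operatorname{diam}K$, $V_h=\{\hat s\circ\Phi^{-1}:\hat s\in\hat{\mathcal S}\}$, and let $V_{0h}$ be the space of all $v_h\in V_h$ with $v_h=0$ on $\Sigma$ and on $\Sigma_0$. For $\theta_K>0$ and $\delta_K=\theta_Kh_K$ define $$a_{loc,h}(u,v)=(\partial_tu,v)_Q+(\nabla_xu,\nabla_xv)_Q+\sum_{K}\delta_K\big((\partial_tu,\partial_tv)_K+(\nabla_xu,\nabla_x\partial_tv)_K\big)-\sum_K\delta_K\sum_{E}\big(n_x\cdot\nabla_xu,\partial_tv\big)_E ,$$ where the inner sum is over the interior facets $E$ of $K$ ($E=\partial K\cap\partial K'$ with $K'\ne K$, $E\not\subset\partial Q$) and $n_x$ is the spatial part of the outer unit normal of $K$; and $$|||v|||_{loc,h}^2=\|\nabla_xv\|_Q^2+\tfrac12\|v\|_{\Sigma_T}^2+\sum_K\delta_K\|\partial_tv\|_K^2 .$$ For $K\in\mathcal K_h$ a number $C>0$ is called an inverse-inequality constant on $K$ if $$\|\nabla_xw\|_K\le C\,h_K^{-1}\|w\|_K\qquad\text{for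 } w=v_h\text{ and for } w=\partial_{x_l}v_h,\ l=1,\dots,d,\quad\text{for all }v_h\in V_h .$$ **Lemma (coercivity).** There is a number $C>0$ that is an inverse-inequality constant on every $K\in\mathcal K_h$. If $C_{int,1}=C_{int,1}(K)>0$ are any inverse-inequality constants on the elements $K\in\mathcal K_h$ (for example one constant for all $K$) and $$\theta_K\in\Big(0,\ \frac{h_K}{d\,C_{int,1}^2}\Big]\qquad\text{for all }K\in\mathcal K_h,$$ then $$a_{loc,h}(v_h,v_h)\ \ge\ \tfrac12\,|||v_h|||_{loc,h}^2\qquad\text{for all }v_h\in V_{0h}.$$ -/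

import Mathlib

open MeasureTheory Set

noncomputable section

namespace SpaceTimeIgA

/-! ### Univariate B-splines, tensor-product NURBS -/

/-- An open knot vector of degree `p` on `[0,1]` with `n` B-splines.  The knots are
`knot 0 ≤ … ≤ knot (n+p)`; the sequence is continued by `1` beyond `n+p`.  The end knots have
multiplicity exactly `p+1`, every inner knot has multiplicity at most `p-1`. -/
structure KnotVector (p : ℕ) where
  n : ℕ
  knot : ℕ → ℝ
  lt_n : p < n
  mono : Monotone knot
  left : ∀ i ≤ p, knot i = 0
  right : ∀ i, n ≤ i → knot i = 1
  inner : ∀ i, p < i → i < n → 0 < knot i ∧ knot i < 1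
  mult : ∀ x : ℝ, 0 < x → x < 1 → Set.ncard {i : ℕ | knot i = x} + 1 ≤ p

/-- Cox-de Boor recursion (`x / 0 = 0`).  Degree zero: indicator of `[ξ i, ξ (i+1))`, where the
last nonempty knot span also contains its right end `1`. -/
def bspline (ξ : ℕ → ℝ) : ℕ → ℕ → ℝ → ℝ
  | 0, i, x =>
      open Classical in
      if (ξ i ≤ x ∧ x < ξ (i + 1)) ∨ (x = 1 ∧ ξ i < 1 ∧ ξ (i + 1) = 1) then 1 else 0
  | q + 1, i, x =>
      (x - ξ i) / (ξ (i + q + 1) - ξ i) * bspline ξ q i x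
        + (ξ (i + q + 2) - x) / (ξ (i + q + 2) - ξ (i + 1)) * bspline ξ q (i + 1) x

/-- Parameter space `ℝ^{d+1}`. -/
abbrev Param (d : ℕ) : Type := Fin (d + 1) → ℝ

/-- Physical space-time `ℝ^{d+1}` with the Euclidean distance; the last coordinate is time. -/
abbrev Phys (d : ℕ) : Type := EuclideanSpace ℝ (Fin (d + 1))

/-- Closed parameter cube `[0,1]^{d+1}`. -/
def closedCube (d : ℕ) : Set (Param d) := Icc 0 1

/-- Open box with corners `a` and `b`. -/
def openBox {d : ℕ} (a b : Param d) : Set (Param d) := univ.pi fun α => Ioo (a α) (b α)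

/-- Open parameter cube `(0,1)^{d+1}`. -/
def openCube (d : ℕ) : Set (Param d) := openBox 0 1

/-- Knot vectors and positive weights, one weight for each tensor-product B-spline. -/
structure NurbsBasis (d p : ℕ) where
  Ξ : Fin (d + 1) → KnotVector p
  w : (∀ α, Fin (Ξ α).n) → ℝ
  w_pos : ∀ i, 0 < w i

namespace NurbsBasis

variable {d p : ℕ} (B : NurbsBasis d p)

/-- Multi-indices numbering the basis functions. -/
abbrev Index : Type := ∀ α, Fin (B.Ξ α).n

/-- Tensor-product B-spline. -/
def tensorB (i : B.Index) (ξ : Param d) : ℝ :=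
  ∏ α, bspline (B.Ξ α).knot p (i α) (ξ α)

/-- The weighting function `W`. -/
def weight (ξ : Param d) : ℝ := ∑ i : B.Index, B.w i * B.tensorB i ξ

/-- The NURBS basis function with index `i`; for constant weights these are the B-splines. -/
def nurbs (i : B.Index) (ξ : Param d) : ℝ := B.w i * B.tensorB i ξ / B.weight ξ

/-- The span of all NURBS basis functions. -/
def nurbsSpace : Submodule ℝ (Param d → ℝ) := Submodule.span ℝ (range B.nurbs)

end NurbsBasis

/-- `f` agrees on `A` with a polynomial of degree at most `p` in each variable. -/
def IsPolyOn {d : ℕ} (p : ℕ) (f : Param d → ℝ) (A : Set (Param d)) : Prop :=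
  ∃ q : MvPolynomial (Fin (d + 1)) ℝ,
    (∀ α, q.degreeOf α ≤ p) ∧ ∀ ξ ∈ A, f ξ = MvPolynomial.eval ξ q

/-- A (possibly hierarchical) spline space with its mesh on the parameter cube: a subspace of the
NURBS space together with a partition of the cube into open boxes on each of which the
weighting function and all functions `W s`, `s` in the space, are polynomials of degree `p`.
The full NURBS space on the mesh of knot spans is `SplineSpace.full` below; spaces of
hierarchical or truncated hierarchical B-splines are subspaces of the B-spline space of the
finest level, and their meshes are partitions into boxes of different levels. -/
structure SplineSpace {d p : ℕ} (B : NurbsBasis d p) (ι : Type*) where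
  space : Submodule ℝ (Param d → ℝ)
  space_le : space ≤ B.nurbsSpace
  lo : ι → Param d
  hi : ι → Param d
  lo_lt_hi : ∀ K α, lo K α < hi K α
  disjoint : Pairwise fun K L => Disjoint (openBox (lo K) (hi K)) (openBox (lo L) (hi L))
  cover : ⋃ K, Icc (lo K) (hi K) = closedCube d
  poly_weight : ∀ K, IsPolyOn p B.weight (openBox (lo K) (hi K))
  poly : ∀ s ∈ space, ∀ K, IsPolyOn p (fun ξ => B.weight ξ * s ξ) (openBox (lo K) (hi K))

/-! ### The full NURBS space on the mesh of knot spans -/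

namespace SplineSpace

variable {d p : ℕ}

/-- The nonempty tensor-product knot spans. -/
abbrev SpanIndex (B : NurbsBasis d p) : Type :=
  {i : B.Index // ∀ α, (B.Ξ α).knot (i α) < (B.Ξ α).knot (i α + 1)}

theorem knot_mem (k : KnotVector p) (i : ℕ) : 0 ≤ k.knot i ∧ k.knot i ≤ 1 := by
  constructor
  · rw [← k.left 0 (Nat.zero_le _)]; exact k.mono (Nat.zero_le _)
  · rw [← k.right (max i k.n) (le_max_right _ _)]; exact k.mono (le_max_left _ _)

theorem exists_span (k : KnotVector p) (x : ℝ) (h0 : 0 ≤ x) (h1 : x ≤ 1) :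
    ∃ i : Fin k.n, k.knot i < k.knot (i + 1) ∧ k.knot i ≤ x ∧ x ≤ k.knot (i + 1) := by
  classical
  have h00 : k.knot 0 = 0 := k.left 0 (Nat.zero_le _)
  have hn : k.knot k.n = 1 := k.right _ le_rfl
  rcases h1.lt_or_eq with h1 | rfl
  · have hex : ∃ j, x < k.knot j := ⟨k.n, by rw [hn]; exact h1⟩
    have hs := Nat.find_spec hex
    have hle : Nat.find hex ≤ k.n := Nat.find_min' hex (by rw [hn]; exact h1)
    obtain ⟨m, hm⟩ : ∃ m, Nat.find hex = m + 1 := by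
      refine Nat.exists_eq_succ_of_ne_zero fun h => ?_
      rw [h, h00] at hs; linarith
    have hmin : k.knot m ≤ x := not_lt.1 (Nat.find_min hex (by omega))
    rw [hm] at hs
    exact ⟨⟨m, by omega⟩, hmin.trans_lt hs, hmin, hs.le⟩
  · have hex : ∃ j, 1 ≤ k.knot j := ⟨k.n, hn.ge⟩
    have hs := Nat.find_spec hex
    have hle : Nat.find hex ≤ k.n := Nat.find_min' hex hn.ge
    obtain ⟨m, hm⟩ : ∃ m, Nat.find hex = m + 1 := by
      refine Nat.exists_eq_succ_of_ne_zero fun h => ?_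
      rw [h, h00] at hs; linarith
    have hmin : k.knot m < 1 := not_le.1 (Nat.find_min hex (by omega))
    rw [hm] at hs
    exact ⟨⟨m, by omega⟩, hmin.trans_le hs, hmin.le, hs⟩

/-- On an open knot span a B-spline of degree `q` is a polynomial of degree at most `q`. -/
theorem bspline_poly (ξ : ℕ → ℝ) (hm : Monotone ξ) (h1 : ∀ i, ξ i ≤ 1) (j q : ℕ) :
    ∀ i, ∃ P : Polynomial ℝ, P.natDegree ≤ q ∧
      ∀ x ∈ Ioo (ξ j) (ξ (j + 1)), bspline ξ q i x = P.eval x := by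
  classical
  induction q with
  | zero =>
    intro i
    refine ⟨if i = j then 1 else 0, by split_ifs <;> simp, fun x hx => ?_⟩
    have hx1 : x ≠ 1 := (hx.2.trans_le (h1 _)).ne
    by_cases hij : i = j
    · subst hij
      simp [bspline, hx.1.le, hx.2]
    · have : ¬ (ξ i ≤ x ∧ x < ξ (i + 1)) := by
        rintro ⟨ha, hb⟩
        rcases lt_or_gt_of_ne hij with h | h
        · linarith [hm (show i + 1 ≤ j by omega), hx.1]
        · linarith [hm (show j + 1 ≤ i by omega), hx.2]
      simp [bspline, hx1, this, hij]
  | succ q ih =>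
    intro i
    obtain ⟨P₁, hd₁, hP₁⟩ := ih i
    obtain ⟨P₂, hd₂, hP₂⟩ := ih (i + 1)
    refine ⟨Polynomial.C (ξ (i + q + 1) - ξ i)⁻¹ * (Polynomial.X - Polynomial.C (ξ i)) * P₁
      + Polynomial.C (ξ (i + q + 2) - ξ (i + 1))⁻¹
        * (Polynomial.C (ξ (i + q + 2)) - Polynomial.X) * P₂, ?_, fun x hx => ?_⟩
    · compute_degree
      omega
    · simp only [bspline, hP₁ x hx, hP₂ x hx, Polynomial.eval_add, Polynomial.eval_mul,
        Polynomial.eval_C, Polynomial.eval_sub, Polynomial.eval_X]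
      ring

end SplineSpace

namespace IsPolyOn

variable {d p : ℕ} {A : Set (Param d)}

theorem const_mul {f : Param d → ℝ} (hf : IsPolyOn p f A) (c : ℝ) :
    IsPolyOn p (fun ξ => c * f ξ) A := by
  obtain ⟨q, hq, h⟩ := hf
  refine ⟨MvPolynomial.C c * q, fun α => (MvPolynomial.degreeOf_C_mul_le q α c).trans (hq α),
    fun ξ hξ => by simp [h ξ hξ]⟩

theorem add {f g : Param d → ℝ} (hf : IsPolyOn p f A) (hg : IsPolyOn p g A) :
    IsPolyOn p (fun ξ => f ξ + g ξ) A := by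
  obtain ⟨q, hq, h⟩ := hf
  obtain ⟨r, hr, h'⟩ := hg
  exact ⟨q + r, fun α => (MvPolynomial.degreeOf_add_le α q r).trans (max_le (hq α) (hr α)),
    fun ξ hξ => by simp [h ξ hξ, h' ξ hξ]⟩

theorem zero : IsPolyOn p (fun _ => 0) A :=
  ⟨0, fun α => by simp, fun ξ _ => by simp⟩

theorem sum {κ : Type*} (s : Finset κ) {f : κ → Param d → ℝ} (hf : ∀ i ∈ s, IsPolyOn p (f i) A) :
    IsPolyOn p (fun ξ => ∑ i ∈ s, f i ξ) A := by
  classical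
  induction s using Finset.induction_on with
  | empty => simpa using zero
  | insert a s ha ih =>
    simp only [Finset.sum_insert ha]
    exact (hf a (Finset.mem_insert_self _ _)).add
      (ih fun i hi => hf i (Finset.mem_insert_of_mem hi))

end IsPolyOn

namespace SplineSpace

variable {d p : ℕ} (B : NurbsBasis d p)

theorem tensorB_poly (i : B.Index) (j : SpanIndex B) :
    IsPolyOn p (B.tensorB i) (openBox (fun α => (B.Ξ α).knot (j.1 α))
      (fun α => (B.Ξ α).knot (j.1 α + 1))) := by
  classical
  choose P hd hP using fun α : Fin (d + 1) => bspline_poly (B.Ξ α).knot (B.Ξ α).mono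
    (fun i => (knot_mem _ i).2) (j.1 α) p (i α)
  refine ⟨∏ α, Polynomial.aeval (MvPolynomial.X α) (P α), fun β => ?_, fun ξ hξ => ?_⟩
  · refine (MvPolynomial.degreeOf_prod_le _ _ _).trans ?_
    refine (Finset.sum_le_sum (g := fun α => if α = β then p else 0) fun α _ => ?_).trans ?_
    · rw [Polynomial.aeval_eq_sum_range]
      refine (MvPolynomial.degreeOf_sum_le _ _ _).trans (Finset.sup_le fun k hk => ?_)
      rw [MvPolynomial.smul_eq_C_mul]
      refine (MvPolynomial.degreeOf_C_mul_le _ _ _).trans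
        ((MvPolynomial.degreeOf_pow_le _ _ _).trans ?_)
      rw [MvPolynomial.degreeOf_X]
      have := hd α
      have := Finset.mem_range.1 hk
      by_cases h : α = β
      · subst h; simp; omega
      · simp [h, Ne.symm h]
    · simp
  · simp only [NurbsBasis.tensorB, map_prod]
    refine Finset.prod_congr rfl fun α _ => ?_
    rw [hP α _ (hξ α (mem_univ _))]
    have h := Polynomial.aeval_algHom_apply
      (MvPolynomial.aeval ξ : MvPolynomial (Fin (d + 1)) ℝ →ₐ[ℝ] ℝ) (MvPolynomial.X α) (P α)
    rw [MvPolynomial.aeval_X, Polynomial.coe_aeval_eq_eval] at h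
    rw [h]
    rfl

theorem weight_poly (j : SpanIndex B) :
    IsPolyOn p B.weight (openBox (fun α => (B.Ξ α).knot (j.1 α))
      (fun α => (B.Ξ α).knot (j.1 α + 1))) :=
  IsPolyOn.sum _ fun i _ => (tensorB_poly B i j).const_mul _

end SplineSpace

namespace SplineSpace

variable {d p : ℕ}

theorem bspline_nonneg (ξ : ℕ → ℝ) (hm : Monotone ξ) (q : ℕ) (x : ℝ) :
    ∀ i, 0 ≤ bspline ξ q i x ∧ (bspline ξ q i x ≠ 0 → ξ i ≤ x ∧ x ≤ ξ (i + q + 1)) := by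
  classical
  induction q with
  | zero =>
    intro i
    simp only [bspline]
    split_ifs with h
    · refine ⟨zero_le_one, fun _ => ?_⟩
      rcases h with h | ⟨rfl, h, h'⟩
      · exact ⟨h.1, h.2.le⟩
      · exact ⟨h.le, h'.ge⟩
    · simp
  | succ q ih =>
    intro i
    have key : ∀ a b c : ℝ, 0 ≤ b → (b ≠ 0 → 0 ≤ a) → 0 ≤ c → 0 ≤ a / c * b := by
      intro a b c hb ha hc
      by_cases h : b = 0
      · simp [h]
      · exact mul_nonneg (div_nonneg (ha h) hc) hb
    obtain ⟨h1, h1'⟩ := ih i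
    obtain ⟨h2, h2'⟩ := ih (i + 1)
    have e : i + 1 + q + 1 = i + q + 2 := by ring
    rw [e] at h2'
    refine ⟨add_nonneg (key _ _ _ h1 (fun h => sub_nonneg.2 (h1' h).1)
      (sub_nonneg.2 (hm (by omega)))) (key _ _ _ h2 (fun h => sub_nonneg.2 (h2' h).2)
      (sub_nonneg.2 (hm (by omega)))), fun h => ?_⟩
    have e' : i + (q + 1) + 1 = i + q + 2 := by ring
    rw [e']
    by_cases hb : bspline ξ q i x = 0
    · by_cases hc : bspline ξ q (i + 1) x = 0
      · exact absurd (by simp [bspline, hb, hc]) h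
      · exact ⟨(hm (by omega)).trans (h2' hc).1, (h2' hc).2⟩
    · exact ⟨(h1' hb).1, (h1' hb).2.trans (hm (by omega))⟩

theorem weight_mul_nurbs (B : NurbsBasis d p) (i : B.Index) (ξ : Param d) :
    B.weight ξ * B.nurbs i ξ = B.w i * B.tensorB i ξ := by
  by_cases h : B.weight ξ = 0
  · have h0 : ∀ i ∈ Finset.univ, 0 ≤ B.w i * B.tensorB i ξ := fun i _ =>
      mul_nonneg (B.w_pos i).le
        (Finset.prod_nonneg fun α _ => (bspline_nonneg _ (B.Ξ α).mono _ _ _).1)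
    have := (Finset.sum_eq_zero_iff_of_nonneg h0).1 h i (Finset.mem_univ _)
    rw [this, h, zero_mul]
  · simp only [NurbsBasis.nurbs]
    field_simp

/-- The span of all NURBS basis functions on the mesh of nonempty knot spans. -/
def full (B : NurbsBasis d p) : SplineSpace B (SpanIndex B) where
  space := B.nurbsSpace
  space_le := le_rfl
  lo j α := (B.Ξ α).knot (j.1 α)
  hi j α := (B.Ξ α).knot (j.1 α + 1)
  lo_lt_hi j := j.2
  disjoint := by
    intro i j hij
    rw [Set.disjoint_left]
    intro ξ hi hj
    refine hij (Subtype.ext (funext fun α => Fin.ext ?_))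
    have h1 := hi α (mem_univ _)
    have h2 := hj α (mem_univ _)
    by_contra hne
    rcases lt_or_gt_of_ne hne with h | h
    · linarith [(B.Ξ α).mono (show (i.1 α : ℕ) + 1 ≤ j.1 α by omega), h1.2, h2.1]
    · linarith [(B.Ξ α).mono (show (j.1 α : ℕ) + 1 ≤ i.1 α by omega), h1.1, h2.2]
  cover := by
    ext ξ
    simp only [mem_iUnion, closedCube]
    constructor
    · rintro ⟨j, h1, h2⟩
      exact ⟨fun α => (knot_mem _ _).1.trans (h1 α), fun α => (h2 α).trans (knot_mem _ _).2⟩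
    · rintro ⟨h1, h2⟩
      choose i hi using fun α => exists_span (B.Ξ α) (ξ α) (h1 α) (h2 α)
      exact ⟨⟨i, fun α => (hi α).1⟩, fun α => (hi α).2.1, fun α => (hi α).2.2⟩
  poly_weight := weight_poly B
  poly := by
    intro s hs j
    induction hs using Submodule.span_induction with
    | mem s hs =>
      obtain ⟨i, rfl⟩ := hs
      simp only [weight_mul_nurbs]
      exact (tensorB_poly B i j).const_mul _
    | zero => simpa using IsPolyOn.zero
    | add s t _ _ hs ht => simpa [mul_add] using hs.add ht
    | smul c s _ hs => simpa [mul_left_comm] using hs.const_mul c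

end SplineSpace

/-! ### Geometry map, physical mesh and discrete spaces -/

/-- The geometrical map `Φ = ∑ R_i P_i`, with components in the spline space, one-to-one on the
closed parameter cube and with nonsingular Jacobian there. -/
structure Geometry {d p : ℕ} {B : NurbsBasis d p} {ι : Type*} (S : SplineSpace B ι) where
  ctrl : B.Index → Phys d
  isogeometric : ∀ k, (fun ξ => (∑ i, B.nurbs i ξ • ctrl i : Phys d) k) ∈ S.space
  injOn : InjOn (fun ξ => (∑ i, B.nurbs i ξ • ctrl i : Phys d)) (closedCube d)
  det_ne_zero : ∀ ξ ∈ closedCube d, (Matrix.of fun k α : Fin (d + 1) =>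
    fderivWithin ℝ (fun ξ => (∑ i, B.nurbs i ξ • ctrl i : Phys d)) (closedCube d) ξ
      (Pi.single α 1) k).det ≠ 0

/-- The space-time point `(x, t)`. -/
def stPoint {d : ℕ} (x : EuclideanSpace ℝ (Fin d)) (t : ℝ) : Phys d :=
  WithLp.toLp 2 (Fin.snoc (fun l => x l) t)

/-- The cylinder `Ω × (0,T)`. -/
def cylinder {d : ℕ} (Ω : Set (EuclideanSpace ℝ (Fin d))) (T : ℝ) : Set (Phys d) :=
  {y | ∃ x ∈ Ω, ∃ t ∈ Ioo 0 T, y = stPoint x t}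

/-- Partial derivative in the `i`-th coordinate direction. -/
def pd {d : ℕ} (i : Fin (d + 1)) (f : Phys d → ℝ) (y : Phys d) : ℝ :=
  fderiv ℝ f y (EuclideanSpace.single i 1)

/-- Spatial partial derivative `∂_{x_l}`. -/
def dx {d : ℕ} (l : Fin d) (f : Phys d → ℝ) : Phys d → ℝ := pd l.castSucc f

/-- Time derivative `∂_t`. -/
def dt {d : ℕ} (f : Phys d → ℝ) : Phys d → ℝ := pd (Fin.last d) f

/-- `(f, g)_A`. -/
def ip {d : ℕ} (A : Set (Phys d)) (f g : Phys d → ℝ) : ℝ := ∫ y in A, f y * g y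

/-- `(∇_x f, ∇_x g)_A`. -/
def ipGrad {d : ℕ} (A : Set (Phys d)) (f g : Phys d → ℝ) : ℝ :=
  ∫ y in A, ∑ l : Fin d, dx l f y * dx l g y

namespace Geometry

variable {d p : ℕ} {B : NurbsBasis d p} {ι : Type*} {S : SplineSpace B ι} (G : Geometry S)

/-- The geometrical map. -/
def Φ (ξ : Param d) : Phys d := ∑ i, B.nurbs i ξ • G.ctrl i

/-- Its inverse on the image of the closed cube. -/
def Φinv : Phys d → Param d := Function.invFunOn G.Φ (closedCube d)

/-- Jacobian matrix of `Φ` (one-sided derivatives on the boundary of the cube). -/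
def jac (ξ : Param d) : Matrix (Fin (d + 1)) (Fin (d + 1)) ℝ :=
  Matrix.of fun k α => fderivWithin ℝ G.Φ (closedCube d) ξ (Pi.single α 1) k

/-- The physical domain `Q = Φ((0,1)^{d+1})`. -/
def Q : Set (Phys d) := G.Φ '' openCube d

/-- The physical element `K`. -/
def elt (K : ι) : Set (Phys d) := G.Φ '' openBox (S.lo K) (S.hi K)

/-- The local mesh size `h_K = diam K`. -/
def h (K : ι) : ℝ := Metric.diam (G.elt K)

/-- `V_h`, the push-forward of the spline space. -/
def Vh : Submodule ℝ (Phys d → ℝ) := S.space.map (LinearMap.funLeft ℝ ℝ G.Φinv)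

/-- `V_{0h}`: functions of `V_h` that vanish on `Σ = ∂Ω × (0,T)` and on `Σ_0 = Ω × {0}`.
(Functions of `V_h` are continuous on the closure of `Q`, so traces are pointwise values.) -/
def V0h (Ω : Set (EuclideanSpace ℝ (Fin d))) (T : ℝ) : Set (Phys d → ℝ) :=
  {v | v ∈ G.Vh ∧ (∀ x ∈ frontier Ω, ∀ t ∈ Ioo 0 T, v (stPoint x t) = 0) ∧
    ∀ x ∈ Ω, v (stPoint x 0) = 0}

/-- The vector `|det J| J^{-T} e_α`, normal to the image of the coordinate plane orthogonal to the
`α`-th parameter direction and pointing to the side where that parameter increases.  Its length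
is the surface element of that image, parametrised by the remaining `d` parameters. -/
def areaVec (ξ : Param d) (α : Fin (d + 1)) : Phys d :=
  WithLp.toLp 2 fun k => (SignType.sign (G.jac ξ).det : ℝ) * (G.jac ξ).adjugate α k

/-- The unit normal. -/
def unitNormal (ξ : Param d) (α : Fin (d + 1)) : Phys d :=
  ‖G.areaVec ξ α‖⁻¹ • G.areaVec ξ α

/-- The parameters `z` of the points of the face `ξ_α = c` of `K` that `Φ` maps into `E`. -/
def facePart (K : ι) (α : Fin (d + 1)) (c : ℝ) (E : Set (Phys d)) : Set (Fin d → ℝ) :=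
  {z | z ∈ Icc (fun j => S.lo K (α.succAbove j)) (fun j => S.hi K (α.succAbove j)) ∧
    G.Φ (α.insertNth c z) ∈ E}

/-- Surface integral over the part `E` of the boundary of `K` of `y ↦ F y (n y)`, where `n` is the
outer unit normal of `K`. -/
def surfInt (K : ι) (E : Set (Phys d)) (F : Phys d → Phys d → ℝ) : ℝ :=
  ∑ α : Fin (d + 1),
    ((∫ z in G.facePart K α (S.hi K α) E,
        F (G.Φ (α.insertNth (S.hi K α) z)) (G.unitNormal (α.insertNth (S.hi K α) z) α)
          * ‖G.areaVec (α.insertNth (S.hi K α) z) α‖)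
      + ∫ z in G.facePart K α (S.lo K α) E,
        F (G.Φ (α.insertNth (S.lo K α) z)) (-G.unitNormal (α.insertNth (S.lo K α) z) α)
          * ‖G.areaVec (α.insertNth (S.lo K α) z) α‖)

/-- The facet between the elements `K` and `L`. -/
def facet (K L : ι) : Set (Phys d) := frontier (G.elt K) ∩ frontier (G.elt L)

/-- `(n_x^E · ∇_x u, ∂_t v)_E` on a facet `E` of `K`, with `n` the outer unit normal of `K`. -/
def facetTerm (K : ι) (E : Set (Phys d)) (u v : Phys d → ℝ) : ℝ :=
  G.surfInt K E fun y n => (∑ l : Fin d, n l.castSucc * dx l u y) * dt v y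

/-- `C` is a constant of the inverse inequality
`‖∇_x w‖_K ≤ C h_K⁻¹ ‖w‖_K` on the element `K`, for the functions `w = v_h` and
`w = ∂_{x_l} v_h`, with `v_h` in `V_h`. -/
def IsInverseConst (K : ι) (C : ℝ) : Prop :=
  ∀ v ∈ G.Vh, ∀ w : Phys d → ℝ, (w = v ∨ ∃ l : Fin d, w = dx l v) →
    √(ipGrad (G.elt K) w w) ≤ C * (G.h K)⁻¹ * √(ip (G.elt K) w w)

variable [Fintype ι]

open Classical in
/-- Sum over the interior facets of `K`, i.e. those not contained in the boundary of `Q`. -/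
def interiorFacetSum (K : ι) (u v : Phys d → ℝ) : ℝ :=
  ∑ L : ι, if L ≠ K ∧ ¬ G.facet K L ⊆ frontier G.Q then G.facetTerm K (G.facet K L) u v else 0

/-- The locally stabilised bilinear form, `δ_K = θ_K h_K`. -/
def aloc (θ : ι → ℝ) (u v : Phys d → ℝ) : ℝ :=
  ip G.Q (dt u) v + ipGrad G.Q u v
    + ∑ K, θ K * G.h K * (ip (G.elt K) (dt u) (dt v) + ipGrad (G.elt K) u (dt v))
    - ∑ K, θ K * G.h K * G.interiorFacetSum K u v

/-- The square of the discrete energy norm. -/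
def normLocSq (Ω : Set (EuclideanSpace ℝ (Fin d))) (T : ℝ) (θ : ι → ℝ) (v : Phys d → ℝ) : ℝ :=
  ipGrad G.Q v v + 1 / 2 * (∫ x in Ω, v (stPoint x T) ^ 2)
    + ∑ K, θ K * G.h K * ip (G.elt K) (dt v) (dt v)

end Geometry

end SpaceTimeIgA

/-! Test the form with u = v. Fubini and the fundamental theorem of calculus on vertical lines give
(∂_t v, v)_Q = ½‖v‖² on Σ_T, because v = 0 on Σ_0 (`ip_dt_self`). On an element, the divergence
theorem for the field (∂_t v ∇_x v, 0) says that the flux of n_x·∇_x v ∂_t v through ∂K is (Δ_x v,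
∂_t v)_K + (∇_x v, ∇_x ∂_t v)_K. The part of ∂K on ∂Q contributes nothing: n_x = 0 on the bottom and
the top, and on Σ the function v vanishes along vertical lines, so ∂_t v = 0
(`boundary_flux_eq_zero`). Hence the interior facets carry the whole flux (`interiorFacetSum_self`),
the mixed terms cancel, and the stabilisation reduces to the sum of δ_K (‖∂_t v‖²_K − (Δ_x v, ∂_t
v)_K).

Cauchy-Schwarz and the inverse inequality for the ∂_{x_l} v give ‖Δ_x v‖²_K ≤ d C² h_K⁻² ‖∇_x v‖²_K.
By Young's inequality and δ_K d C² h_K⁻² ≤ 1, which is the condition on θ_K, the remaining term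
costs at most half of δ_K ‖∂_t v‖²_K and half of ‖∇_x v‖²_K (`laplacian_bound`). Inverse constants
exist because the space is finite-dimensional and w = 0 in L²(K) forces ∇_x w = 0 on K
(`exists_inverse_of_family`).

The rest is regularity and geometry. Inner multiplicities at most p − 1 make NURBS C¹ up to the
boundary of the cube, so one-sided first derivatives exist and are continuous on the closure of Q.
On each closed element all functions are rational and extend smoothly to a neighbourhood, which
provides second derivatives. The divergence theorem is applied on the parameter box and carried to K
by the Piola identity (`sum_fderiv_piola`). Hanging nodes are allowed, so facets are matched with
box faces only almost everywhere, off the finitely many coordinate hyperplanes of the mesh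
(`sum_setIntegral_facePart`). -/

namespace SpaceTimeIgA

open scoped ContDiff Topology

/-! ### Smoothness and positivity of univariate B-splines -/

/-- The Cox-de Boor recursion started from arbitrary constants in degree zero. -/
def coxDeBoor (ξ : ℕ → ℝ) (f : ℕ → ℝ) : ℕ → ℕ → ℝ → ℝ
  | 0, i, _ => f i
  | q + 1, i, x =>
      (x - ξ i) / (ξ (i + q + 1) - ξ i) * coxDeBoor ξ f q i x
        + (ξ (i + q + 2) - x) / (ξ (i + q + 2) - ξ (i + 1)) * coxDeBoor ξ f q (i + 1) x

/-- The recursion sees a point only through its degree-zero values, so at a fixed `x` these may be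
frozen. With `f = Pi.single j 1` the frozen recursion is the polynomial piece on the `j`-th span. -/
theorem bspline_eq_coxDeBoor {ξ f : ℕ → ℝ} {x : ℝ} (h : ∀ i, bspline ξ 0 i x = f i) (q : ℕ) :
    ∀ i, bspline ξ q i x = coxDeBoor ξ f q i x := by
  induction q with
  | zero => exact h
  | succ q ih => intro i; rw [bspline, coxDeBoor, ih, ih]

/-- The usual B-spline derivative formula is an identity between polynomial pieces, so it holds at
every `x` and for arbitrary degree-zero constants. Repeated knots are covered by the convention `x /
0 = 0`. -/
theorem coxDeBoor_hasDerivAt {ξ : ℕ → ℝ} (hm : Monotone ξ) (f : ℕ → ℝ) (q : ℕ) (x : ℝ) :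
    ∀ i, HasDerivAt (coxDeBoor ξ f (q + 1) i)
      ((q + 1) * (coxDeBoor ξ f q i x / (ξ (i + q + 1) - ξ i)
        - coxDeBoor ξ f q (i + 1) x / (ξ (i + q + 2) - ξ (i + 1)))) x := by
  have h1 : ∀ a c : ℝ, HasDerivAt (fun x => (x - a) / c) (1 / c) x := fun a c =>
    ((hasDerivAt_id x).sub_const a).div_const c
  have h2 : ∀ a c : ℝ, HasDerivAt (fun x => (a - x) / c) (-1 / c) x := fun a c =>
    ((hasDerivAt_id x).const_sub a).div_const c
  induction q with
  | zero =>
    intro i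
    have := ((h1 (ξ i) (ξ (i + 0 + 1) - ξ i)).mul_const (f i)).add
      ((h2 (ξ (i + 0 + 2)) (ξ (i + 0 + 2) - ξ (i + 1))).mul_const (f (i + 1)))
    refine this.congr_deriv ?_
    simp only [coxDeBoor]
    push_cast
    ring
  | succ q ih =>
    intro i
    have := ((h1 (ξ i) (ξ (i + (q + 1) + 1) - ξ i)).mul (ih i)).add
      ((h2 (ξ (i + (q + 1) + 2)) (ξ (i + (q + 1) + 2) - ξ (i + 1))).mul (ih (i + 1)))
    refine this.congr_deriv ?_
    have m1 : ξ i ≤ ξ (i + 1) := hm (by omega)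
    have m2 : ξ (i + 1) ≤ ξ (i + q + 1) := hm (by omega)
    have m2' : ξ (i + 1) ≤ ξ (i + 2) := hm (by omega)
    have m3 : ξ (i + q + 1) ≤ ξ (i + q + 2) := hm (by omega)
    have m4 : ξ (i + q + 2) ≤ ξ (i + q + 3) := hm (by omega)
    have e1 : i + (q + 1) + 1 = i + q + 2 := by ring
    have e2 : i + (q + 1) + 2 = i + q + 3 := by ring
    have e3 : i + 1 + q + 1 = i + q + 2 := by ring
    have e4 : i + 1 + q + 2 = i + q + 3 := by ring
    have e5 : i + 1 + 1 = i + 2 := by ring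
    have e6 : i + 1 + 1 + q + 1 = i + q + 3 := by ring
    simp only [coxDeBoor, e1, e2, e3, e4, e5]
    push_cast
    generalize coxDeBoor ξ f q i x = A
    generalize coxDeBoor ξ f q (i + 1) x = B
    generalize coxDeBoor ξ f q (i + 2) x = C
    -- The induction step matches the coefficients of the three lower-degree functions. Only the
    -- middle one, `B`, needs an argument; if `b = c`, both sides vanish through `0⁻¹ = 0`.
    have key : ∀ a b c d : ℝ, a ≤ b → b ≤ c → c ≤ d →
        (c - b)⁻¹ * ((d - x) * (d - b)⁻¹ - (x - a) * (c - a)⁻¹)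
          = (c - b)⁻¹ * ((c - x) * (c - a)⁻¹ - (x - b) * (d - b)⁻¹) := by
      intro a b c d hab hbc hcd
      rcases hbc.eq_or_lt with h | h
      · simp [h]
      · have h1 : c - a ≠ 0 := by linarith
        have h2 : d - b ≠ 0 := by linarith
        field_simp
        ring
    have k := key (ξ i) (ξ (i + 1)) (ξ (i + q + 2)) (ξ (i + q + 3)) m1 (m2.trans m3) m4
    simp only [div_eq_mul_inv]
    linear_combination ((q : ℝ) + 1) * B * k

theorem coxDeBoor_sub (ξ f g : ℕ → ℝ) (q : ℕ) (x : ℝ) :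
    ∀ i, coxDeBoor ξ (f - g) q i x = coxDeBoor ξ f q i x - coxDeBoor ξ g q i x := by
  induction q with
  | zero => intro i; rfl
  | succ q ih => intro i; simp only [coxDeBoor, ih]; ring

/-- The two polynomial pieces meeting at a knot of multiplicity `m` agree there when the degree
is at least `m`. -/
theorem coxDeBoor_jump {ξ : ℕ → ℝ} {x : ℝ} {a m : ℕ} (hx : ∀ k, ξ k = x ↔ a < k ∧ k ≤ a + m)
    (hm : 1 ≤ m) (q : ℕ) : ∀ i,
    coxDeBoor ξ (Pi.single a 1 - Pi.single (a + m) 1) q i x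
      = if q < m then (if i = a then 1 else 0) - (if i + q = a + m then 1 else 0) else 0 := by
  have ha : ξ a ≠ x := fun h => by have := (hx a).1 h; omega
  have hb : ξ (a + m + 1) ≠ x := fun h => by have := (hx _).1 h; omega
  induction q with
  | zero =>
    intro i
    rw [if_pos (by omega)]
    simp [coxDeBoor, Pi.single_apply]
  | succ q ih =>
    intro i
    rw [coxDeBoor, ih, ih]
    -- While `q < m` only the entries `i = a` and `i + q = a + m` are nonzero. The recursion
    -- multiplies each by 1 in one summand and by 0 in the other. At degree `m` the two positions
    -- coincide and cancel.
    by_cases hq : q < m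
    · rw [if_pos hq, if_pos hq]
      have t1 : (x - ξ i) / (ξ (i + q + 1) - ξ i) *
          ((if i = a then (1 : ℝ) else 0) - (if i + q = a + m then 1 else 0))
          = (if i = a then 1 else 0) - (if i = a ∧ q = m then 1 else 0) := by
        by_cases hi : i = a
        · subst hi
          have : ξ (i + q + 1) = x := (hx _).2 (by omega)
          have h0 : x - ξ i ≠ 0 := sub_ne_zero.2 (Ne.symm ha)
          simp [this, div_self h0, hq.ne]
        · by_cases hi2 : i + q = a + m
          · have : ξ i = x := (hx _).2 (by omega)
            simp [this, hi]
          · simp [hi, hi2]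
      have t2 : (ξ (i + q + 2) - x) / (ξ (i + q + 2) - ξ (i + 1)) *
          ((if i + 1 = a then (1 : ℝ) else 0) - (if i + 1 + q = a + m then 1 else 0))
          = - (if i + 1 + q = a + m then 1 else 0) := by
        by_cases hi2 : i + 1 + q = a + m
        · have e : i + q + 2 = a + m + 1 := by omega
          have : ξ (i + 1) = x := (hx _).2 (by omega)
          have h0 : ξ (a + m + 1) - x ≠ 0 := sub_ne_zero.2 hb
          simp only [e, this, div_self h0, hi2]
          simp
          omega
        · by_cases hi : i + 1 = a
          · have : ξ (i + q + 2) = x := (hx _).2 (by omega)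
            simp [this, hi2]
          · simp [hi, hi2]
      rw [t1, t2]
      have e : i + (q + 1) = i + 1 + q := by ring
      rw [e]
      split_ifs <;> first | omega | simp
    · rw [if_neg hq, if_neg hq, if_neg (by omega)]; simp

/-- The degree-zero functions are indicators of disjoint spans, so exactly one of them is nonzero at
`x`. The second alternative is the closed right end of the last nonempty span. -/
theorem bspline_zero_of_mem {ξ : ℕ → ℝ} (hm : Monotone ξ) (h1 : ∀ i, ξ i ≤ 1) {j : ℕ} {x : ℝ}
    (h : ξ j ≤ x ∧ x < ξ (j + 1) ∨ x = 1 ∧ ξ j < 1 ∧ ξ (j + 1) = 1) (i : ℕ) :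
    bspline ξ 0 i x = (Pi.single j 1 : ℕ → ℝ) i := by
  classical
  rw [Pi.single_apply, bspline]
  by_cases hij : i = j
  · subst hij; simp [h]
  · rw [if_neg hij, if_neg]
    rcases lt_or_gt_of_ne hij with hl | hl
    · have := hm (show i + 1 ≤ j by omega)
      have := h1 (j + 1)
      rcases h with ⟨h, h2⟩ | ⟨h, h2, h3⟩ <;> rintro (⟨h', h4⟩ | ⟨h', h4, h5⟩) <;> linarith
    · have := hm (show j + 1 ≤ i by omega)
      have := h1 (i + 1)
      have := h1 i
      rcases h with ⟨h, h2⟩ | ⟨h, h2, h3⟩ <;> rintro (⟨h', h4⟩ | ⟨h', h4, h5⟩) <;> linarith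

theorem exists_lt_le_knot {ξ : ℕ → ℝ} {x : ℝ} (h0 : ξ 0 < x) {N : ℕ} (hN : x ≤ ξ N) :
    ∃ j, ξ j < x ∧ x ≤ ξ (j + 1) := by
  classical
  have hex : ∃ j, x ≤ ξ j := ⟨N, hN⟩
  obtain ⟨m, hm⟩ : ∃ m, Nat.find hex = m + 1 := by
    refine Nat.exists_eq_succ_of_ne_zero fun h => ?_
    have hs := Nat.find_spec hex
    rw [h] at hs; linarith
  refine ⟨m, not_le.1 (Nat.find_min hex (by omega)), hm ▸ Nat.find_spec hex⟩

theorem exists_le_lt_knot {ξ : ℕ → ℝ} {x : ℝ} (h0 : ξ 0 ≤ x) {N : ℕ} (hN : x < ξ N) :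
    ∃ j < N, ξ j ≤ x ∧ x < ξ (j + 1) := by
  classical
  have hex : ∃ j, x < ξ j := ⟨N, hN⟩
  have hle := Nat.find_min' hex hN
  obtain ⟨m, hm⟩ : ∃ m, Nat.find hex = m + 1 := by
    refine Nat.exists_eq_succ_of_ne_zero fun h => ?_
    have hs := Nat.find_spec hex
    rw [h] at hs; linarith
  refine ⟨m, by omega, not_lt.1 (Nat.find_min hex (by omega)), hm ▸ Nat.find_spec hex⟩

/-- The polynomial piece to the left of `x` has the right value at `x`. -/
theorem bspline_eq_left {ξ : ℕ → ℝ} (hm : Monotone ξ) (h1 : ∀ i, ξ i ≤ 1) {N : ℕ} (hN : ξ N = 1)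
    {q : ℕ} (hmul : ∀ x < 1, ξ 0 < x → {k | ξ k = x}.ncard ≤ q) {j : ℕ} {x : ℝ}
    (hj : ξ j < x) (hj' : x ≤ ξ (j + 1)) (i : ℕ) :
    bspline ξ q i x = coxDeBoor ξ (Pi.single j 1) q i x := by
  rcases hj'.lt_or_eq with h | h
  · exact bspline_eq_coxDeBoor (bspline_zero_of_mem hm h1 (Or.inl ⟨hj.le, h⟩)) q i
  by_cases hx1 : x = 1
  · exact bspline_eq_coxDeBoor (bspline_zero_of_mem hm h1
      (Or.inr ⟨hx1, hj.trans_le (hx1 ▸ le_rfl), by rw [← h, hx1]⟩)) q i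
  have hx1 : x < 1 := lt_of_le_of_ne (h ▸ h1 _) hx1
  -- Here `x` is an inner knot. With `l = j + m` the span to its right, the knots equal to `x` are
  -- those numbered `j+1, …, j+m`. Thus `m` is the multiplicity, at most `q`, and the left and right
  -- pieces agree at `x`.
  obtain ⟨l, -, hl, hl'⟩ := exists_le_lt_knot (ξ := ξ) (x := x) (N := N)
    ((hm (Nat.zero_le j)).trans hj.le) (hN ▸ hx1)
  have hjl : j < l := by
    by_contra hcon
    have := hm (show l + 1 ≤ j + 1 by omega)
    linarith
  obtain ⟨m, rfl⟩ : ∃ m, l = j + m := ⟨l - j, by omega⟩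
  have hk : ∀ k, ξ k = x ↔ j < k ∧ k ≤ j + m := by
    intro k
    constructor
    · intro hk
      constructor
      · by_contra hcon
        have := hm (show k ≤ j by omega)
        linarith
      · by_contra hcon
        have := hm (show j + m + 1 ≤ k by omega)
        linarith
    · rintro ⟨ha, hb⟩
      have := hm hb
      have := hm (show j + 1 ≤ k by omega)
      linarith
  have hcard : m ≤ q := by
    have : {k | ξ k = x} = (Finset.Ioc j (j + m) : Set ℕ) := by
      ext k; simp [hk]
    have h2 := hmul x hx1 ((hm (Nat.zero_le j)).trans_lt hj)
    rw [this, Set.ncard_coe_finset] at h2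
    simpa using h2
  have hjump := coxDeBoor_jump hk (by omega) q i
  rw [if_neg (by omega), coxDeBoor_sub, sub_eq_zero] at hjump
  rw [hjump]
  exact bspline_eq_coxDeBoor (bspline_zero_of_mem hm h1 (Or.inl ⟨hl, hl'⟩)) q i

theorem coxDeBoor_continuous (ξ f : ℕ → ℝ) (q : ℕ) : ∀ i, Continuous (coxDeBoor ξ f q i) := by
  induction q with
  | zero => intro i; exact continuous_const
  | succ q ih =>
    intro i
    have := ih i
    have := ih (i + 1)
    show Continuous fun x => (x - ξ i) / (ξ (i + q + 1) - ξ i) * coxDeBoor ξ f q i x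
        + (ξ (i + q + 2) - x) / (ξ (i + q + 2) - ξ (i + 1)) * coxDeBoor ξ f q (i + 1) x
    fun_prop

/-- To the right of each point of `[0,1)` a B-spline coincides with one polynomial piece. -/
theorem bspline_right_piece {ξ : ℕ → ℝ} (hm : Monotone ξ) (h0 : ξ 0 = 0) (h1 : ∀ i, ξ i ≤ 1)
    {N : ℕ} (hN : ξ N = 1) {x : ℝ} (hx : 0 ≤ x) (hx1 : x < 1) :
    ∃ j, ∃ y > x, ∀ q i, EqOn (bspline ξ q i) (coxDeBoor ξ (Pi.single j 1) q i) (Ico x y) := by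
  obtain ⟨l, -, hl, hl'⟩ := exists_le_lt_knot (ξ := ξ) (x := x) (N := N) (h0 ▸ hx) (hN ▸ hx1)
  refine ⟨l, ξ (l + 1), hl', fun q i y hy => ?_⟩
  exact bspline_eq_coxDeBoor (bspline_zero_of_mem hm h1 (Or.inl ⟨hl.trans hy.1, hy.2⟩)) q i

/-- To the left of each point of `(0,1]`, and in the point, a B-spline of sufficient degree
coincides with one polynomial piece. -/
theorem bspline_left_piece {ξ : ℕ → ℝ} (hm : Monotone ξ) (h0 : ξ 0 = 0) (h1 : ∀ i, ξ i ≤ 1)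
    {N : ℕ} (hN : ξ N = 1) {x : ℝ} (hx : 0 < x) (hx1 : x ≤ 1) :
    ∃ j, ∃ y < x, ∀ q, (∀ x < 1, ξ 0 < x → {k | ξ k = x}.ncard ≤ q) →
      ∀ i, EqOn (bspline ξ q i) (coxDeBoor ξ (Pi.single j 1) q i) (Ioc y x) := by
  obtain ⟨l, hl, hl'⟩ := exists_lt_le_knot (ξ := ξ) (x := x) (N := N) (h0 ▸ hx) (hN ▸ hx1)
  exact ⟨l, ξ l, hl, fun q hq i y hy => bspline_eq_left hm h1 hN hq hy.1 (hy.2.trans hl') i⟩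

theorem bspline_continuousOn {ξ : ℕ → ℝ} (hm : Monotone ξ) (h0 : ξ 0 = 0) (h1 : ∀ i, ξ i ≤ 1)
    {N : ℕ} (hN : ξ N = 1) {q : ℕ} (hmul : ∀ x < 1, ξ 0 < x → {k | ξ k = x}.ncard ≤ q) (i : ℕ) :
    ContinuousOn (bspline ξ q i) (Icc 0 1) := by
  intro x hx
  have hR : x < 1 → ContinuousWithinAt (bspline ξ q i) (Ici x) x := by
    intro hx1
    obtain ⟨j, y, hy, h⟩ := bspline_right_piece hm h0 h1 hN hx.1 hx1
    exact ((coxDeBoor_continuous ξ _ q i).continuousWithinAt.congr_of_eventuallyEq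
      (Filter.eventually_of_mem (Ico_mem_nhdsGE hy) fun z hz => h q i hz)
      (h q i ⟨le_rfl, hy⟩))
  have hL : 0 < x → ContinuousWithinAt (bspline ξ q i) (Iic x) x := by
    intro hx0
    obtain ⟨j, y, hy, h⟩ := bspline_left_piece hm h0 h1 hN hx0 hx.2
    exact ((coxDeBoor_continuous ξ _ q i).continuousWithinAt.congr_of_eventuallyEq
      (Filter.eventually_of_mem (Ioc_mem_nhdsLE hy) fun z hz => h q hmul i hz)
      (h q hmul i ⟨hy, le_rfl⟩))
  rcases hx.1.eq_or_lt with h | h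
  · exact (hR (by linarith)).mono fun z hz => h ▸ hz.1
  rcases hx.2.eq_or_lt with h' | h'
  · exact (hL h).mono fun z hz => h' ▸ hz.2
  · exact ((hL h).union (hR h')).mono (by simp)

theorem bspline_hasDerivWithinAt {ξ : ℕ → ℝ} (hm : Monotone ξ) (h0 : ξ 0 = 0)
    (h1 : ∀ i, ξ i ≤ 1) {N : ℕ} (hN : ξ N = 1) {q : ℕ}
    (hmul : ∀ x < 1, ξ 0 < x → {k | ξ k = x}.ncard ≤ q) (i : ℕ) {x : ℝ} (hx : x ∈ Icc (0 : ℝ) 1) :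
    HasDerivWithinAt (bspline ξ (q + 1) i)
      ((q + 1) * (bspline ξ q i x / (ξ (i + q + 1) - ξ i)
        - bspline ξ q (i + 1) x / (ξ (i + q + 2) - ξ (i + 1)))) (Icc 0 1) x := by
  set D := ((q + 1) * (bspline ξ q i x / (ξ (i + q + 1) - ξ i)
        - bspline ξ q (i + 1) x / (ξ (i + q + 2) - ξ (i + 1)))) with hD
  have hR : x < 1 → HasDerivWithinAt (bspline ξ (q + 1) i) D (Ici x) x := by
    intro hx1
    obtain ⟨j, y, hy, h⟩ := bspline_right_piece hm h0 h1 hN hx.1 hx1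
    have := coxDeBoor_hasDerivAt hm (Pi.single j 1) q x i
    rw [← h q i ⟨le_rfl, hy⟩, ← h q (i + 1) ⟨le_rfl, hy⟩] at this
    exact this.hasDerivWithinAt.congr_of_eventuallyEq
      (Filter.eventually_of_mem (Ico_mem_nhdsGE hy) fun z hz => h _ i hz)
      (h _ i ⟨le_rfl, hy⟩)
  have hL : 0 < x → HasDerivWithinAt (bspline ξ (q + 1) i) D (Iic x) x := by
    intro hx0
    obtain ⟨j, y, hy, h⟩ := bspline_left_piece hm h0 h1 hN hx0 hx.2
    have hmul' : ∀ x < 1, ξ 0 < x → {k | ξ k = x}.ncard ≤ q + 1 := fun x a b =>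
      (hmul x a b).trans (Nat.le_succ _)
    have := coxDeBoor_hasDerivAt hm (Pi.single j 1) q x i
    rw [← h q hmul i ⟨hy, le_rfl⟩, ← h q hmul (i + 1) ⟨hy, le_rfl⟩] at this
    exact this.hasDerivWithinAt.congr_of_eventuallyEq
      (Filter.eventually_of_mem (Ioc_mem_nhdsLE hy) fun z hz => h _ hmul' i hz)
      (h _ hmul' i ⟨hy, le_rfl⟩)
  rcases hx.1.eq_or_lt with h | h
  · exact (hR (by linarith)).mono fun z hz => h ▸ hz.1
  rcases hx.2.eq_or_lt with h' | h'
  · exact (hL h).mono fun z hz => h' ▸ hz.2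
  · exact ((hL h).union (hR h')).mono (by simp)

/-- A function that is continuously differentiable on `[0,1]` extends to a continuously
differentiable function on the line. -/
theorem exists_contDiff_extension {f f' : ℝ → ℝ} (hf' : ContinuousOn f' (Icc 0 1))
    (hf : ∀ x ∈ Icc (0 : ℝ) 1, HasDerivWithinAt f (f' x) (Icc 0 1) x) :
    ∃ b : ℝ → ℝ, ContDiff ℝ 1 b ∧ EqOn f b (Icc 0 1) := by
  have h01 : (0 : ℝ) ≤ 1 := zero_le_one
  -- Extend the derivative by its end values and integrate: the primitive is C¹ on the line and
  -- agrees with `f` on `[0,1]`.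
  set g : ℝ → ℝ := IccExtend h01 ((Icc 0 1).domRestrict f') with hg
  have hgc : Continuous g := (continuousOn_iff_continuous_domRestrict.1 hf').Icc_extend'
  have hder : ∀ x, HasDerivAt (fun x => f 0 + ∫ t in (0 : ℝ)..x, g t) (g x) x := fun x =>
    (hgc.integral_hasStrictDerivAt 0 x).hasDerivAt.const_add _
  refine ⟨fun x => f 0 + ∫ t in (0 : ℝ)..x, g t, ?_, ?_⟩
  · rw [contDiff_one_iff_deriv]
    refine ⟨fun x => (hder x).differentiableAt, ?_⟩
    rw [show deriv (fun x => f 0 + ∫ t in (0 : ℝ)..x, g t) = g from funext fun x => (hder x).deriv]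
    exact hgc
  · intro x hx
    have key : ∫ t in (0 : ℝ)..x, g t = f x - f 0 := by
      have h1 : ∫ t in (0 : ℝ)..x, g t = ∫ t in (0 : ℝ)..x, f' t := by
        refine intervalIntegral.integral_congr fun t ht => ?_
        rw [uIcc_of_le hx.1] at ht
        exact IccExtend_of_mem h01 _ ⟨ht.1, ht.2.trans hx.2⟩
      rw [h1]
      refine intervalIntegral.integral_eq_sub_of_hasDeriv_right_of_le hx.1
        (fun t ht => ((hf t ⟨ht.1, ht.2.trans hx.2⟩).continuousWithinAt).mono
          (Icc_subset_Icc_right hx.2)) (f' := f') (fun t ht => ?_) ?_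
      · exact ((hf t ⟨ht.1.le, ht.2.le.trans hx.2⟩).hasDerivAt
          (Icc_mem_nhds ht.1 (ht.2.trans_le hx.2))).hasDerivWithinAt
      · refine ContinuousOn.intervalIntegrable ?_
        rw [uIcc_of_le hx.1]
        exact hf'.mono (Icc_subset_Icc_right hx.2)
    simp [key]

/-- The derivative is a combination of B-splines of degree `p - 1`, which are continuous because
inner multiplicities are at most `p - 1`. -/
theorem KnotVector.exists_contDiff_bspline {p : ℕ} (hp : 2 ≤ p) (k : KnotVector p) (i : ℕ) :
    ∃ b : ℝ → ℝ, ContDiff ℝ 1 b ∧ EqOn (bspline k.knot p i) b (Icc 0 1) := by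
  obtain ⟨q, rfl⟩ : ∃ q, p = q + 1 := ⟨p - 1, by omega⟩
  have h0 : k.knot 0 = 0 := k.left 0 (Nat.zero_le _)
  have h1 : ∀ i, k.knot i ≤ 1 := fun i => (SplineSpace.knot_mem k i).2
  have hN : k.knot k.n = 1 := k.right _ le_rfl
  have hmul : ∀ x < 1, k.knot 0 < x → {i | k.knot i = x}.ncard ≤ q := by
    intro x hx1 hx0
    have := k.mult x (h0 ▸ hx0) hx1
    omega
  refine exists_contDiff_extension ?_
    (fun x hx => bspline_hasDerivWithinAt k.mono h0 h1 hN hmul i hx)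
  have c1 := bspline_continuousOn k.mono h0 h1 hN hmul i
  have c2 := bspline_continuousOn k.mono h0 h1 hN hmul (i + 1)
  exact continuousOn_const.mul ((c1.div_const _).sub (c2.div_const _))

/-- The last B-spline active on a span stays positive under the recursion: its second summand is
positive for `x < ξ (j + 1)` and the first is nonnegative. Together with `bspline_one_pos`, which
treats the end point 1, this keeps the weighting function away from zero. -/
theorem bspline_pos_left {ξ : ℕ → ℝ} (hm : Monotone ξ) {j : ℕ} {x : ℝ}
    (h : ξ j ≤ x) (h' : x < ξ (j + 1)) (q : ℕ) : ∀ i, i + q = j → 0 < bspline ξ q i x := by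
  classical
  induction q with
  | zero => intro i hi; obtain rfl : i = j := by omega
            simp [bspline, h, h']
  | succ q ih =>
    intro i hi
    have hp := ih (i + 1) (by omega)
    have hn := (SplineSpace.bspline_nonneg ξ hm q x i).1
    have e : i + q + 2 = j + 1 := by omega
    rw [bspline, e]
    have m1 := hm (show i ≤ j by omega)
    have m2 := hm (show i + 1 ≤ j by omega)
    have m3 := hm (show i ≤ i + q + 1 by omega)
    refine add_pos_of_nonneg_of_pos (mul_nonneg (div_nonneg (by linarith) (by linarith)) hn)
      (mul_pos (div_pos (by linarith) (by linarith)) hp)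

theorem bspline_one_pos {ξ : ℕ → ℝ} (hm : Monotone ξ) {j : ℕ} (h : ξ j < 1)
    (h' : ∀ i, j < i → ξ i = 1) (q : ℕ) : 0 < bspline ξ q j 1 := by
  classical
  induction q with
  | zero => simp [bspline, h, h' (j + 1) (by omega)]
  | succ q ih =>
    have hn := (SplineSpace.bspline_nonneg ξ hm q 1 (j + 1)).1
    rw [bspline, h' (j + q + 1) (by omega), h' (j + q + 2) (by omega)]
    simp only [sub_self, zero_div, zero_mul, add_zero]
    exact mul_pos (div_pos (by linarith) (by linarith)) ih

theorem KnotVector.exists_bspline_pos {p : ℕ} (k : KnotVector p) {x : ℝ} (hx : x ∈ Icc (0 : ℝ) 1) :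
    ∃ i : Fin k.n, 0 < bspline k.knot p i x := by
  have h0 : k.knot 0 = 0 := k.left 0 (Nat.zero_le _)
  have hN : k.knot k.n = 1 := k.right _ le_rfl
  have hn := k.lt_n
  rcases hx.2.lt_or_eq with h | rfl
  · obtain ⟨j, hj, h1, h2⟩ := exists_le_lt_knot (ξ := k.knot) (h0 ▸ hx.1) (hN ▸ h)
    have hpj : p ≤ j := by
      by_contra hcon
      rw [k.left (j + 1) (by omega)] at h2
      linarith [hx.1]
    exact ⟨⟨j - p, by omega⟩, bspline_pos_left k.mono h1 h2 p _ (by simp; omega)⟩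
  · refine ⟨⟨k.n - 1, by omega⟩, bspline_one_pos k.mono ?_
      (fun i hi => k.right i (by simp at hi; omega)) p⟩
    rcases Nat.lt_or_ge p (k.n - 1) with h | h
    · exact (k.inner _ h (by omega)).2
    · show k.knot (k.n - 1) < 1
      rw [k.left _ h]; exact zero_lt_one

/-! ### The Piola identity and the divergence theorem in curvilinear coordinates -/

/-- Jacobian matrix of a map of the parameter space into itself. -/
def jacMatrix {d : ℕ} (ψ : Param d → Param d) (ξ : Param d) :
    Matrix (Fin (d + 1)) (Fin (d + 1)) ℝ :=
  Matrix.of fun k α => fderiv ℝ ψ ξ (Pi.single α 1) k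

/-- The physical partial derivative `∂_k`, expressed in the coordinates given by `ψ`. -/
def pullPd {d : ℕ} (ψ : Param d → Param d) (k : Fin (d + 1)) (f : Param d → ℝ) (ξ : Param d) : ℝ :=
  ∑ α, fderiv ℝ f ξ (Pi.single α 1) * (jacMatrix ψ ξ)⁻¹ α k

/-! ### Regularity of Jacobians, adjugates and physical derivatives. -/

section Smooth

variable {d : ℕ} {ψ : Param d → Param d} {U : Set (Param d)} {m n : WithTop ℕ∞}

theorem contDiffOn_fderiv_single {F : Type*} [NormedAddCommGroup F] [NormedSpace ℝ F]
    {f : Param d → F} (hU : IsOpen U) (hf : ContDiffOn ℝ n f U)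
    (hmn : m + 1 ≤ n) (v : Param d) : ContDiffOn ℝ m (fun ξ => fderiv ℝ f ξ v) U :=
  (hf.fderiv_of_isOpen hU hmn).clm_apply contDiffOn_const

theorem contDiffOn_jacMatrix (hU : IsOpen U) (hψ : ContDiffOn ℝ n ψ U) (hmn : m + 1 ≤ n)
    (k α : Fin (d + 1)) : ContDiffOn ℝ m (fun ξ => jacMatrix ψ ξ k α) U :=
  contDiffOn_pi.1 (contDiffOn_fderiv_single hU hψ hmn (Pi.single α 1)) k

theorem contDiffOn_det {ι : Type*} [Fintype ι] [DecidableEq ι] {M : Param d → Matrix ι ι ℝ}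
    (h : ∀ i j, ContDiffOn ℝ m (fun ξ => M ξ i j) U) : ContDiffOn ℝ m (fun ξ => (M ξ).det) U := by
  simp only [Matrix.det_apply]
  exact ContDiffOn.sum fun σ _ => (contDiffOn_prod fun i _ => h (σ i) i).const_smul _

theorem contDiffOn_adjugate {M : Param d → Matrix (Fin (d + 1)) (Fin (d + 1)) ℝ}
    (h : ∀ i j, ContDiffOn ℝ m (fun ξ => M ξ i j) U) (i j : Fin (d + 1)) :
    ContDiffOn ℝ m (fun ξ => (M ξ).adjugate i j) U := by
  simp only [Matrix.adjugate_apply]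
  refine contDiffOn_det fun k l => ?_
  by_cases hk : k = j
  · subst hk; simpa using contDiffOn_const
  · simpa [Matrix.updateRow_ne hk] using h k l

theorem inv_eq_det_inv_mul_adjugate {N : Type*} [Fintype N] [DecidableEq N] (A : Matrix N N ℝ)
    (i j : N) : A⁻¹ i j = A.det⁻¹ * A.adjugate i j := by
  rw [Matrix.inv_def, Ring.inverse_eq_inv', Matrix.smul_apply, smul_eq_mul]

theorem contDiffOn_pullPd (hU : IsOpen U) (hψ : ContDiffOn ℝ n ψ U) (hmn : m + 1 ≤ n)
    (hdet : ∀ ξ ∈ U, (jacMatrix ψ ξ).det ≠ 0) {f : Param d → ℝ} (hf : ContDiffOn ℝ n f U)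
    (k : Fin (d + 1)) : ContDiffOn ℝ m (pullPd ψ k f) U := by
  have hJ := contDiffOn_jacMatrix hU hψ hmn
  refine ContDiffOn.sum fun α _ => (contDiffOn_fderiv_single hU hf hmn _).mul ?_
  simp only [inv_eq_det_inv_mul_adjugate]
  exact ((contDiffOn_det hJ).inv hdet).mul (contDiffOn_adjugate hJ _ _)

end Smooth

section Piola

variable {d : ℕ} {ψ : Param d → Param d} {ξ : Param d}

/-- Cramer's rule, transposed so that the columns of the Jacobian become the arguments of a
multilinear map that can be differentiated. -/
theorem adjugate_eq_det_update {N : Type*} [Fintype N] [DecidableEq N] (A : Matrix N N ℝ)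
    (α k : N) : A.adjugate α k
      = Matrix.detRowAlternating (Function.update A.transpose α (Pi.single k 1)) := by
  have h := congrFun (Matrix.cramer_eq_adjugate_mulVec A (Pi.single k 1)) α
  rw [Matrix.cramer_apply] at h
  rw [Matrix.mulVec_single_one] at h
  rw [show A.adjugate α k = A.adjugate.col k α from rfl, ← h, ← Matrix.det_transpose,
    ← Matrix.updateRow_transpose]
  rfl

/-- The determinant as a continuous multilinear map of the rows. -/
def detMultilinear (N : Type*) [Fintype N] [DecidableEq N] :
    ContinuousMultilinearMap ℝ (fun _ : N => N → ℝ) ℝ where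
  toMultilinearMap := (Matrix.detRowAlternating : (N → ℝ) [⋀^N]→ₗ[ℝ] ℝ).toMultilinearMap
  cont := Continuous.matrix_det (A := fun M : Matrix N N ℝ => M) continuous_id

/-- Exchanging `α` and `β` swaps two rows and keeps `H`, so the double sum equals its own negative.
With `H` the second derivatives of a map, this is the Piola identity. -/
theorem sum_det_update_update_eq_zero {N : Type*} [Fintype N] [DecidableEq N]
    (c : N → N → ℝ) (e : N → ℝ) (H : N → N → N → ℝ) (hH : ∀ α β, H α β = H β α) :
    ∑ α, ∑ β, (if β = α then 0 else Matrix.detRowAlternating (R := ℝ)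
      (Function.update (Function.update c α e) β (H α β))) = 0 := by
  set T : N → N → ℝ := fun α β => if β = α then 0 else Matrix.detRowAlternating (R := ℝ)
      (Function.update (Function.update c α e) β (H α β)) with hT
  have hanti : ∀ α β, T α β = - T β α := by
    intro α β
    simp only [hT]
    by_cases h : β = α
    · simp [h]
    · rw [if_neg h, if_neg (Ne.symm h), ← AlternatingMap.map_swap _ _ h]
      congr 1
      ext γ
      simp only [Function.comp_apply]
      by_cases h1 : γ = α
      · subst h1
        simp [Function.update_of_ne (Ne.symm h), h]
      · by_cases h2 : γ = β
        · subst h2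
          simp [hH]
        · rw [Equiv.swap_apply_of_ne_of_ne h2 h1]
          simp [h1, h2]
  have h1 : ∑ α, ∑ β, T α β = ∑ α, ∑ β, T β α := Finset.sum_comm
  have h2 : ∑ α, ∑ β, T α β = - ∑ α, ∑ β, T β α := by
    simp only [← Finset.sum_neg_distrib]
    exact Finset.sum_congr rfl fun α _ => Finset.sum_congr rfl fun β _ => hanti α β
  show ∑ α, ∑ β, T α β = 0
  linarith

/-- The rows of the adjugate of a Jacobian matrix are divergence free. -/
theorem sum_fderiv_adjugate_eq_zero (hψ : ContDiffAt ℝ 2 ψ ξ) (k : Fin (d + 1)) :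
    ∑ α, fderiv ℝ (fun ξ => (jacMatrix ψ ξ).adjugate α k) ξ (Pi.single α 1) = 0 := by
  have hf : DifferentiableAt ℝ (fderiv ℝ ψ) ξ :=
    (hψ.fderiv_right (m := 1) (by norm_num)).differentiableAt one_ne_zero
  have hsymm : IsSymmSndFDerivAt ℝ ψ ξ := hψ.isSymmSndFDerivAt (by simp)
  set c : Fin (d + 1) → Param d → Param d := fun β ξ => fderiv ℝ ψ ξ (Pi.single β 1) with hc
  have hcd : ∀ β, HasFDerivAt (c β) ((fderiv ℝ (fderiv ℝ ψ) ξ).flip (Pi.single β 1)) ξ := by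
    intro β
    have := hf.hasFDerivAt.clm_apply (hasFDerivAt_const (Pi.single β (1 : ℝ)) ξ)
    refine this.congr_fderiv ?_
    ext v : 1
    simp
  set H : Fin (d + 1) → Fin (d + 1) → Param d := fun α β =>
    fderiv ℝ (fderiv ℝ ψ) ξ (Pi.single α 1) (Pi.single β 1) with hH
  rw [← sum_det_update_update_eq_zero (fun β => c β ξ) (Pi.single k 1) H
    (fun α β => hsymm _ _)]
  refine Finset.sum_congr rfl fun α _ => ?_
  -- The columns of the Jacobian with the `α`-th frozen at the unit vector `k`. The frozen slot has
  -- zero derivative, which accounts for the vanishing diagonal terms of the double sum.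
  set g : Fin (d + 1) → Param d → Param d := Function.update c α (fun _ => Pi.single k 1) with hg
  set g' : Fin (d + 1) → Param d →L[ℝ] Param d :=
    Function.update (fun β => (fderiv ℝ (fderiv ℝ ψ) ξ).flip (Pi.single β 1)) α 0 with hg'
  have hgg : ∀ β, HasFDerivAt (g β) (g' β) ξ := by
    intro β
    by_cases h : β = α
    · subst h
      simp only [hg, hg', Function.update_self]
      exact hasFDerivAt_const _ _
    · simp only [hg, hg', Function.update_of_ne h]
      exact hcd β
  have gval : ∀ ζ, (fun β => g β ζ) = Function.update (fun β => c β ζ) α (Pi.single k 1) := by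
    intro ζ
    ext1 β
    by_cases h : β = α
    · subst h; simp [hg]
    · simp [hg, h]
  have heq : (fun ζ => (jacMatrix ψ ζ).adjugate α k)
      = fun ζ => detMultilinear (Fin (d + 1)) (fun β => g β ζ) := by
    ext ζ
    rw [adjugate_eq_det_update, gval]
    rfl
  rw [heq, (HasFDerivAt.multilinear_comp (detMultilinear (Fin (d + 1))) hgg).fderiv]
  rw [sum_apply]
  refine Finset.sum_congr rfl fun β _ => ?_
  rw [ContinuousLinearMap.comp_apply, ContinuousMultilinearMap.toContinuousLinearMap_apply, gval]
  by_cases h : β = α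
  · subst h
    rw [if_pos rfl]
    simp only [hg', Function.update_self, zero_apply]
    exact (detMultilinear (Fin (d + 1))).toMultilinearMap.map_coord_zero β (by simp)
  · rw [if_neg h]
    simp only [hg', Function.update_of_ne h]
    rfl

/-- The Piola transform of a vector field has divergence `det J` times the physical divergence. -/
theorem sum_fderiv_piola (hψ : ContDiffAt ℝ 2 ψ ξ) (hdet : (jacMatrix ψ ξ).det ≠ 0)
    {F : Fin (d + 1) → Param d → ℝ} (hF : ∀ k, DifferentiableAt ℝ (F k) ξ) :
    ∑ α, fderiv ℝ (fun ξ => ∑ k, (jacMatrix ψ ξ).adjugate α k * F k ξ) ξ (Pi.single α 1)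
      = (jacMatrix ψ ξ).det * ∑ k, pullPd ψ k (F k) ξ := by
  have hadj : ∀ α k, DifferentiableAt ℝ (fun ξ => (jacMatrix ψ ξ).adjugate α k) ξ := by
    intro α k
    obtain ⟨u, hu, hψu⟩ := hψ.contDiffOn (m := 2) le_rfl (by simp)
    obtain ⟨w, hw, hwo, hξw⟩ := mem_nhds_iff.1 (by simpa using hu)
    have := contDiffOn_adjugate (contDiffOn_jacMatrix (m := 1) hwo (hψu.mono hw) (by norm_num)) α k
    exact (this.contDiffAt (hwo.mem_nhds hξw)).differentiableAt one_ne_zero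
  have h1 : ∀ α, fderiv ℝ (fun ξ => ∑ k, (jacMatrix ψ ξ).adjugate α k * F k ξ) ξ (Pi.single α 1)
      = ∑ k, ((jacMatrix ψ ξ).adjugate α k * fderiv ℝ (F k) ξ (Pi.single α 1)
        + F k ξ * fderiv ℝ (fun ξ => (jacMatrix ψ ξ).adjugate α k) ξ (Pi.single α 1)) := by
    intro α
    rw [fderiv_fun_sum fun k _ => (hadj α k).fun_mul (hF k), sum_apply]
    refine Finset.sum_congr rfl fun k _ => ?_
    rw [fderiv_fun_mul (hadj α k) (hF k)]
    simp
  simp only [h1]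
  rw [Finset.sum_comm, Finset.mul_sum]
  refine Finset.sum_congr rfl fun k _ => ?_
  -- The derivatives falling on the adjugate cancel by the Piola identity.
  rw [Finset.sum_add_distrib, ← Finset.mul_sum, sum_fderiv_adjugate_eq_zero hψ, mul_zero, add_zero,
    pullPd, Finset.mul_sum]
  refine Finset.sum_congr rfl fun α _ => ?_
  rw [inv_eq_det_inv_mul_adjugate]
  field_simp

/-- The divergence theorem on the image of a box. -/
theorem integral_det_mul_divergence {U : Set (Param d)} (hU : IsOpen U) {a b : Param d}
    (hab : a ≤ b) (hsub : Icc a b ⊆ U) (hψ : ContDiffOn ℝ ∞ ψ U)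
    (hdet : ∀ ξ ∈ U, (jacMatrix ψ ξ).det ≠ 0)
    {F : Fin (d + 1) → Param d → ℝ} (hF : ∀ k, ContDiffOn ℝ ∞ (F k) U) :
    ∫ ξ in Icc a b, (jacMatrix ψ ξ).det * ∑ k, pullPd ψ k (F k) ξ
      = ∑ α : Fin (d + 1),
        ((∫ z in Icc (a ∘ α.succAbove) (b ∘ α.succAbove),
            ∑ k, (jacMatrix ψ (α.insertNth (b α) z)).adjugate α k * F k (α.insertNth (b α) z))
          - ∫ z in Icc (a ∘ α.succAbove) (b ∘ α.succAbove),
            ∑ k, (jacMatrix ψ (α.insertNth (a α) z)).adjugate α k * F k (α.insertNth (a α) z)) := by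
  have hJ := contDiffOn_jacMatrix (m := ∞) hU hψ (by simp)
  set G : Fin (d + 1) → Param d → ℝ := fun α ξ => ∑ k, (jacMatrix ψ ξ).adjugate α k * F k ξ
  have hG : ∀ α, ContDiffOn ℝ ∞ (G α) U := fun α =>
    ContDiffOn.sum fun k _ => (contDiffOn_adjugate hJ α k).mul (hF k)
  have hdiv : ∀ ξ ∈ U, ∑ α, fderiv ℝ (G α) ξ (Pi.single α 1)
      = (jacMatrix ψ ξ).det * ∑ k, pullPd ψ k (F k) ξ := fun ξ hξ =>
    sum_fderiv_piola ((hψ.contDiffAt (hU.mem_nhds hξ)).of_le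
      (WithTop.coe_le_coe.2 (le_top : (2 : ℕ∞) ≤ ⊤))) (hdet ξ hξ)
      fun k => ((hF k).contDiffAt (hU.mem_nhds hξ)).differentiableAt (by simp)
  rw [← setIntegral_congr_fun measurableSet_Icc fun ξ hξ => hdiv ξ (hsub hξ)]
  refine integral_divergence_of_hasFDerivAt_off_countable' a b hab G (fun α => fderiv ℝ (G α)) ∅
    countable_empty (fun α => (hG α).continuousOn.mono hsub) (fun ξ hξ α => ?_) ?_
  · have hξU : ξ ∈ U := hsub ⟨fun i => (hξ.1 i (mem_univ i)).1.le,
      fun i => (hξ.1 i (mem_univ i)).2.le⟩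
    exact (((hG α).contDiffAt (hU.mem_nhds hξU)).differentiableAt (by simp)).hasFDerivAt
  · refine ContinuousOn.integrableOn_compact isCompact_Icc (continuousOn_finsetSum _ fun α _ => ?_)
    exact (contDiffOn_fderiv_single (m := ∞) hU (hG α) (by simp) _).continuousOn.mono hsub

end Piola

/-! ### Smooth extensions of NURBS and of the geometrical map -/

theorem mem_closedCube {d : ℕ} {ξ : Param d} : ξ ∈ closedCube d ↔ ∀ α, ξ α ∈ Icc (0 : ℝ) 1 :=
  ⟨fun h α => ⟨h.1 α, h.2 α⟩, fun h => ⟨fun α => (h α).1, fun α => (h α).2⟩⟩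

theorem mem_openBox {d : ℕ} {a b ξ : Param d} : ξ ∈ openBox a b ↔ ∀ α, a α < ξ α ∧ ξ α < b α := by
  simp [openBox]

theorem isOpen_openBox {d : ℕ} (a b : Param d) : IsOpen (openBox a b) :=
  isOpen_set_pi finite_univ fun _ _ => isOpen_Ioo

theorem openBox_subset_Icc {d : ℕ} (a b : Param d) : openBox a b ⊆ Icc a b := fun _ h =>
  ⟨fun α => ((mem_openBox.1 h) α).1.le, fun α => ((mem_openBox.1 h) α).2.le⟩

theorem closure_openBox {d : ℕ} {a b : Param d} (h : ∀ α, a α < b α) :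
    closure (openBox a b) = Icc a b := by
  rw [openBox, closure_pi_set, ← pi_univ_Icc]
  congr 1
  ext1 α
  exact closure_Ioo (h α).ne

theorem uniqueDiffOn_Icc_pi {d : ℕ} {a b : Param d} (h : ∀ α, a α < b α) :
    UniqueDiffOn ℝ (Icc a b) := by
  rw [← pi_univ_Icc]
  exact UniqueDiffOn.univ_pi fun α => uniqueDiffOn_Icc (h α)

theorem openCube_subset_closedCube (d : ℕ) : openCube d ⊆ closedCube d :=
  openBox_subset_Icc _ _

theorem openCube_mem_nhds {d : ℕ} {ξ : Param d} (h : ξ ∈ openCube d) : closedCube d ∈ 𝓝 ξ :=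
  Filter.mem_of_superset ((isOpen_openBox _ _).mem_nhds h) (openCube_subset_closedCube d)

theorem isCompact_closedCube (d : ℕ) : IsCompact (closedCube d) := isCompact_Icc

theorem uniqueDiffOn_closedCube (d : ℕ) : UniqueDiffOn ℝ (closedCube d) :=
  uniqueDiffOn_Icc_pi fun _ => zero_lt_one

theorem contDiff_mvPolynomial_eval {σ : Type*} [Fintype σ] (q : MvPolynomial σ ℝ)
    {n : WithTop ℕ∞} : ContDiff ℝ n fun ξ : σ → ℝ => MvPolynomial.eval ξ q := by
  induction q using MvPolynomial.induction_on with
  | C a => simpa using contDiff_const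
  | add p q hp hq => simpa using hp.add hq
  | mul_X p i hp => simpa using hp.mul (contDiff_apply ℝ ℝ i)

namespace NurbsBasis

variable {d p : ℕ} (B : NurbsBasis d p)

theorem exists_contDiff_tensorB (hp : 2 ≤ p) (i : B.Index) :
    ∃ f : Param d → ℝ, ContDiff ℝ 1 f ∧ EqOn (B.tensorB i) f (closedCube d) := by
  choose b hb hbe using fun α => (B.Ξ α).exists_contDiff_bspline hp (i α)
  refine ⟨fun ξ => ∏ α, b α (ξ α), contDiff_prod fun α _ => (hb α).comp (contDiff_apply ℝ ℝ α),
    fun ξ hξ => Finset.prod_congr rfl fun α _ => hbe α (mem_closedCube.1 hξ α)⟩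

theorem tensorB_nonneg (i : B.Index) (ξ : Param d) : 0 ≤ B.tensorB i ξ :=
  Finset.prod_nonneg fun α _ => (SplineSpace.bspline_nonneg _ (B.Ξ α).mono _ _ _).1

theorem weight_pos {ξ : Param d} (hξ : ξ ∈ closedCube d) : 0 < B.weight ξ := by
  choose i hi using fun α => (B.Ξ α).exists_bspline_pos (mem_closedCube.1 hξ α)
  exact Finset.sum_pos' (fun j _ => mul_nonneg (B.w_pos j).le (B.tensorB_nonneg j ξ))
    ⟨i, Finset.mem_univ _, mul_pos (B.w_pos i) (Finset.prod_pos fun α _ => hi α)⟩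

theorem exists_contDiff_weight (hp : 2 ≤ p) :
    ∃ f : Param d → ℝ, ContDiff ℝ 1 f ∧ EqOn B.weight f (closedCube d) := by
  choose b hb hbe using B.exists_contDiff_tensorB hp
  exact ⟨fun ξ => ∑ i, B.w i * b i ξ, ContDiff.sum fun i _ => contDiff_const.mul (hb i),
    fun ξ hξ => Finset.sum_congr rfl fun i _ => by rw [hbe i hξ]⟩

/-- All NURBS extend to `C¹` functions on one neighbourhood of the closed cube. -/
theorem exists_contDiffOn_nurbsSpace (hp : 2 ≤ p) :
    ∃ U : Set (Param d), IsOpen U ∧ closedCube d ⊆ U ∧ ∀ s ∈ B.nurbsSpace,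
      ∃ f : Param d → ℝ, ContDiffOn ℝ 1 f U ∧ EqOn s f (closedCube d) := by
  obtain ⟨W, hW, hWe⟩ := B.exists_contDiff_weight hp
  -- The denominator is common to all NURBS, so the nonvanishing set of its C¹ extension serves
  -- every `s` at once.
  refine ⟨{ξ | W ξ ≠ 0}, isOpen_ne_fun hW.continuous continuous_const,
    fun ξ hξ => by rw [mem_ofPred_eq, ← hWe hξ]; exact (B.weight_pos hξ).ne', fun s hs => ?_⟩
  induction hs using Submodule.span_induction with
  | mem s hs =>
    obtain ⟨i, rfl⟩ := hs
    obtain ⟨b, hb, hbe⟩ := B.exists_contDiff_tensorB hp i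
    exact ⟨fun ξ => B.w i * b ξ / W ξ, (contDiff_const.mul hb).contDiffOn.div hW.contDiffOn
      fun ξ h => h, fun ξ hξ => by simp only [nurbs, hbe hξ, hWe hξ]⟩
  | zero => exact ⟨0, contDiffOn_const, fun ξ _ => rfl⟩
  | add s t _ _ hs ht =>
    obtain ⟨f, hf, hfe⟩ := hs
    obtain ⟨g, hg, hge⟩ := ht
    exact ⟨f + g, hf.add hg, fun ξ hξ => by simp [hfe hξ, hge hξ]⟩
  | smul c s _ hs =>
    obtain ⟨f, hf, hfe⟩ := hs
    exact ⟨c • f, hf.const_smul c, fun ξ hξ => by simp [hfe hξ]⟩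

theorem differentiableWithinAt_of_mem (hp : 2 ≤ p) {s : Param d → ℝ} (hs : s ∈ B.nurbsSpace)
    {ξ : Param d} (hξ : ξ ∈ closedCube d) : DifferentiableWithinAt ℝ s (closedCube d) ξ := by
  obtain ⟨U, hU, hsub, h⟩ := B.exists_contDiffOn_nurbsSpace hp
  obtain ⟨f, hf, hfe⟩ := h s hs
  exact ((((hf.contDiffAt (hU.mem_nhds (hsub hξ))).differentiableAt
    one_ne_zero).differentiableWithinAt).congr hfe (hfe hξ))

theorem continuousOn_of_mem (hp : 2 ≤ p) {s : Param d → ℝ} (hs : s ∈ B.nurbsSpace) :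
    ContinuousOn s (closedCube d) := fun _ hξ =>
  (B.differentiableWithinAt_of_mem hp hs hξ).continuousWithinAt

end NurbsBasis

namespace SplineSpace

variable {d p : ℕ} {B : NurbsBasis d p} {ι : Type*} (S : SplineSpace B ι)

theorem Icc_subset (K : ι) : Icc (S.lo K) (S.hi K) ⊆ closedCube d :=
  S.cover ▸ subset_iUnion (fun K => Icc (S.lo K) (S.hi K)) K

theorem openBox_subset_openCube (K : ι) : openBox (S.lo K) (S.hi K) ⊆ openCube d := by
  have hlh : S.lo K ≤ S.hi K := fun α => (S.lo_lt_hi K α).le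
  have h1 := mem_closedCube.1 (S.Icc_subset K (left_mem_Icc.2 hlh))
  have h2 := mem_closedCube.1 (S.Icc_subset K (right_mem_Icc.2 hlh))
  intro ξ hξ
  refine mem_openBox.2 fun α => ?_
  have := mem_openBox.1 hξ α
  exact ⟨(h1 α).1.trans_lt this.1, this.2.trans_le (h2 α).2⟩

/-- On each closed element all functions of the space extend to smooth functions on one
neighbourhood of the element. -/
theorem exists_contDiffOn_element (hp : 2 ≤ p) (K : ι) :
    ∃ U : Set (Param d), IsOpen U ∧ Icc (S.lo K) (S.hi K) ⊆ U ∧ ∀ s ∈ S.space,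
      ∃ f : Param d → ℝ, ContDiffOn ℝ ∞ f U ∧ EqOn s f (Icc (S.lo K) (S.hi K)) := by
  obtain ⟨W, hW, hWe⟩ := B.exists_contDiff_weight hp
  have hWc : ContinuousOn B.weight (closedCube d) := hW.continuous.continuousOn.congr hWe
  have hcl := closure_openBox (S.lo_lt_hi K)
  obtain ⟨q, -, hq⟩ := S.poly_weight K
  -- The mesh provides polynomials on the open box only; continuity of the splines carries the
  -- identity to the closed box.
  have hq' : EqOn B.weight (fun ξ => MvPolynomial.eval ξ q) (Icc (S.lo K) (S.hi K)) :=
    EqOn.of_subset_closure hq (hWc.mono (S.Icc_subset K))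
      (contDiff_mvPolynomial_eval (n := 0) q).continuous.continuousOn
      (openBox_subset_Icc _ _) hcl.ge
  refine ⟨{ξ | MvPolynomial.eval ξ q ≠ 0},
    isOpen_ne_fun (contDiff_mvPolynomial_eval (n := 0) q).continuous continuous_const,
    fun ξ hξ => ?_, fun s hs => ?_⟩
  · have := hq' hξ
    simp only at this
    rw [mem_ofPred_eq, ← this]
    exact (B.weight_pos (S.Icc_subset K hξ)).ne'
  · obtain ⟨r, -, hr⟩ := S.poly s hs K
    have hr' : EqOn (fun ξ => B.weight ξ * s ξ) (fun ξ => MvPolynomial.eval ξ r)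
        (Icc (S.lo K) (S.hi K)) :=
      EqOn.of_subset_closure hr
        ((hWc.mul (B.continuousOn_of_mem hp (S.space_le hs))).mono (S.Icc_subset K))
        (contDiff_mvPolynomial_eval (n := 0) r).continuous.continuousOn
        (openBox_subset_Icc _ _) hcl.ge
    refine ⟨fun ξ => MvPolynomial.eval ξ r / MvPolynomial.eval ξ q,
      (contDiff_mvPolynomial_eval r).contDiffOn.div (contDiff_mvPolynomial_eval q).contDiffOn
      fun ξ h => h, fun ξ hξ => ?_⟩
    have h1 := hq' hξ
    have h2 := hr' hξ
    simp only at h1 h2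
    have h3 := (B.weight_pos (S.Icc_subset K hξ)).ne'
    simp only
    rw [← h1, ← h2]
    field_simp

end SplineSpace

/-! ### Charts: extensions of the geometrical map beyond a closed box. -/

namespace Geometry

variable {d p : ℕ} {B : NurbsBasis d p} {ι : Type*} {S : SplineSpace B ι} (G : Geometry S)

theorem Φ_mem (k : Fin (d + 1)) : (fun ξ => G.Φ ξ k) ∈ S.space := G.isogeometric k

theorem Φ_injOn : InjOn G.Φ (closedCube d) := G.injOn

theorem differentiableWithinAt_Φ (hp : 2 ≤ p) {ξ : Param d} (hξ : ξ ∈ closedCube d) :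
    DifferentiableWithinAt ℝ G.Φ (closedCube d) ξ :=
  differentiableWithinAt_euclidean.2 fun k =>
    B.differentiableWithinAt_of_mem hp (S.space_le (G.Φ_mem k)) hξ

theorem continuousOn_Φ (hp : 2 ≤ p) : ContinuousOn G.Φ (closedCube d) := fun _ hξ =>
  (G.differentiableWithinAt_Φ hp hξ).continuousWithinAt

theorem jac_det_ne_zero {ξ : Param d} (hξ : ξ ∈ closedCube d) : (G.jac ξ).det ≠ 0 :=
  G.det_ne_zero ξ hξ

theorem jac_apply (hp : 2 ≤ p) {ξ : Param d} (hξ : ξ ∈ closedCube d) (k α : Fin (d + 1)) :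
    G.jac ξ k α = fderivWithin ℝ (fun ξ => G.Φ ξ k) (closedCube d) ξ (Pi.single α 1) := by
  have h := hasFDerivWithinAt_euclidean.1 (G.differentiableWithinAt_Φ hp hξ).hasFDerivWithinAt k
  rw [h.fderivWithin (uniqueDiffOn_closedCube d ξ hξ)]
  rfl

/-- `∂_k (s ∘ Φ⁻¹)` as a function of the parameter. -/
def grad (k : Fin (d + 1)) (s : Param d → ℝ) (ξ : Param d) : ℝ :=
  ∑ α, fderivWithin ℝ s (closedCube d) ξ (Pi.single α 1) * (G.jac ξ)⁻¹ α k

/-- A smooth extension of the geometrical map and of the spline space to a neighbourhood of the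
box with corners `a` and `b`. -/
structure Chart (n : WithTop ℕ∞) (a b : Param d) where
  lt : ∀ α, a α < b α
  subset_cube : Icc a b ⊆ closedCube d
  U : Set (Param d)
  isOpen_U : IsOpen U
  subset_U : Icc a b ⊆ U
  ψ : Param d → Param d
  contDiffOn_ψ : ContDiffOn ℝ n ψ U
  jac_eq : ∀ ξ ∈ Icc a b, jacMatrix ψ ξ = G.jac ξ
  det_ne : ∀ ξ ∈ U, (jacMatrix ψ ξ).det ≠ 0
  lift : ∀ s ∈ S.space, ∃ f : Param d → ℝ, ContDiffOn ℝ n f U ∧ EqOn s f (Icc a b)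

/-- Both are derivatives of `s` within the smaller box, where derivatives are unique even at the
boundary. -/
theorem fderivWithin_eq_fderiv {a b : Param d} (hlt : ∀ α, a α < b α)
    (hsub : Icc a b ⊆ closedCube d) {s f : Param d → ℝ} (h : EqOn s f (Icc a b)) {ξ : Param d}
    (hξ : ξ ∈ Icc a b) (hs : DifferentiableWithinAt ℝ s (closedCube d) ξ)
    (hf : DifferentiableAt ℝ f ξ) : fderivWithin ℝ s (closedCube d) ξ = fderiv ℝ f ξ :=
  (uniqueDiffOn_Icc_pi hlt ξ hξ).eq (hs.hasFDerivWithinAt.mono hsub)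
    (hf.hasFDerivAt.hasFDerivWithinAt.congr h (h hξ))

theorem exists_chart (hp : 2 ≤ p) {n : WithTop ℕ∞} (hn : 1 ≤ n) {a b : Param d}
    (hlt : ∀ α, a α < b α) (hsub : Icc a b ⊆ closedCube d) {U : Set (Param d)} (hU : IsOpen U)
    (hsubU : Icc a b ⊆ U) (hlift : ∀ s ∈ S.space,
      ∃ f : Param d → ℝ, ContDiffOn ℝ n f U ∧ EqOn s f (Icc a b)) :
    Nonempty (G.Chart n a b) := by
  choose f hf hfe using fun k => hlift _ (G.Φ_mem k)
  set ψ : Param d → Param d := fun ξ k => f k ξ with hψ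
  have hψd : ContDiffOn ℝ n ψ U := contDiffOn_pi.2 hf
  have hn0 : n ≠ 0 := fun h => by simp [h] at hn
  have hjac : ∀ ξ ∈ Icc a b, jacMatrix ψ ξ = G.jac ξ := by
    intro ξ hξ
    ext k α
    have hd : ∀ k, DifferentiableAt ℝ (f k) ξ := fun k =>
      ((hf k).contDiffAt (hU.mem_nhds (hsubU hξ))).differentiableAt hn0
    rw [G.jac_apply hp (hsub hξ), fderivWithin_eq_fderiv hlt hsub (hfe k) hξ
      (B.differentiableWithinAt_of_mem hp (S.space_le (G.Φ_mem k)) (hsub hξ)) (hd k)]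
    simp only [jacMatrix, Matrix.of_apply, hψ]
    rw [fderiv_pi hd]
    rfl
  have hdet : ContinuousOn (fun ξ => (jacMatrix ψ ξ).det) U :=
    (contDiffOn_det (m := 0) (contDiffOn_jacMatrix hU hψd (by simpa using hn))).continuousOn
  exact ⟨{ lt := hlt
           subset_cube := hsub
           -- Shrinking to the set where the determinant does not vanish keeps the inverse Jacobian
           -- smooth beyond the box.
           U := U ∩ (fun ξ => (jacMatrix ψ ξ).det) ⁻¹' {0}ᶜ
           isOpen_U := hdet.isOpen_inter_preimage hU isOpen_compl_singleton
           subset_U := fun ξ hξ => ⟨hsubU hξ, by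
            simp only [mem_preimage, mem_compl_iff, mem_singleton_iff]
            rw [hjac ξ hξ]; exact G.jac_det_ne_zero (hsub hξ)⟩
           ψ := ψ
           contDiffOn_ψ := hψd.mono inter_subset_left
           jac_eq := hjac
           det_ne := fun ξ hξ => hξ.2
           lift := fun s hs => by
            obtain ⟨g, hg, hge⟩ := hlift s hs
            exact ⟨g, hg.mono inter_subset_left, hge⟩ }⟩

/-- Two kinds of charts are used. The C¹ chart of the whole cube yields continuity of first
derivatives up to ∂Q; the smooth charts of single elements allow the second derivatives. -/
theorem nonempty_chart_cube (hp : 2 ≤ p) : Nonempty (G.Chart 1 0 1) := by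
  obtain ⟨U, hU, hsub, h⟩ := B.exists_contDiffOn_nurbsSpace hp
  exact G.exists_chart hp le_rfl (fun _ => zero_lt_one) le_rfl hU hsub
    fun s hs => h s (S.space_le hs)

theorem nonempty_chart_element (hp : 2 ≤ p) (K : ι) : Nonempty (G.Chart ∞ (S.lo K) (S.hi K)) := by
  obtain ⟨U, hU, hsub, h⟩ := S.exists_contDiffOn_element hp K
  exact G.exists_chart hp (by simp) (S.lo_lt_hi K) (S.Icc_subset K) hU hsub h

/-- Derivatives computed from the chosen extension are intrinsic on the closed box: they equal
`grad`, which involves neither the chart nor the extension. -/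
theorem Chart.pullPd_eq (hp : 2 ≤ p) {n : WithTop ℕ∞} (hn : n ≠ 0) {a b : Param d}
    (χ : G.Chart n a b) {s f : Param d → ℝ} (hs : s ∈ S.space) (hf : ContDiffOn ℝ n f χ.U)
    (h : EqOn s f (Icc a b)) (k : Fin (d + 1)) {ξ : Param d} (hξ : ξ ∈ Icc a b) :
    pullPd χ.ψ k f ξ = G.grad k s ξ := by
  rw [pullPd, grad, χ.jac_eq ξ hξ, fderivWithin_eq_fderiv χ.lt χ.subset_cube h hξ
    (B.differentiableWithinAt_of_mem hp (S.space_le hs) (χ.subset_cube hξ))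
    ((hf.contDiffAt (χ.isOpen_U.mem_nhds (χ.subset_U hξ))).differentiableAt hn)]

theorem continuousOn_grad (hp : 2 ≤ p) {s : Param d → ℝ} (hs : s ∈ S.space) (k : Fin (d + 1)) :
    ContinuousOn (G.grad k s) (closedCube d) := by
  obtain ⟨χ⟩ := G.nonempty_chart_cube hp
  obtain ⟨f, hf, hfe⟩ := χ.lift s hs
  exact ((contDiffOn_pullPd (m := 0) χ.isOpen_U χ.contDiffOn_ψ (by simp) χ.det_ne hf
    k).continuousOn.mono χ.subset_U).congr fun ξ hξ =>
      (Chart.pullPd_eq G hp one_ne_zero χ hs hf hfe k hξ).symm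

theorem continuousOn_jac_det (hp : 2 ≤ p) :
    ContinuousOn (fun ξ => (G.jac ξ).det) (closedCube d) := by
  obtain ⟨χ⟩ := G.nonempty_chart_cube hp
  have := contDiffOn_det (m := 0) (contDiffOn_jacMatrix χ.isOpen_U χ.contDiffOn_ψ (by simp))
  exact (this.continuousOn.mono χ.subset_U).congr fun ξ hξ => by simp only [χ.jac_eq ξ hξ]

/-! ### The inverse of the geometrical map -/

theorem Φinv_Φ {ξ : Param d} (hξ : ξ ∈ closedCube d) : G.Φinv (G.Φ ξ) = ξ :=
  G.Φ_injOn.leftInvOn_invFunOn hξ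

theorem Φ_Φinv {y : Phys d} (hy : y ∈ G.Φ '' closedCube d) : G.Φ (G.Φinv y) = y :=
  Function.invFunOn_eq hy

theorem Φinv_mem {y : Phys d} (hy : y ∈ G.Φ '' closedCube d) : G.Φinv y ∈ closedCube d :=
  Function.invFunOn_mem hy

/-- A continuous injection of a compact set has a continuous inverse, because images of closed
subsets are compact. -/
theorem continuousOn_Φinv (hp : 2 ≤ p) : ContinuousOn G.Φinv (G.Φ '' closedCube d) := by
  rw [continuousOn_iff_isClosed]
  intro t ht
  refine ⟨G.Φ '' (closedCube d ∩ t),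
    (((isCompact_closedCube d).inter_right ht).image_of_continuousOn
      ((G.continuousOn_Φ hp).mono inter_subset_left)).isClosed, ?_⟩
  ext y
  constructor
  · rintro ⟨h1, h2⟩
    exact ⟨⟨_, ⟨G.Φinv_mem h2, h1⟩, G.Φ_Φinv h2⟩, h2⟩
  · rintro ⟨⟨ξ, ⟨h1, h2⟩, rfl⟩, h3⟩
    refine ⟨?_, h3⟩
    rw [mem_preimage, G.Φinv_Φ h1]
    exact h2

/-- The coordinates of the geometrical map, as a map of the parameter space into itself. -/
def Ψ (ξ : Param d) : Param d := WithLp.ofLp (G.Φ ξ)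

theorem hasFDerivWithinAt_Ψ (hp : 2 ≤ p) {ξ : Param d} (hξ : ξ ∈ closedCube d) :
    HasFDerivWithinAt G.Ψ (LinearMap.toContinuousLinearMap (Matrix.toLin' (G.jac ξ)))
      (closedCube d) ξ := by
  rw [hasFDerivWithinAt_pi']
  intro k
  have h := (B.differentiableWithinAt_of_mem hp (S.space_le (G.Φ_mem k)) hξ).hasFDerivWithinAt
  refine h.congr_fderiv ?_
  refine ContinuousLinearMap.coe_injective ((Pi.basisFun ℝ (Fin (d + 1))).ext fun α => ?_)
  simp [← G.jac_apply hp hξ]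

/-- A continuous inverse of a map with invertible derivative is differentiable with the inverse
derivative. Working relative to the image of the closed cube includes boundary points, where only
one-sided derivatives are available. -/
theorem exists_hasFDerivWithinAt_Φinv (hp : 2 ≤ p) {ξ : Param d} (hξ : ξ ∈ closedCube d) :
    ∃ L : Phys d →L[ℝ] Param d, HasFDerivWithinAt G.Φinv L (G.Φ '' closedCube d) (G.Φ ξ) ∧
      ∀ k α, L (EuclideanSpace.single k 1) α = (G.jac ξ)⁻¹ α k := by
  set A := LinearMap.toContinuousLinearMap (Matrix.toLin' (G.jac ξ)) with hA
  have hdet : A.det ≠ 0 := by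
    rw [hA, LinearMap.det_toContinuousLinearMap, LinearMap.det_toLin']
    exact G.jac_det_ne_zero hξ
  have hder : HasFDerivWithinAt G.Ψ (A.toContinuousLinearEquivOfDetNeZero hdet :
      Param d →L[ℝ] Param d) (closedCube d) (G.Φinv (WithLp.toLp 2 (G.Ψ ξ))) := by
    show HasFDerivWithinAt G.Ψ _ _ (G.Φinv (G.Φ ξ))
    rw [G.Φinv_Φ hξ, ContinuousLinearMap.coe_toContinuousLinearEquivOfDetNeZero]
    exact G.hasFDerivWithinAt_Ψ hp hξ
  set e := EuclideanSpace.equiv (Fin (d + 1)) ℝ with he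
  have hmaps : ∀ x ∈ G.Ψ '' closedCube d, WithLp.toLp 2 x ∈ G.Φ '' closedCube d := by
    rintro _ ⟨ζ, hζ, rfl⟩; exact ⟨ζ, hζ, rfl⟩
  have hinv := HasFDerivWithinAt.of_local_left_inverse (s := G.Ψ '' closedCube d)
    (g := fun x => G.Φinv (WithLp.toLp 2 x)) (a := G.Ψ ξ) (f := G.Ψ) (t := closedCube d)
    (f' := A.toContinuousLinearEquivOfDetNeZero hdet) ?_ hder ⟨ξ, hξ, rfl⟩ ?_
  · refine ⟨_, hinv.comp (G.Φ ξ) (t := G.Ψ '' closedCube d) (f := e)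
      e.hasFDerivAt.hasFDerivWithinAt ?_, ?_⟩
    · rintro _ ⟨ζ, hζ, rfl⟩; exact ⟨ζ, hζ, rfl⟩
    · intro k α
      have h1 : (A.toContinuousLinearEquivOfDetNeZero hdet).symm (Pi.single k 1)
          = (G.jac ξ)⁻¹.mulVec (Pi.single k 1) := by
        rw [ContinuousLinearEquiv.symm_apply_eq,
          ContinuousLinearMap.toContinuousLinearEquivOfDetNeZero_apply, hA]
        simp only [LinearMap.coe_toContinuousLinearMap', Matrix.toLin'_apply, Matrix.mulVec_mulVec]
        rw [Matrix.mul_nonsing_inv _ (isUnit_iff_ne_zero.2 (G.jac_det_ne_zero hξ)),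
          Matrix.one_mulVec]
      have h2 : e (EuclideanSpace.single k (1 : ℝ)) = Pi.single k 1 := rfl
      simp only [ContinuousLinearMap.comp_apply, ContinuousLinearEquiv.coe_coe, h2, h1,
        Matrix.mulVec_single_one]
      rfl
  · refine tendsto_nhdsWithin_iff.2 ⟨?_, Filter.eventually_of_mem self_mem_nhdsWithin
      fun x hx => G.Φinv_mem (hmaps x hx)⟩
    exact ((G.continuousOn_Φinv hp).comp e.symm.continuous.continuousOn hmaps) _ ⟨ξ, hξ, rfl⟩
  · refine Filter.eventually_of_mem self_mem_nhdsWithin fun x hx => ?_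
    exact congrArg WithLp.ofLp (G.Φ_Φinv (hmaps x hx))

theorem clm_apply_eq_sum {F : Type*} [NormedAddCommGroup F] [NormedSpace ℝ F]
    (A : Param d →L[ℝ] F) (x : Param d) : A x = ∑ α, x α • A (Pi.single α 1) := by
  conv_lhs => rw [← (Pi.basisFun ℝ (Fin (d + 1))).sum_repr x]
  simp

/-- Derivative of a push-forward, one-sided at the boundary. -/
theorem exists_hasFDerivWithinAt_comp_Φinv (hp : 2 ≤ p) {s : Param d → ℝ} {ξ : Param d}
    (hξ : ξ ∈ closedCube d) (hs : DifferentiableWithinAt ℝ s (closedCube d) ξ) :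
    ∃ L : Phys d →L[ℝ] ℝ, HasFDerivWithinAt (s ∘ G.Φinv) L (G.Φ '' closedCube d) (G.Φ ξ) ∧
      ∀ k, L (EuclideanSpace.single k 1) = G.grad k s ξ := by
  obtain ⟨L, hL, hLk⟩ := G.exists_hasFDerivWithinAt_Φinv hp hξ
  have h1 : HasFDerivWithinAt s (fderivWithin ℝ s (closedCube d) ξ) (closedCube d)
      (G.Φinv (G.Φ ξ)) := by
    rw [G.Φinv_Φ hξ]; exact hs.hasFDerivWithinAt
  refine ⟨_, h1.comp _ hL fun y hy => G.Φinv_mem hy, fun k => ?_⟩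
  rw [ContinuousLinearMap.comp_apply, clm_apply_eq_sum, grad]
  refine Finset.sum_congr rfl fun α _ => ?_
  rw [hLk, smul_eq_mul, mul_comm]

theorem Q_subset : G.Q ⊆ G.Φ '' closedCube d := image_mono (openCube_subset_closedCube d)

theorem Q_mem_nhds (hQ : IsOpen G.Q) {ξ : Param d} (hξ : ξ ∈ openCube d) :
    G.Φ '' closedCube d ∈ 𝓝 (G.Φ ξ) :=
  Filter.mem_of_superset (hQ.mem_nhds ⟨ξ, hξ, rfl⟩) G.Q_subset

/-- Invariance of domain is not needed: the image is the preimage of `W` under the continuous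
inverse inside `Q`, which is assumed open. -/
theorem isOpen_image (hp : 2 ≤ p) (hQ : IsOpen G.Q) {W : Set (Param d)} (hW : IsOpen W)
    (hsub : W ⊆ openCube d) : IsOpen (G.Φ '' W) := by
  have : G.Φ '' W = G.Q ∩ G.Φinv ⁻¹' W := by
    ext y
    constructor
    · rintro ⟨ξ, hξ, rfl⟩
      refine ⟨⟨ξ, hsub hξ, rfl⟩, ?_⟩
      rw [mem_preimage, G.Φinv_Φ (openCube_subset_closedCube d (hsub hξ))]
      exact hξ
    · rintro ⟨h1, h2⟩
      exact ⟨_, h2, G.Φ_Φinv (G.Q_subset h1)⟩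
  rw [this]
  exact ((G.continuousOn_Φinv hp).mono G.Q_subset).isOpen_inter_preimage hQ hW

/-- Derivative of a function that is locally a push-forward. -/
theorem exists_hasFDerivAt (hp : 2 ≤ p) (hQ : IsOpen G.Q) {ξ : Param d} (hξ : ξ ∈ openCube d)
    {w : Phys d → ℝ} {f : Param d → ℝ} (hw : ∀ᶠ ζ in 𝓝 ξ, w (G.Φ ζ) = f ζ)
    (hf : DifferentiableAt ℝ f ξ) : ∃ L : Phys d →L[ℝ] ℝ, HasFDerivAt w L (G.Φ ξ) ∧
      ∀ k, L (EuclideanSpace.single k 1) = G.grad k f ξ := by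
  have hξ' := openCube_subset_closedCube d hξ
  have hn := G.Q_mem_nhds hQ hξ
  obtain ⟨L, hL, hLk⟩ := G.exists_hasFDerivWithinAt_comp_Φinv hp hξ' hf.differentiableWithinAt
  refine ⟨L, (hL.hasFDerivAt hn).congr_of_eventuallyEq ?_, hLk⟩
  have hc : ContinuousAt G.Φinv (G.Φ ξ) := (G.continuousOn_Φinv hp).continuousAt hn
  have ht : Filter.Tendsto G.Φinv (𝓝 (G.Φ ξ)) (𝓝 ξ) := by
    have := hc.tendsto
    rwa [G.Φinv_Φ hξ'] at this
  filter_upwards [ht.eventually hw, hn] with y hy hy'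
  rw [G.Φ_Φinv hy'] at hy
  exact hy

theorem pd_eq (hp : 2 ≤ p) (hQ : IsOpen G.Q) {ξ : Param d} (hξ : ξ ∈ openCube d)
    {w : Phys d → ℝ} {f : Param d → ℝ} (hw : ∀ᶠ ζ in 𝓝 ξ, w (G.Φ ζ) = f ζ)
    (hf : DifferentiableAt ℝ f ξ) (k : Fin (d + 1)) : pd k w (G.Φ ξ) = G.grad k f ξ := by
  obtain ⟨L, hL, hLk⟩ := G.exists_hasFDerivAt hp hQ hξ hw hf
  rw [pd, hL.fderiv, hLk]

/-! ### Change of variables -/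

theorem image_eq_preimage (W : Set (Param d)) :
    G.Φ '' W = WithLp.ofLp ⁻¹' (G.Ψ '' W) := by
  ext y
  constructor
  · rintro ⟨ξ, hξ, rfl⟩; exact ⟨ξ, hξ, rfl⟩
  · rintro ⟨ξ, hξ, h⟩; exact ⟨ξ, hξ, WithLp.ofLp_injective 2 h⟩

theorem measurableEmbedding_ofLp {n : Type*} [Fintype n] :
    MeasurableEmbedding (WithLp.ofLp : EuclideanSpace ℝ n → n → ℝ) :=
  (MeasurableEquiv.toLp 2 (n → ℝ)).symm.measurableEmbedding

theorem Ψ_injOn : InjOn G.Ψ (closedCube d) := fun _ hx _ hy h =>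
  G.Φ_injOn hx hy (WithLp.ofLp_injective 2 h)

theorem setIntegral_image (hp : 2 ≤ p) {W : Set (Param d)} (hW : MeasurableSet W)
    (hsub : W ⊆ closedCube d) (g : Phys d → ℝ) :
    ∫ y in G.Φ '' W, g y = ∫ ξ in W, |(G.jac ξ).det| * g (G.Φ ξ) := by
  have h1 := (PiLp.volume_preserving_ofLp (Fin (d + 1))).setIntegral_preimage_emb
    measurableEmbedding_ofLp (fun x => g (WithLp.toLp 2 x)) (G.Ψ '' W)
  rw [G.image_eq_preimage]
  refine (Eq.trans ?_ h1).trans ?_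
  · rfl
  · rw [integral_image_eq_integral_abs_det_fderiv_smul volume hW
      (fun ξ hξ => (G.hasFDerivWithinAt_Ψ hp (hsub hξ)).mono hsub) (G.Ψ_injOn.mono hsub)]
    simp only [LinearMap.det_toContinuousLinearMap, LinearMap.det_toLin']
    rfl

theorem integrableOn_image (hp : 2 ≤ p) {W : Set (Param d)} (hW : MeasurableSet W)
    (hsub : W ⊆ closedCube d) (g : Phys d → ℝ) :
    IntegrableOn g (G.Φ '' W) ↔ IntegrableOn (fun ξ => |(G.jac ξ).det| * g (G.Φ ξ)) W := by
  have h1 := (PiLp.volume_preserving_ofLp (Fin (d + 1))).integrableOn_comp_preimage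
    measurableEmbedding_ofLp (f := fun x => g (WithLp.toLp 2 x)) (s := G.Ψ '' W)
  rw [G.image_eq_preimage]
  refine (Iff.trans ?_ h1).trans ?_
  · rfl
  · rw [integrableOn_image_iff_integrableOn_abs_det_fderiv_smul volume hW
      (fun ξ hξ => (G.hasFDerivWithinAt_Ψ hp (hsub hξ)).mono hsub) (G.Ψ_injOn.mono hsub)]
    simp only [LinearMap.det_toContinuousLinearMap, LinearMap.det_toLin']
    rfl

/-- A function on the image of an open box is integrable if its pull-back is continuous up to the
boundary. -/
theorem integrableOn_of_continuousOn (hp : 2 ≤ p) {a b : Param d} (hsub : Icc a b ⊆ closedCube d)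
    {g : Phys d → ℝ} {f : Param d → ℝ} (hf : ContinuousOn f (Icc a b))
    (h : ∀ ξ ∈ openBox a b, g (G.Φ ξ) = f ξ) : IntegrableOn g (G.Φ '' openBox a b) := by
  have hm := (isOpen_openBox a b).measurableSet
  rw [G.integrableOn_image hp hm ((openBox_subset_Icc a b).trans hsub)]
  have : IntegrableOn (fun ξ => |(G.jac ξ).det| * f ξ) (openBox a b) :=
    (ContinuousOn.integrableOn_compact isCompact_Icc
      (((G.continuousOn_jac_det hp).mono hsub).abs.mul hf)).mono_set (openBox_subset_Icc a b)
  exact this.congr_fun (fun ξ hξ => by simp only [h ξ hξ]) hm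

end Geometry

/-! ### Inverse inequalities -/

/-- `T` factors through the range of `A`, and a linear map on this finite-dimensional range is
bounded. -/
theorem exists_norm_le_of_ker_le {V E F : Type*} [AddCommGroup V] [Module ℝ V]
    [FiniteDimensional ℝ V] [NormedAddCommGroup E] [NormedSpace ℝ E] [NormedAddCommGroup F]
    [NormedSpace ℝ F] (A : V →ₗ[ℝ] E) (T : V →ₗ[ℝ] F) (h : LinearMap.ker A ≤ LinearMap.ker T) :
    ∃ C : ℝ, 0 < C ∧ ∀ v, ‖T v‖ ≤ C * ‖A v‖ := by
  let g : LinearMap.range A →ₗ[ℝ] F := ((LinearMap.ker A).liftQ T h) ∘ₗ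
    (A.quotKerEquivRange.symm : LinearMap.range A →ₗ[ℝ] V ⧸ LinearMap.ker A)
  have hg : ∀ v, g ⟨A v, v, rfl⟩ = T v := by
    intro v
    have : A.quotKerEquivRange.symm ⟨A v, v, rfl⟩ = (LinearMap.ker A).mkQ v := by
      rw [LinearEquiv.symm_apply_eq]; rfl
    simp only [g, LinearMap.comp_apply, LinearEquiv.coe_coe, this]
    rfl
  refine ⟨‖LinearMap.toContinuousLinearMap g‖ + 1, by positivity, fun v => ?_⟩
  rw [← hg v]
  refine ((LinearMap.toContinuousLinearMap g).le_opNorm ⟨A v, v, rfl⟩).trans ?_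
  have : ‖(⟨A v, v, rfl⟩ : LinearMap.range A)‖ = ‖A v‖ := rfl
  rw [this]
  gcongr
  linarith

theorem exists_sqrt_sum_norm_sq_le {V E F κ : Type*} [Fintype κ] [AddCommGroup V] [Module ℝ V]
    [FiniteDimensional ℝ V] [NormedAddCommGroup E] [NormedSpace ℝ E] [NormedAddCommGroup F]
    [NormedSpace ℝ F] (A : V →ₗ[ℝ] E) (D : κ → V →ₗ[ℝ] F)
    (h : ∀ v, A v = 0 → ∀ l, D l v = 0) :
    ∃ C : ℝ, 0 < C ∧ ∀ v, √(∑ l, ‖D l v‖ ^ 2) ≤ C * ‖A v‖ := by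
  let T : V →ₗ[ℝ] PiLp 2 (fun _ : κ => F) :=
    (WithLp.linearEquiv 2 ℝ (κ → F)).symm.toLinearMap ∘ₗ LinearMap.pi D
  obtain ⟨C, hC, hT⟩ := exists_norm_le_of_ker_le A T fun v hv =>
    (WithLp.linearEquiv 2 ℝ (κ → F)).injective (funext fun l => h v hv l)
  refine ⟨C, hC, fun v => ?_⟩
  have := hT v
  rwa [PiLp.norm_eq_of_L2] at this

theorem norm_toLp_sq {X : Type*} [MeasurableSpace X] {μ : Measure X} {f : X → ℝ}
    (hf : MemLp f 2 μ) : ‖hf.toLp f‖ ^ 2 = ∫ x, f x * f x ∂μ := by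
  rw [← real_inner_self_eq_norm_sq, L2.inner_def]
  refine integral_congr_ae ?_
  filter_upwards [hf.coeFn_toLp] with x hx
  simp [hx, sq]

/-- The linear map into `L²` given by a family of square integrable functions. -/
def toL2 {V X : Type*} [AddCommGroup V] [Module ℝ V] [MeasurableSpace X] {μ : Measure X}
    (F : V → X → ℝ) (hF : ∀ v, MemLp (F v) 2 μ) (hadd : ∀ u v, F (u + v) =ᵐ[μ] F u + F v)
    (hsmul : ∀ (c : ℝ) v, F (c • v) =ᵐ[μ] c • F v) : V →ₗ[ℝ] Lp ℝ 2 μ where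
  toFun v := (hF v).toLp (F v)
  map_add' u v := by
    rw [← MemLp.toLp_add]
    exact MemLp.toLp_congr _ ((hF u).add (hF v)) (hadd u v)
  map_smul' c v := by
    rw [RingHom.id_apply, ← MemLp.toLp_const_smul]
    exact MemLp.toLp_congr _ ((hF v).const_smul c) (hsmul c v)

theorem norm_toL2_sq {V X : Type*} [AddCommGroup V] [Module ℝ V] [MeasurableSpace X]
    {μ : Measure X} (F : V → X → ℝ) (hF : ∀ v, MemLp (F v) 2 μ)
    (hadd : ∀ u v, F (u + v) =ᵐ[μ] F u + F v) (hsmul : ∀ (c : ℝ) v, F (c • v) =ᵐ[μ] c • F v)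
    (v : V) : ‖toL2 F hF hadd hsmul v‖ ^ 2 = ∫ x, F v x * F v x ∂μ :=
  norm_toLp_sq (hF v)

theorem toL2_eq_zero_iff {V X : Type*} [AddCommGroup V] [Module ℝ V] [MeasurableSpace X]
    {μ : Measure X} (F : V → X → ℝ) (hF : ∀ v, MemLp (F v) 2 μ)
    (hadd : ∀ u v, F (u + v) =ᵐ[μ] F u + F v) (hsmul : ∀ (c : ℝ) v, F (c • v) =ᵐ[μ] c • F v)
    (v : V) : toL2 F hF hadd hsmul v = 0 ↔ F v =ᵐ[μ] 0 :=
  (MemLp.toLp_eq_toLp_iff (hF v) MemLp.zero)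

/-! ### Smooth lifts on an element, and the inverse inequality there. -/

namespace Geometry

variable {d p : ℕ} {B : NurbsBasis d p} {ι : Type*} {S : SplineSpace B ι} {G : Geometry S}

theorem elt_subset_Q (K : ι) : G.elt K ⊆ G.Q := image_mono (S.openBox_subset_openCube K)

theorem isOpen_elt (hp : 2 ≤ p) (hQ : IsOpen G.Q) (K : ι) : IsOpen (G.elt K) :=
  G.isOpen_image hp hQ (isOpen_openBox _ _) (S.openBox_subset_openCube K)

theorem exists_eq_of_mem_Vh {v : Phys d → ℝ} (hv : v ∈ G.Vh) :
    ∃ s ∈ S.space, v = s ∘ G.Φinv := by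
  obtain ⟨s, hs, rfl⟩ := Submodule.mem_map.1 hv
  exact ⟨s, hs, rfl⟩

theorem pd_comp_Φinv (hp : 2 ≤ p) (hQ : IsOpen G.Q) {s : Param d → ℝ} (hs : s ∈ S.space)
    {ξ : Param d} (hξ : ξ ∈ openCube d) (k : Fin (d + 1)) :
    pd k (s ∘ G.Φinv) (G.Φ ξ) = G.grad k s ξ := by
  have hn := openCube_mem_nhds hξ
  refine G.pd_eq hp hQ hξ ?_ ((B.differentiableWithinAt_of_mem hp (S.space_le hs)
    (openCube_subset_closedCube d hξ)).differentiableAt hn) k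
  filter_upwards [hn] with ζ hζ
  rw [Function.comp_apply, G.Φinv_Φ hζ]

/-- `f` is a smooth function on a neighbourhood of the closed parameter element whose push-forward
is `w`. -/
def IsLift {K : ι} (χ : G.Chart ∞ (S.lo K) (S.hi K)) (w : Phys d → ℝ) (f : Param d → ℝ) : Prop :=
  ContDiffOn ℝ ∞ f χ.U ∧ ∀ ξ ∈ openBox (S.lo K) (S.hi K), w (G.Φ ξ) = f ξ

namespace IsLift

variable {K : ι} {χ : G.Chart ∞ (S.lo K) (S.hi K)} {w w' : Phys d → ℝ} {f f' : Param d → ℝ}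

theorem differentiableAt (h : IsLift χ w f) {ξ : Param d} (hξ : ξ ∈ χ.U) :
    DifferentiableAt ℝ f ξ :=
  (h.1.contDiffAt (χ.isOpen_U.mem_nhds hξ)).differentiableAt (by simp)

theorem continuousOn (h : IsLift χ w f) : ContinuousOn f (Icc (S.lo K) (S.hi K)) :=
  h.1.continuousOn.mono χ.subset_U

theorem eventually (h : IsLift χ w f) {ξ : Param d} (hξ : ξ ∈ openBox (S.lo K) (S.hi K)) :
    ∀ᶠ ζ in 𝓝 ξ, w (G.Φ ζ) = f ζ :=
  Filter.eventually_of_mem ((isOpen_openBox _ _).mem_nhds hξ) h.2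

theorem differentiableAt_phys (h : IsLift χ w f) (hp : 2 ≤ p) (hQ : IsOpen G.Q) {y : Phys d}
    (hy : y ∈ G.elt K) : DifferentiableAt ℝ w y := by
  obtain ⟨ξ, hξ, rfl⟩ := hy
  obtain ⟨L, hL, -⟩ := G.exists_hasFDerivAt hp hQ (S.openBox_subset_openCube K hξ) (h.eventually hξ)
    (h.differentiableAt (χ.subset_U (openBox_subset_Icc _ _ hξ)))
  exact hL.differentiableAt

theorem pd (h : IsLift χ w f) (hp : 2 ≤ p) (hQ : IsOpen G.Q) (k : Fin (d + 1)) :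
    IsLift χ (pd k w) (pullPd χ.ψ k f) := by
  refine ⟨contDiffOn_pullPd χ.isOpen_U χ.contDiffOn_ψ (by simp) χ.det_ne h.1 k, fun ξ hξ => ?_⟩
  have hξ' := openBox_subset_Icc _ _ hξ
  have hξc := S.openBox_subset_openCube K hξ
  rw [G.pd_eq hp hQ hξc (h.eventually hξ) (h.differentiableAt (χ.subset_U hξ')), pullPd, grad,
    χ.jac_eq ξ hξ', fderivWithin_of_mem_nhds (openCube_mem_nhds hξc)]

theorem mul (h : IsLift χ w f) (h' : IsLift χ w' f') :
    IsLift χ (fun y => w y * w' y) (fun ξ => f ξ * f' ξ) :=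
  ⟨h.1.mul h'.1, fun ξ hξ => by simp only [h.2 ξ hξ, h'.2 ξ hξ]⟩

theorem sum {κ : Type*} (s : Finset κ) {w : κ → Phys d → ℝ} {f : κ → Param d → ℝ}
    (h : ∀ i, IsLift χ (w i) (f i)) :
    IsLift χ (fun y => ∑ i ∈ s, w i y) (fun ξ => ∑ i ∈ s, f i ξ) :=
  ⟨ContDiffOn.sum fun i _ => (h i).1, fun ξ hξ => Finset.sum_congr rfl fun i _ => (h i).2 ξ hξ⟩

theorem integrableOn (h : IsLift χ w f) (hp : 2 ≤ p) : IntegrableOn w (G.elt K) :=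
  G.integrableOn_of_continuousOn hp (S.Icc_subset K) h.continuousOn h.2

theorem memLp (h : IsLift χ w f) (hp : 2 ≤ p) : MemLp w 2 (volume.restrict (G.elt K)) := by
  rw [memLp_two_iff_integrable_sq (h.integrableOn hp).aestronglyMeasurable]
  have := (h.mul h).integrableOn hp
  exact this.congr (Filter.Eventually.of_forall fun y => by simp [sq])

end IsLift

theorem exists_isLift {K : ι} (χ : G.Chart ∞ (S.lo K) (S.hi K)) {s : Param d → ℝ}
    (hs : s ∈ S.space) : ∃ f, IsLift χ (s ∘ G.Φinv) f ∧ EqOn s f (Icc (S.lo K) (S.hi K)) := by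
  obtain ⟨f, hf, hfe⟩ := χ.lift s hs
  refine ⟨f, ⟨hf, fun ξ hξ => ?_⟩, hfe⟩
  have hξ' := openBox_subset_Icc _ _ hξ
  rw [Function.comp_apply, G.Φinv_Φ (S.Icc_subset K hξ'), hfe hξ']

theorem finiteDimensional_space : FiniteDimensional ℝ S.space := by
  have : FiniteDimensional ℝ B.nurbsSpace := FiniteDimensional.span_of_finite ℝ (finite_range _)
  exact Submodule.finiteDimensional_of_le S.space_le

theorem ipGrad_eq_sum {A : Set (Phys d)} {u v : Phys d → ℝ}
    (h : ∀ l, IntegrableOn (fun y => dx l u y * dx l v y) A) :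
    ipGrad A u v = ∑ l, ip A (dx l u) (dx l v) :=
  integral_finsetSum _ fun l _ => h l

/-- Inverse inequality for a finite-dimensional family of functions that are smooth on the closed
element. -/
theorem exists_inverse_of_family (hp : 2 ≤ p) (hQ : IsOpen G.Q) {K : ι}
    (χ : G.Chart ∞ (S.lo K) (S.hi K)) {V : Type*} [AddCommGroup V] [Module ℝ V]
    [FiniteDimensional ℝ V] (w : V → Phys d → ℝ) (hw : ∀ v, ∃ f, IsLift χ (w v) f)
    (hadd : ∀ u v, EqOn (w (u + v)) (w u + w v) (G.elt K))
    (hsmul : ∀ (c : ℝ) v, EqOn (w (c • v)) (c • w v) (G.elt K)) :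
    ∃ C : ℝ, 0 < C ∧ ∀ v, √(ipGrad (G.elt K) (w v) (w v)) ≤ C * √(ip (G.elt K) (w v) (w v)) := by
  have hKo := isOpen_elt hp hQ K
  choose f hf using hw
  have hpd : ∀ v l, IsLift χ (dx l (w v)) (pullPd χ.ψ l.castSucc (f v)) := fun v l =>
    (hf v).pd hp hQ l.castSucc
  have hdadd : ∀ l u v, EqOn (dx l (w (u + v))) (dx l (w u) + dx l (w v)) (G.elt K) := by
    intro l u v y hy
    have : w (u + v) =ᶠ[𝓝 y] w u + w v := Filter.eventually_of_mem (hKo.mem_nhds hy) (hadd u v)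
    rw [Pi.add_apply, dx, dx, dx, SpaceTimeIgA.pd, SpaceTimeIgA.pd, SpaceTimeIgA.pd, this.fderiv_eq,
      fderiv_add ((hf u).differentiableAt_phys hp hQ hy) ((hf v).differentiableAt_phys hp hQ hy)]
    rfl
  have hdsmul : ∀ l (c : ℝ) v, EqOn (dx l (w (c • v))) (c • dx l (w v)) (G.elt K) := by
    intro l c v y hy
    have : w (c • v) =ᶠ[𝓝 y] c • w v := Filter.eventually_of_mem (hKo.mem_nhds hy) (hsmul c v)
    rw [Pi.smul_apply, dx, dx, SpaceTimeIgA.pd, SpaceTimeIgA.pd, this.fderiv_eq,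
      fderiv_const_smul ((hf v).differentiableAt_phys hp hQ hy)]
    rfl
  have hae : ∀ {g g' : Phys d → ℝ}, EqOn g g' (G.elt K) → g =ᵐ[volume.restrict (G.elt K)] g' :=
    fun h => (ae_restrict_mem hKo.measurableSet).mono h
  have hA0 := toL2_eq_zero_iff w (fun v => (hf v).memLp hp)
    (fun u v => hae (hadd u v)) (fun c v => hae (hsmul c v))
  have hAn := norm_toL2_sq w (fun v => (hf v).memLp hp)
    (fun u v => hae (hadd u v)) (fun c v => hae (hsmul c v))
  have hD0 := fun l => toL2_eq_zero_iff (fun v => dx l (w v)) (fun v => (hpd v l).memLp hp)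
    (fun u v => hae (hdadd l u v)) (fun c v => hae (hdsmul l c v))
  have hDn := fun l => norm_toL2_sq (fun v => dx l (w v)) (fun v => (hpd v l).memLp hp)
    (fun u v => hae (hdadd l u v)) (fun c v => hae (hdsmul l c v))
  generalize toL2 w _ _ _ = A at hA0 hAn
  obtain ⟨D, hDe⟩ : ∃ D : Fin d → V →ₗ[ℝ] Lp ℝ 2 (volume.restrict (G.elt K)), ∀ l, D l =
    toL2 (fun v => dx l (w v)) (fun v => (hpd v l).memLp hp)
      (fun u v => hae (hdadd l u v)) (fun c v => hae (hdsmul l c v)) := ⟨_, fun _ => rfl⟩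
  simp only [← hDe] at hD0 hDn
  -- A continuous function that is zero almost everywhere on the open element is zero on it, hence
  -- so is its gradient. This kernel inclusion is all that finite dimension requires.
  have hker : ∀ v, A v = 0 → ∀ l, D l v = 0 := by
    intro v hv l
    rw [hD0]
    have h1 : EqOn (w v) 0 (G.elt K) := Measure.eqOn_open_of_ae_eq ((hA0 v).1 hv) hKo
      (fun y hy => ((hf v).differentiableAt_phys hp hQ hy).continuousAt.continuousWithinAt)
      continuousOn_const
    refine hae fun y hy => ?_
    have : w v =ᶠ[𝓝 y] fun _ => 0 := Filter.eventually_of_mem (hKo.mem_nhds hy) h1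
    rw [dx, SpaceTimeIgA.pd, this.fderiv_eq]
    simp
  obtain ⟨C, hC, h⟩ := exists_sqrt_sum_norm_sq_le A D hker
  refine ⟨C, hC, fun v => ?_⟩
  have h1 := h v
  rw [← Real.sqrt_sq (norm_nonneg (A v)), hAn] at h1
  simp only [hDn] at h1
  rw [ipGrad_eq_sum fun l => ((hpd v l).mul (hpd v l)).integrableOn hp]
  exact h1

theorem h_pos (hp : 2 ≤ p) (K : ι) : 0 < G.h K := by
  have hlt := S.lo_lt_hi K
  have hsub := S.Icc_subset K
  have hb : Bornology.IsBounded (G.elt K) :=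
    (((isCompact_closedCube d).image_of_continuousOn (G.continuousOn_Φ hp)).isBounded).subset
      (image_mono ((openBox_subset_Icc _ _).trans hsub))
  refine Metric.diam_pos ?_ hb
  -- The points at one third and two thirds of the diagonal have distinct images, so the diameter is
  -- positive.
  have h1 : (fun α => (2 * S.lo K α + S.hi K α) / 3) ∈ openBox (S.lo K) (S.hi K) :=
    mem_openBox.2 fun α => ⟨by linarith [hlt α], by linarith [hlt α]⟩
  have h2 : (fun α => (S.lo K α + 2 * S.hi K α) / 3) ∈ openBox (S.lo K) (S.hi K) :=
    mem_openBox.2 fun α => ⟨by linarith [hlt α], by linarith [hlt α]⟩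
  refine ⟨_, ⟨_, h1, rfl⟩, _, ⟨_, h2, rfl⟩, fun h => ?_⟩
  have := congrFun (G.Φ_injOn (hsub (openBox_subset_Icc _ _ h1))
    (hsub (openBox_subset_Icc _ _ h2)) h) 0
  linarith [hlt 0]

/-- The family bound is applied to the functions `v` and to each family `dx l v`. Admissibility of
every larger constant is what permits one common constant for finitely many elements. -/
theorem exists_isInverseConst (hp : 2 ≤ p) (hQ : IsOpen G.Q) (K : ι) :
    ∃ C : ℝ, 0 < C ∧ ∀ C' ≥ C, G.IsInverseConst K C' := by
  obtain ⟨χ⟩ := G.nonempty_chart_element hp K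
  have hlift : ∀ s : S.space, ∃ f, IsLift χ ((s : Param d → ℝ) ∘ G.Φinv) f := fun s => by
    obtain ⟨f, hf, -⟩ := exists_isLift χ s.2
    exact ⟨f, hf⟩
  have := finiteDimensional_space (S := S)
  obtain ⟨C₀, hC₀, h₀⟩ := exists_inverse_of_family hp hQ χ
    (fun s : S.space => (s : Param d → ℝ) ∘ G.Φinv) hlift
    (fun u v => fun y _ => rfl) (fun c v => fun y _ => rfl)
  have hex : ∀ l : Fin d, ∃ C : ℝ, 0 < C ∧ ∀ s : S.space,
      √(ipGrad (G.elt K) (dx l ((s : Param d → ℝ) ∘ G.Φinv)) (dx l ((s : Param d → ℝ) ∘ G.Φinv)))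
        ≤ C * √(ip (G.elt K) (dx l ((s : Param d → ℝ) ∘ G.Φinv))
          (dx l ((s : Param d → ℝ) ∘ G.Φinv))) := by
    intro l
    choose f hf using hlift
    refine exists_inverse_of_family hp hQ χ (fun s : S.space => dx l ((s : Param d → ℝ) ∘ G.Φinv))
      (fun s => ⟨_, (hf s).pd hp hQ l.castSucc⟩) (fun u v y hy => ?_) (fun c v y hy => ?_)
    · have := fderiv_add ((hf u).differentiableAt_phys hp hQ hy)
        ((hf v).differentiableAt_phys hp hQ hy)
      exact DFunLike.congr_fun this (EuclideanSpace.single l.castSucc 1)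
    · have := fderiv_const_smul ((hf v).differentiableAt_phys hp hQ hy) c
      exact DFunLike.congr_fun this (EuclideanSpace.single l.castSucc 1)
  choose C₁ hC₁ h₁ using hex
  have hh := h_pos (G := G) hp K
  have hsum : ∀ l, C₁ l ≤ ∑ l, C₁ l := fun l =>
    Finset.single_le_sum (fun l _ => (hC₁ l).le) (Finset.mem_univ l)
  have hs0 : 0 ≤ ∑ l, C₁ l := Finset.sum_nonneg fun l _ => (hC₁ l).le
  -- The factor `h K` compensates the `h⁻¹` of the definition.
  refine ⟨(C₀ + ∑ l, C₁ l) * G.h K, mul_pos (by linarith) hh, fun C' hC' v hv w hw => ?_⟩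
  have hle : C₀ + ∑ l, C₁ l ≤ C' * (G.h K)⁻¹ := by
    rw [← div_eq_mul_inv, le_div_iff₀ hh]; exact hC'
  obtain ⟨s, hs, rfl⟩ := exists_eq_of_mem_Vh hv
  rcases hw with rfl | ⟨l, rfl⟩
  · exact (h₀ ⟨s, hs⟩).trans (mul_le_mul_of_nonneg_right (by linarith) (Real.sqrt_nonneg _))
  · exact (h₁ l ⟨s, hs⟩).trans
      (mul_le_mul_of_nonneg_right (by linarith [hsum l]) (Real.sqrt_nonneg _))

theorem exists_uniform_isInverseConst [Fintype ι] (hp : 2 ≤ p) (hQ : IsOpen G.Q) :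
    ∃ C : ℝ, 0 < C ∧ ∀ K, G.IsInverseConst K C := by
  choose C hC h using fun K => exists_isInverseConst (G := G) hp hQ K
  have hs0 : 0 ≤ ∑ K, C K := Finset.sum_nonneg fun K _ => (hC K).le
  refine ⟨1 + ∑ K, C K, by linarith, fun K => h K _ ?_⟩
  have := Finset.single_le_sum (f := C) (fun K _ => (hC K).le) (Finset.mem_univ K)
  linarith

/-- The element residual is controlled by the energy norm. -/
theorem laplacian_bound (hp : 2 ≤ p) (hd : 1 ≤ d) (hQ : IsOpen G.Q) {K : ι} {C θ : ℝ} (hC : 0 < C)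
    (hK : G.IsInverseConst K C) (hθ : θ ∈ Ioc 0 (G.h K / (d * C ^ 2))) {v : Phys d → ℝ}
    (hv : v ∈ G.Vh) :
    θ * G.h K * ip (G.elt K) (fun y => ∑ l, dx l (dx l v) y) (dt v)
      ≤ 1 / 2 * (θ * G.h K * ip (G.elt K) (dt v) (dt v)) + 1 / 2 * ipGrad (G.elt K) v v := by
  obtain ⟨χ⟩ := G.nonempty_chart_element hp K
  obtain ⟨s, hs, hvs⟩ := exists_eq_of_mem_Vh hv
  obtain ⟨f, hf, -⟩ := exists_isLift χ hs
  rw [← hvs] at hf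
  have hh := h_pos (G := G) hp K
  have hd0 : (0 : ℝ) < d := by exact_mod_cast hd
  have hdx : ∀ l : Fin d, IsLift χ (dx l v) _ := fun l => hf.pd hp hQ l.castSucc
  have hdxx : ∀ l m : Fin d, IsLift χ (dx m (dx l v)) _ := fun l m => (hdx l).pd hp hQ m.castSucc
  have hdt : IsLift χ (dt v) _ := hf.pd hp hQ (Fin.last d)
  have hlap := IsLift.sum Finset.univ fun l => hdxx l l
  set Λ : Phys d → ℝ := fun y => ∑ l, dx l (dx l v) y with hΛ
  -- The pure second derivative is one of the terms of the gradient of `dx l v`, to which the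
  -- squared inverse inequality applies.
  have hinv : ∀ l : Fin d, ip (G.elt K) (dx l (dx l v)) (dx l (dx l v))
      ≤ C ^ 2 * (G.h K)⁻¹ ^ 2 * ip (G.elt K) (dx l v) (dx l v) := by
    intro l
    have h1 := hK v hv (dx l v) (Or.inr ⟨l, rfl⟩)
    have hg : ipGrad (G.elt K) (dx l v) (dx l v)
        = ∑ m, ip (G.elt K) (dx m (dx l v)) (dx m (dx l v)) :=
      ipGrad_eq_sum fun m => ((hdxx l m).mul (hdxx l m)).integrableOn hp
    have hnn : ∀ u : Phys d → ℝ, 0 ≤ ip (G.elt K) u u := fun u =>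
      integral_nonneg fun y => mul_self_nonneg _
    have hle : ip (G.elt K) (dx l (dx l v)) (dx l (dx l v))
        ≤ ipGrad (G.elt K) (dx l v) (dx l v) := by
      rw [hg]
      exact Finset.single_le_sum (f := fun m => ip (G.elt K) (dx m (dx l v)) (dx m (dx l v)))
        (fun m _ => hnn _) (Finset.mem_univ l)
    have hg0 := (hnn (dx l (dx l v))).trans hle
    refine hle.trans ?_
    have h2 := pow_le_pow_left₀ (Real.sqrt_nonneg _) h1 2
    rwa [Real.sq_sqrt hg0, mul_pow, mul_pow, Real.sq_sqrt (hnn _)] at h2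
  -- Cauchy-Schwarz for the `d` summands of the Laplacian; this is the `d` in the bound on `θ`.
  have hlap2 : ip (G.elt K) Λ Λ ≤ d * ∑ l, ip (G.elt K) (dx l (dx l v)) (dx l (dx l v)) := by
    have h1 : d * ∑ l, ip (G.elt K) (dx l (dx l v)) (dx l (dx l v))
        = ∫ y in G.elt K, d * ∑ l, dx l (dx l v) y * dx l (dx l v) y := by
      rw [integral_const_mul, integral_finsetSum _ fun l _ =>
        ((hdxx l l).mul (hdxx l l)).integrableOn hp]
      rfl
    rw [h1]
    refine setIntegral_mono ((hlap.mul hlap).integrableOn hp)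
      (((IsLift.sum Finset.univ fun l => (hdxx l l).mul (hdxx l l)).integrableOn hp).const_mul _)
      fun y => ?_
    have := sq_sum_le_card_mul_sum_sq (s := (Finset.univ : Finset (Fin d)))
      (f := fun l => dx l (dx l v) y)
    simp only [Finset.card_univ, Fintype.card_fin, sq] at this
    exact this
  have hgrad : ipGrad (G.elt K) v v = ∑ l, ip (G.elt K) (dx l v) (dx l v) :=
    ipGrad_eq_sum fun l => ((hdx l).mul (hdx l)).integrableOn hp
  have hyoung : ip (G.elt K) Λ (dt v)
      ≤ 1 / 2 * ip (G.elt K) (dt v) (dt v) + 1 / 2 * ip (G.elt K) Λ Λ := by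
    rw [ip, ip, ip, ← integral_const_mul, ← integral_const_mul, ← integral_add
      (((hdt.mul hdt).integrableOn hp).const_mul _) (((hlap.mul hlap).integrableOn hp).const_mul _)]
    refine setIntegral_mono ((hlap.mul hdt).integrableOn hp)
      ((((hdt.mul hdt).integrableOn hp).const_mul _).add
        (((hlap.mul hlap).integrableOn hp).const_mul _)) fun y => ?_
    simp only
    nlinarith [sq_nonneg (Λ y - dt v y)]
  have hfin : ip (G.elt K) Λ Λ ≤ d * (C ^ 2 * (G.h K)⁻¹ ^ 2 * ipGrad (G.elt K) v v) := by
    refine hlap2.trans (mul_le_mul_of_nonneg_left ?_ hd0.le)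
    rw [hgrad, Finset.mul_sum]
    exact Finset.sum_le_sum fun l _ => hinv l
  have hg0 : 0 ≤ ipGrad (G.elt K) v v :=
    integral_nonneg fun y => Finset.sum_nonneg fun l _ => mul_self_nonneg _
  have hθ1 : θ * (d * C ^ 2) ≤ G.h K := (le_div_iff₀ (by positivity)).1 hθ.2
  -- With δ = θh this product is θ d C² / h, so the upper bound on `θ` makes the gradient
  -- coefficient in Young's inequality at most one half.
  have hθh : θ * G.h K * (d * (C ^ 2 * (G.h K)⁻¹ ^ 2)) ≤ 1 := by
    have : θ * G.h K * (d * (C ^ 2 * (G.h K)⁻¹ ^ 2)) = θ * (d * C ^ 2) / G.h K := by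
      field_simp
    rw [this]
    exact (div_le_one hh).2 hθ1
  have hpos : 0 ≤ θ * G.h K := (mul_pos hθ.1 hh).le
  have h1 := mul_le_mul_of_nonneg_left hyoung hpos
  have h2 := mul_le_mul_of_nonneg_left hfin hpos
  have h3 := mul_le_mul_of_nonneg_right hθh hg0
  nlinarith

end Geometry

/-! ### Facets of the mesh -/

namespace SplineSpace

variable {d p : ℕ} {B : NurbsBasis d p} {ι : Type*} (S : SplineSpace B ι)

/-- The parameters of the face of `K` orthogonal to the direction `α`. -/
def face (K : ι) (α : Fin (d + 1)) : Set (Fin d → ℝ) :=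
  Icc (fun j => S.lo K (α.succAbove j)) (fun j => S.hi K (α.succAbove j))

theorem isCompact_face (K : ι) (α : Fin (d + 1)) : IsCompact (S.face K α) := isCompact_Icc

/-- Points that lie on no coordinate hyperplane through a vertex of the mesh. -/
def IsGeneric (α : Fin (d + 1)) (z : Fin d → ℝ) : Prop :=
  ∀ (K : ι) (j : Fin d), z j ≠ S.lo K (α.succAbove j) ∧ z j ≠ S.hi K (α.succAbove j)

theorem ae_isGeneric [Finite ι] (α : Fin (d + 1)) : ∀ᵐ z : Fin d → ℝ, S.IsGeneric α z := by
  simp only [IsGeneric]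
  rw [ae_all_iff]
  intro K
  rw [ae_all_iff]
  intro j
  exact (Measure.ae_eval_ne (μ := fun _ : Fin d => (volume : Measure ℝ)) j _).and
    (Measure.ae_eval_ne (μ := fun _ : Fin d => (volume : Measure ℝ)) j _)

variable {S}

theorem IsGeneric.lt {α : Fin (d + 1)} {z : Fin d → ℝ} (hz : S.IsGeneric α z) {K : ι}
    (h : z ∈ S.face K α) (j : Fin d) :
    S.lo K (α.succAbove j) < z j ∧ z j < S.hi K (α.succAbove j) :=
  ⟨lt_of_le_of_ne (h.1 j) (hz K j).1.symm, lt_of_le_of_ne (h.2 j) (hz K j).2⟩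

theorem insertNth_mem_Icc_iff {K : ι} {α : Fin (d + 1)} {c : ℝ} {z : Fin d → ℝ} :
    (α.insertNth c z : Param d) ∈ Icc (S.lo K) (S.hi K)
      ↔ c ∈ Icc (S.lo K α) (S.hi K α) ∧ z ∈ S.face K α :=
  Fin.insertNth_mem_Icc

/-- Distinct elements meeting in a generic point of a coordinate hyperplane lie on different sides
of it. -/
theorem min_hi_le_max_lo {K L : ι} (hKL : K ≠ L) {α : Fin (d + 1)} {z : Fin d → ℝ}
    (hz : S.IsGeneric α z) (hK : z ∈ S.face K α) (hL : z ∈ S.face L α) :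
    min (S.hi K α) (S.hi L α) ≤ max (S.lo K α) (S.lo L α) := by
  -- If the two intervals in direction `α` overlapped, a common `t` would give a point of both open
  -- boxes, since generic `z` lies strictly inside both faces.
  rw [← Ioo_disjoint_Ioo, Set.disjoint_left]
  intro t h1 h2
  have hd : ∀ ξ ∈ openBox (S.lo K) (S.hi K), ξ ∉ openBox (S.lo L) (S.hi L) := fun ξ h =>
    Set.disjoint_left.1 (S.disjoint hKL) h
  refine hd (α.insertNth t z) (mem_openBox.2 ?_) (mem_openBox.2 ?_)
  · rw [Fin.forall_iff_succAbove α]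
    simp only [Fin.insertNth_apply_same, Fin.insertNth_apply_succAbove]
    exact ⟨h1, fun j => hz.lt hK j⟩
  · rw [Fin.forall_iff_succAbove α]
    simp only [Fin.insertNth_apply_same, Fin.insertNth_apply_succAbove]
    exact ⟨h2, fun j => hz.lt hL j⟩

theorem lo_nonneg (K : ι) (α : Fin (d + 1)) : 0 ≤ S.lo K α :=
  (S.Icc_subset K (left_mem_Icc.2 fun β => (S.lo_lt_hi K β).le)).1 α

theorem hi_le_one (K : ι) (α : Fin (d + 1)) : S.hi K α ≤ 1 :=
  (S.Icc_subset K (right_mem_Icc.2 fun β => (S.lo_lt_hi K β).le)).2 α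

/-- On the boundary of the cube different elements do not share generic points. -/
theorem eq_of_mem_boundary {K L : ι} {α : Fin (d + 1)} {z : Fin d → ℝ} (hz : S.IsGeneric α z)
    {c : ℝ} (hc : c = 0 ∨ c = 1) (hK : (α.insertNth c z : Param d) ∈ Icc (S.lo K) (S.hi K))
    (hL : (α.insertNth c z : Param d) ∈ Icc (S.lo L) (S.hi L)) : K = L := by
  by_contra hne
  rw [insertNth_mem_Icc_iff] at hK hL
  have h := min_hi_le_max_lo hne hz hK.2 hL.2
  have := S.lo_lt_hi K α
  have := S.lo_lt_hi L α
  have := lo_nonneg (S := S) K α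
  have := lo_nonneg (S := S) L α
  have := hi_le_one (S := S) K α
  have := hi_le_one (S := S) L α
  obtain ⟨⟨h1, h2⟩, -⟩ := hK
  obtain ⟨⟨h3, h4⟩, -⟩ := hL
  rw [min_le_iff, le_max_iff, le_max_iff] at h
  rcases hc with rfl | rfl <;> rcases h with (h | h) | (h | h) <;> linarith

/-- At most two elements share a generic point of a coordinate hyperplane. -/
theorem eq_of_mem_of_mem {K L M : ι} {α : Fin (d + 1)} {z : Fin d → ℝ} (hz : S.IsGeneric α z)
    {c : ℝ} (hLK : L ≠ K) (hMK : M ≠ K)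
    (hK : (α.insertNth c z : Param d) ∈ Icc (S.lo K) (S.hi K))
    (hL : (α.insertNth c z : Param d) ∈ Icc (S.lo L) (S.hi L))
    (hM : (α.insertNth c z : Param d) ∈ Icc (S.lo M) (S.hi M)) : L = M := by
  by_contra hne
  rw [insertNth_mem_Icc_iff] at hK hL hM
  -- Three nondegenerate intervals containing `c` cannot have pairwise disjoint interiors.
  have a1 := min_hi_le_max_lo hne hz hL.2 hM.2
  have a2 := min_hi_le_max_lo hLK hz hL.2 hK.2
  have a3 := min_hi_le_max_lo hMK hz hM.2 hK.2
  have b1 := S.lo_lt_hi K α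
  have b2 := S.lo_lt_hi L α
  have b3 := S.lo_lt_hi M α
  obtain ⟨⟨h1, h2⟩, -⟩ := hK
  obtain ⟨⟨h3, h4⟩, -⟩ := hL
  obtain ⟨⟨h5, h6⟩, -⟩ := hM
  rw [min_le_iff, le_max_iff, le_max_iff] at a1 a2 a3
  rcases a1 with (a1 | a1) | (a1 | a1) <;> rcases a2 with (a2 | a2) | (a2 | a2) <;>
    rcases a3 with (a3 | a3) | (a3 | a3) <;> linarith

/-- A point of a face of `K` beyond which there is room in the cube belongs to another element. -/
theorem exists_ne_mem [Finite ι] {K : ι} {α : Fin (d + 1)} {z : Fin d → ℝ} (hz : z ∈ S.face K α)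
    {c : ℝ} (hc : c = S.lo K α ∨ c = S.hi K α) (h0 : 0 < c) (h1 : c < 1) :
    ∃ L, L ≠ K ∧ (α.insertNth c z : Param d) ∈ Icc (S.lo L) (S.hi L) := by
  -- The interval `(u, w)` lies beyond the face: `(0, c)` for a lower face, `(c, 1)` for an upper
  -- one. Other elements cover it, and their finite union is closed, so it also contains the end
  -- point `c`.
  obtain ⟨u, w, huw, hu0, hw1, hcl, hout⟩ : ∃ u w : ℝ, u < w ∧ 0 ≤ u ∧ w ≤ 1 ∧ c ∈ Icc u w ∧
      ∀ t ∈ Ioo u w, t ∉ Icc (S.lo K α) (S.hi K α) := by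
    rcases hc with rfl | rfl
    · exact ⟨0, _, h0, le_rfl, h1.le, ⟨h0.le, le_rfl⟩, fun t ht ht' => ht'.1.not_gt ht.2⟩
    · exact ⟨_, 1, h1, h0.le, le_rfl, ⟨le_rfl, h1.le⟩, fun t ht ht' => ht'.2.not_gt ht.1⟩
  have hF : IsClosed (⋃ L : {L : ι // L ≠ K}, Icc (S.lo L) (S.hi L)) :=
    isClosed_iUnion_of_finite fun _ => isClosed_Icc
  have hcont : Continuous fun t : ℝ => (α.insertNth t z : Param d) :=
    Continuous.finInsertNth α continuous_id continuous_const
  have hsub : Ioo u w ⊆ (fun t : ℝ => (α.insertNth t z : Param d)) ⁻¹'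
      (⋃ L : {L : ι // L ≠ K}, Icc (S.lo L) (S.hi L)) := by
    intro t ht
    have hcube : (α.insertNth t z : Param d) ∈ closedCube d := by
      rw [mem_closedCube, Fin.forall_iff_succAbove α]
      simp only [Fin.insertNth_apply_same, Fin.insertNth_apply_succAbove]
      exact ⟨⟨hu0.trans ht.1.le, ht.2.le.trans hw1⟩, fun j =>
        ⟨(lo_nonneg K _).trans (hz.1 j), (hz.2 j).trans (hi_le_one K _)⟩⟩
    rw [← S.cover] at hcube
    obtain ⟨L, hL⟩ := mem_iUnion.1 hcube
    refine mem_iUnion.2 ⟨⟨L, ?_⟩, hL⟩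
    rintro rfl
    exact hout t ht (insertNth_mem_Icc_iff.1 hL).1
  have hmem := closure_minimal hsub (hF.preimage hcont)
  rw [closure_Ioo huw.ne] at hmem
  obtain ⟨⟨L, hL⟩, h⟩ := mem_iUnion.1 (hmem hcl)
  exact ⟨L, hL, h⟩

theorem insertNth_mem_openCube {K : ι} {α : Fin (d + 1)} {z : Fin d → ℝ} (hz : S.IsGeneric α z)
    (h : z ∈ S.face K α) {c : ℝ} (h0 : 0 < c) (h1 : c < 1) :
    (α.insertNth c z : Param d) ∈ openCube d := by
  rw [openCube, mem_openBox, Fin.forall_iff_succAbove α]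
  simp only [Fin.insertNth_apply_same, Fin.insertNth_apply_succAbove, Pi.zero_apply, Pi.one_apply]
  exact ⟨⟨h0, h1⟩, fun j => ⟨(lo_nonneg K _).trans_lt (hz.lt h j).1,
    (hz.lt h j).2.trans_le (hi_le_one K _)⟩⟩

end SplineSpace

/-! ### Facets in the physical mesh. -/

namespace Geometry

variable {d p : ℕ} {B : NurbsBasis d p} {ι : Type*} {S : SplineSpace B ι} {G : Geometry S}

theorem closure_elt (hp : 2 ≤ p) (K : ι) : closure (G.elt K) = G.Φ '' Icc (S.lo K) (S.hi K) := by
  have hc := (G.continuousOn_Φ hp).mono (S.Icc_subset K)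
  have hcl := closure_openBox (S.lo_lt_hi K)
  refine subset_antisymm (closure_minimal (image_mono (openBox_subset_Icc _ _))
    (isCompact_Icc.image_of_continuousOn hc).isClosed) ?_
  have := ContinuousOn.image_closure (f := G.Φ) (s := openBox (S.lo K) (S.hi K)) (hcl ▸ hc)
  rwa [hcl] at this

theorem disjoint_elt {K L : ι} (h : K ≠ L) : Disjoint (G.elt K) (G.elt L) := by
  rw [Set.disjoint_left]
  rintro _ ⟨ξ, hξ, rfl⟩ ⟨ζ, hζ, he⟩
  have := G.Φ_injOn (S.Icc_subset L (openBox_subset_Icc _ _ hζ))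
    (S.Icc_subset K (openBox_subset_Icc _ _ hξ)) he
  subst this
  exact Set.disjoint_left.1 (S.disjoint h) hξ hζ

/-- Elements are open and disjoint, so each misses the closure of the other. A common point of two
closures therefore lies on both frontiers, and injectivity returns it to the parameter boxes. -/
theorem mem_facet_iff (hp : 2 ≤ p) (hQ : IsOpen G.Q) {K L : ι} (h : L ≠ K) {ξ : Param d}
    (hξ : ξ ∈ Icc (S.lo K) (S.hi K)) : G.Φ ξ ∈ G.facet K L ↔ ξ ∈ Icc (S.lo L) (S.hi L) := by
  constructor
  · rintro ⟨-, h2⟩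
    have h3 := frontier_subset_closure h2
    rw [closure_elt hp] at h3
    obtain ⟨ζ, hζ, he⟩ := h3
    rwa [← G.Φ_injOn (S.Icc_subset L hζ) (S.Icc_subset K hξ) he]
  · intro hL
    have hcK : G.Φ ξ ∈ closure (G.elt K) := by rw [closure_elt hp]; exact ⟨ξ, hξ, rfl⟩
    have hcL : G.Φ ξ ∈ closure (G.elt L) := by rw [closure_elt hp]; exact ⟨ξ, hL, rfl⟩
    have hoK := isOpen_elt (G := G) hp hQ K
    have hoL := isOpen_elt (G := G) hp hQ L
    refine ⟨⟨hcK, ?_⟩, ⟨hcL, ?_⟩⟩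
    · rw [hoK.interior_eq]
      exact Set.disjoint_left.1 ((disjoint_elt h).closure_left hoK) hcL
    · rw [hoL.interior_eq]
      exact Set.disjoint_left.1 ((disjoint_elt h.symm).closure_left hoL) hcK

theorem facePart_facet (hp : 2 ≤ p) (hQ : IsOpen G.Q) {K L : ι} (h : L ≠ K) {α : Fin (d + 1)}
    {c : ℝ} (hc : c ∈ Icc (S.lo K α) (S.hi K α)) : G.facePart K α c (G.facet K L)
      = S.face K α ∩ {z | (α.insertNth c z : Param d) ∈ Icc (S.lo L) (S.hi L)} := by
  ext z
  refine and_congr_right fun hz => ?_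
  exact mem_facet_iff hp hQ h (SplineSpace.insertNth_mem_Icc_iff.2 ⟨hc, hz⟩)

theorem measurableSet_facePart_facet (hp : 2 ≤ p) (hQ : IsOpen G.Q) {K L : ι} (h : L ≠ K)
    {α : Fin (d + 1)} {c : ℝ} (hc : c ∈ Icc (S.lo K α) (S.hi K α)) :
    MeasurableSet (G.facePart K α c (G.facet K L)) := by
  rw [facePart_facet hp hQ h hc]
  have hcont : Continuous fun z : Fin d → ℝ => (α.insertNth c z : Param d) :=
    Continuous.finInsertNth α continuous_const continuous_id
  exact (S.isCompact_face K α).measurableSet.inter (isClosed_Icc.preimage hcont).measurableSet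

/-- An interior facet may still touch ∂Q. On a face of the cube it contains no generic point, so its
part there is a null set and any integrand is harmless. -/
theorem setIntegral_facePart_boundary [Finite ι] (hp : 2 ≤ p) (hQ : IsOpen G.Q) {K L : ι}
    (h : L ≠ K) {α : Fin (d + 1)} {c : ℝ} (hc : c ∈ Icc (S.lo K α) (S.hi K α))
    (hc' : c = 0 ∨ c = 1) (H : (Fin d → ℝ) → ℝ) :
    ∫ z in G.facePart K α c (G.facet K L), H z = 0 := by
  refine setIntegral_measure_zero _ (measure_mono_null (t := {z | ¬ S.IsGeneric α z}) ?_
    (ae_iff.1 (S.ae_isGeneric α)))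
  intro z hz hgen
  rw [facePart_facet hp hQ h hc] at hz
  exact h (SplineSpace.eq_of_mem_boundary hgen hc' hz.2
    (SplineSpace.insertNth_mem_Icc_iff.2 ⟨hc, hz.1⟩))

open Classical in
/-- The interior facets of `K` on a face inside the cube cover this face. -/
theorem sum_setIntegral_facePart [Fintype ι] (hp : 2 ≤ p) (hQ : IsOpen G.Q) {K : ι}
    {α : Fin (d + 1)} {c : ℝ} (hc : c = S.lo K α ∨ c = S.hi K α) (h0 : 0 < c) (h1 : c < 1)
    {H : (Fin d → ℝ) → ℝ} (hH : IntegrableOn H (S.face K α)) :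
    ∑ L, (if L ≠ K ∧ ¬ G.facet K L ⊆ frontier G.Q then
      ∫ z in G.facePart K α c (G.facet K L), H z else 0) = ∫ z in S.face K α, H z := by
  have hc' : c ∈ Icc (S.lo K α) (S.hi K α) := by
    have := (S.lo_lt_hi K α).le
    rcases hc with rfl | rfl
    · exact ⟨le_rfl, this⟩
    · exact ⟨this, le_rfl⟩
  set A : ι → Set (Fin d → ℝ) := fun L =>
    if L ≠ K ∧ ¬ G.facet K L ⊆ frontier G.Q then G.facePart K α c (G.facet K L) else ∅ with hA
  have hAm : ∀ L, MeasurableSet (A L) := by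
    intro L
    simp only [hA]
    split_ifs with h
    · exact measurableSet_facePart_facet hp hQ h.1 hc'
    · exact MeasurableSet.empty
  have hAsub : ∀ L, A L ⊆ S.face K α := by
    intro L z hz
    simp only [hA] at hz
    split_ifs at hz with h
    · exact hz.1
    · exact hz.elim
  have hterm : ∀ L, (if L ≠ K ∧ ¬ G.facet K L ⊆ frontier G.Q then
      ∫ z in G.facePart K α c (G.facet K L), H z else 0)
        = ∫ z in S.face K α, (A L).indicator H z := by
    intro L
    rw [setIntegral_indicator (hAm L), inter_eq_self_of_subset_right (hAsub L)]
    simp only [hA]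
    split_ifs with h <;> simp
  simp only [hterm]
  rw [← integral_finsetSum _ fun L _ => hH.indicator (hAm L)]
  refine setIntegral_congr_ae (S.isCompact_face K α).measurableSet ?_
  filter_upwards [S.ae_isGeneric α] with z hz hzK
  obtain ⟨L, hLK, hL⟩ := SplineSpace.exists_ne_mem hzK hc h0 h1
  have hK : (α.insertNth c z : Param d) ∈ Icc (S.lo K) (S.hi K) :=
    SplineSpace.insertNth_mem_Icc_iff.2 ⟨hc', hzK⟩
  -- A generic point of an inner face belongs to exactly one other element. The facet shared with it
  -- is not contained in ∂Q, because the image of this point lies in the open set `Q`.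
  rw [Finset.sum_eq_single L]
  · refine indicator_of_mem ?_ _
    have hmem := (mem_facet_iff hp hQ hLK hK).2 hL
    have hcond : L ≠ K ∧ ¬ G.facet K L ⊆ frontier G.Q := by
      refine ⟨hLK, fun hsub => ?_⟩
      have h2 := (hsub hmem).2
      rw [hQ.interior_eq] at h2
      exact h2 ⟨_, SplineSpace.insertNth_mem_openCube hz hzK h0 h1, rfl⟩
    simp only [hA, if_pos hcond]
    exact ⟨hzK, hmem⟩
  · intro M _ hM
    refine indicator_of_notMem (fun hzM => ?_) _
    simp only [hA] at hzM
    split_ifs at hzM with h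
    · rw [facePart_facet hp hQ h.1 hc'] at hzM
      exact hM (SplineSpace.eq_of_mem_of_mem hz h.1 hLK hK hzM.2 hL)
    · exact hzM
  · intro h; exact (h (Finset.mem_univ _)).elim

end Geometry

/-! ### The space-time cylinder -/

section Cylinder

variable {d : ℕ}

/-- The spatial part of a space-time point. -/
def spacePart (y : Phys d) : EuclideanSpace ℝ (Fin d) := WithLp.toLp 2 fun l => y l.castSucc

@[simp] theorem stPoint_castSucc (x : EuclideanSpace ℝ (Fin d)) (t : ℝ) (l : Fin d) :
    stPoint x t l.castSucc = x l := by simp [stPoint]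

@[simp] theorem stPoint_last (x : EuclideanSpace ℝ (Fin d)) (t : ℝ) :
    stPoint x t (Fin.last d) = t := by simp [stPoint]

@[simp] theorem spacePart_stPoint (x : EuclideanSpace ℝ (Fin d)) (t : ℝ) :
    spacePart (stPoint x t) = x := by ext l; simp [spacePart]

theorem stPoint_spacePart (y : Phys d) : stPoint (spacePart y) (y (Fin.last d)) = y := by
  ext k
  refine Fin.lastCases ?_ (fun l => ?_) k <;> simp [spacePart]

theorem continuous_spacePart : Continuous (spacePart (d := d)) := by
  unfold spacePart; fun_prop

theorem continuous_time : Continuous fun y : Phys d => y (Fin.last d) := by fun_prop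

theorem stPoint_eq_add (x : EuclideanSpace ℝ (Fin d)) (t : ℝ) :
    stPoint x t = stPoint x 0 + t • EuclideanSpace.single (Fin.last d) 1 := by
  ext k
  refine Fin.lastCases ?_ (fun l => ?_) k <;> simp [Fin.castSucc_ne_last]

theorem hasDerivAt_stPoint (x : EuclideanSpace ℝ (Fin d)) (t : ℝ) :
    HasDerivAt (stPoint x) (EuclideanSpace.single (Fin.last d) 1) t := by
  have h := ((hasDerivAt_id t).smul_const
    (EuclideanSpace.single (Fin.last d) (1 : ℝ))).const_add (stPoint x 0)
  rw [one_smul] at h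
  exact h.congr_of_eventuallyEq (Filter.Eventually.of_forall fun r => stPoint_eq_add x r)

theorem continuous_stPoint :
    Continuous fun q : EuclideanSpace ℝ (Fin d) × ℝ => stPoint q.1 q.2 := by
  refine (PiLp.continuous_toLp 2 _).comp (continuous_pi fun k => ?_)
  refine Fin.lastCases ?_ (fun l => ?_) k
  · simpa using continuous_snd
  · simp only [Fin.snoc_castSucc]; fun_prop

theorem mem_cylinder_iff {Ω : Set (EuclideanSpace ℝ (Fin d))} {T : ℝ} {y : Phys d} :
    y ∈ cylinder Ω T ↔ spacePart y ∈ Ω ∧ y (Fin.last d) ∈ Ioo 0 T := by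
  constructor
  · rintro ⟨x, hx, t, ht, rfl⟩; simpa using ⟨hx, ht⟩
  · rintro ⟨hx, ht⟩; exact ⟨_, hx, _, ht, (stPoint_spacePart y).symm⟩

theorem isOpen_cylinder {Ω : Set (EuclideanSpace ℝ (Fin d))} (hΩ : IsOpen Ω) (T : ℝ) :
    IsOpen (cylinder Ω T) := by
  have : cylinder Ω T = spacePart ⁻¹' Ω ∩ (fun y : Phys d => y (Fin.last d)) ⁻¹' Ioo 0 T := by
    ext y; exact mem_cylinder_iff
  rw [this]
  exact (hΩ.preimage continuous_spacePart).inter (isOpen_Ioo.preimage continuous_time)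

theorem closure_cylinder_subset {Ω : Set (EuclideanSpace ℝ (Fin d))} {T : ℝ} {y : Phys d}
    (hy : y ∈ closure (cylinder Ω T)) :
    spacePart y ∈ closure Ω ∧ y (Fin.last d) ∈ Icc 0 T := by
  refine ⟨map_mem_closure continuous_spacePart hy fun z hz => (mem_cylinder_iff.1 hz).1, ?_⟩
  have := map_mem_closure continuous_time hy fun z hz =>
    Ioo_subset_Icc_self (mem_cylinder_iff.1 hz).2
  rwa [isClosed_Icc.closure_eq] at this

theorem stPoint_mem_closure {Ω : Set (EuclideanSpace ℝ (Fin d))} {T : ℝ} (hT : 0 < T)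
    {x : EuclideanSpace ℝ (Fin d)} (hx : x ∈ closure Ω) {t : ℝ} (ht : t ∈ Icc 0 T) :
    stPoint x t ∈ closure (cylinder Ω T) := by
  rw [← closure_Ioo hT.ne] at ht
  exact map_mem_closure₂ continuous_stPoint hx ht fun a ha b hb => ⟨a, ha, b, hb, rfl⟩

/-- Space-time as a product of space and time. -/
def stEquiv (d : ℕ) : EuclideanSpace ℝ (Fin d) × ℝ ≃ᵐ Phys d :=
  ((((MeasurableEquiv.toLp 2 (Fin d → ℝ)).symm.prodCongr (MeasurableEquiv.refl ℝ)).trans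
    MeasurableEquiv.prodComm).trans
      (MeasurableEquiv.piFinSuccAbove (fun _ => ℝ) (Fin.last d)).symm).trans
        (MeasurableEquiv.toLp 2 (Fin (d + 1) → ℝ))

theorem stEquiv_apply (q : EuclideanSpace ℝ (Fin d) × ℝ) : stEquiv d q = stPoint q.1 q.2 := by
  ext k
  have : stEquiv d q = WithLp.toLp 2 ((Fin.last d).insertNth (α := fun _ => ℝ) q.2
    (fun l => q.1 l)) := rfl
  rw [this]
  refine Fin.lastCases ?_ (fun l => ?_) k
  · simp
  · simp

theorem measurePreserving_stEquiv (d : ℕ) : MeasurePreserving (stEquiv d) := by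
  have h1 := (PiLp.volume_preserving_ofLp (Fin d)).prod (MeasurePreserving.id (volume : Measure ℝ))
  have h2 := Measure.measurePreserving_swap (μ := (volume : Measure (Fin d → ℝ)))
    (ν := (volume : Measure ℝ))
  have h3 := (volume_preserving_piFinSuccAbove (fun _ : Fin (d + 1) => ℝ) (Fin.last d)).symm
  have h4 := PiLp.volume_preserving_toLp (Fin (d + 1))
  exact h4.comp (h3.comp (h2.comp h1))

theorem setIntegral_cylinder {Ω : Set (EuclideanSpace ℝ (Fin d))} {T : ℝ} {g : Phys d → ℝ}
    (hg : IntegrableOn g (cylinder Ω T)) :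
    ∫ y in cylinder Ω T, g y = ∫ x in Ω, ∫ t in Ioo 0 T, g (stPoint x t) := by
  have hpre : stEquiv d ⁻¹' cylinder Ω T = Ω ×ˢ Ioo 0 T := by
    ext q
    rw [mem_preimage, stEquiv_apply, mem_cylinder_iff]
    simp
  rw [← (measurePreserving_stEquiv d).setIntegral_preimage_emb (stEquiv d).measurableEmbedding,
    hpre]
  rw [← (measurePreserving_stEquiv d).integrableOn_comp_preimage (stEquiv d).measurableEmbedding,
    hpre] at hg
  rw [Measure.volume_eq_prod] at hg ⊢
  refine (setIntegral_prod _ hg).trans ?_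
  simp only [Function.comp_apply, stEquiv_apply]

end Cylinder

namespace Geometry

variable {d p : ℕ} {B : NurbsBasis d p} {ι : Type*} {S : SplineSpace B ι} {G : Geometry S}
  {Ω : Set (EuclideanSpace ℝ (Fin d))} {T : ℝ}

theorem closure_Q_subset (hp : 2 ≤ p) : closure G.Q ⊆ G.Φ '' closedCube d :=
  closure_minimal G.Q_subset
    ((isCompact_closedCube d).image_of_continuousOn (G.continuousOn_Φ hp)).isClosed

theorem Φ_mem_closure_Q (hp : 2 ≤ p) {ξ : Param d} (hξ : ξ ∈ closedCube d) :
    G.Φ ξ ∈ closure G.Q := by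
  have hcl : closure (openCube d) = closedCube d := closure_openBox fun _ => zero_lt_one
  have := ContinuousOn.image_closure (f := G.Φ) (s := openCube d)
    (hcl ▸ G.continuousOn_Φ hp)
  rw [hcl] at this
  exact this ⟨ξ, hξ, rfl⟩

theorem stPoint_mem_image (hp : 2 ≤ p) (hQ : G.Q = cylinder Ω T) (hT : 0 < T)
    {x : EuclideanSpace ℝ (Fin d)} (hx : x ∈ closure Ω) {t : ℝ} (ht : t ∈ Icc 0 T) :
    stPoint x t ∈ G.Φ '' closedCube d :=
  closure_Q_subset hp (hQ ▸ stPoint_mem_closure hT hx ht)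

/-- Time derivative of a push-forward along a vertical line in the closed cylinder. -/
theorem hasDerivAt_stPoint_line (hp : 2 ≤ p) {s : Param d → ℝ} (hs : s ∈ S.space) {ξ : Param d}
    (hξ : ξ ∈ closedCube d) {x : EuclideanSpace ℝ (Fin d)} {t : ℝ} (h : G.Φ ξ = stPoint x t)
    (hC : ∀ᶠ r in 𝓝 t, stPoint x r ∈ G.Φ '' closedCube d) :
    HasDerivAt (fun r => (s ∘ G.Φinv) (stPoint x r)) (G.grad (Fin.last d) s ξ) t := by
  obtain ⟨L, hL, hLk⟩ := G.exists_hasFDerivWithinAt_comp_Φinv hp hξ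
    (B.differentiableWithinAt_of_mem hp (S.space_le hs) hξ)
  rw [h] at hL
  have := hL.comp_hasDerivAt t (hasDerivAt_stPoint x t) hC
  rwa [hLk] at this

/-- `(∂_t v, v)_Q` for functions that vanish at time zero. -/
theorem ip_dt_self (hp : 2 ≤ p) (hΩ : IsOpen Ω) (hT : 0 < T) (hQ : G.Q = cylinder Ω T)
    {v : Phys d → ℝ} (hv : v ∈ G.V0h Ω T) :
    ip G.Q (dt v) v = 1 / 2 * ∫ x in Ω, v (stPoint x T) ^ 2 := by
  have hQo : IsOpen G.Q := hQ ▸ isOpen_cylinder hΩ T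
  obtain ⟨hvV, -, hv0⟩ := hv
  obtain ⟨s, hs, rfl⟩ := exists_eq_of_mem_Vh hvV
  have hint : IntegrableOn (fun y => dt (s ∘ G.Φinv) y * (s ∘ G.Φinv) y) G.Q := by
    refine G.integrableOn_of_continuousOn hp (a := 0) (b := 1) le_rfl
      (f := fun ξ => G.grad (Fin.last d) s ξ * s ξ)
      ((G.continuousOn_grad hp hs _).mul (B.continuousOn_of_mem hp (S.space_le hs)))
      fun ξ hξ => ?_
    rw [dt, pd_comp_Φinv hp hQo hs hξ, Function.comp_apply,
      G.Φinv_Φ (openCube_subset_closedCube d hξ)]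
  rw [ip, hQ, setIntegral_cylinder (hQ ▸ hint), ← integral_const_mul]
  refine setIntegral_congr_fun hΩ.measurableSet fun x hx => ?_
  have hmem : ∀ t ∈ Icc 0 T, stPoint x t ∈ G.Φ '' closedCube d := fun t ht =>
    stPoint_mem_image hp hQ hT (subset_closure hx) ht
  have hline : ContinuousOn (fun t => G.Φinv (stPoint x t)) (Icc 0 T) :=
    (G.continuousOn_Φinv hp).comp
      (continuous_stPoint.comp (Continuous.prodMk_right x)).continuousOn hmem
  have hmaps : MapsTo (fun t => G.Φinv (stPoint x t)) (Icc 0 T) (closedCube d) := fun t ht =>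
    G.Φinv_mem (hmem t ht)
  set u : ℝ → ℝ := fun t => (s ∘ G.Φinv) (stPoint x t) with hu
  set u' : ℝ → ℝ := fun t => G.grad (Fin.last d) s (G.Φinv (stPoint x t)) with hu'
  have huc : ContinuousOn u (Icc 0 T) :=
    (B.continuousOn_of_mem hp (S.space_le hs)).comp hline hmaps
  have huc' : ContinuousOn u' (Icc 0 T) := (G.continuousOn_grad hp hs _).comp hline hmaps
  have hder : ∀ t ∈ Ioo 0 T, HasDerivAt u (u' t) t := fun t ht =>
    hasDerivAt_stPoint_line hp hs (G.Φinv_mem (hmem t (Ioo_subset_Icc_self ht)))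
      (G.Φ_Φinv (hmem t (Ioo_subset_Icc_self ht)))
      (Filter.eventually_of_mem (isOpen_Ioo.mem_nhds ht) fun r hr =>
        hmem r (Ioo_subset_Icc_self hr))
  have hdt : ∀ t ∈ Ioo 0 T, dt (s ∘ G.Φinv) (stPoint x t) = u' t := by
    intro t ht
    have hyQ : stPoint x t ∈ G.Q := hQ ▸ ⟨x, hx, t, ht, rfl⟩
    obtain ⟨ξ, hξ, hy⟩ := hyQ
    simp only [hu']
    rw [← hy, dt, pd_comp_Φinv hp hQo hs hξ, G.Φinv_Φ (openCube_subset_closedCube d hξ)]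
  -- The integrand is the derivative of u²/2; only `u 0 = 0` and the value at `T` enter.
  have hftc : ∫ t in (0 : ℝ)..T, u' t * u t = 1 / 2 * u T ^ 2 - 1 / 2 * u 0 ^ 2 := by
    refine intervalIntegral.integral_eq_sub_of_hasDerivAt_of_le hT.le
      (f := fun t => 1 / 2 * u t ^ 2) (continuousOn_const.mul (huc.pow 2)) (fun t ht => ?_) ?_
    · refine (((hder t ht).pow 2).const_mul (1 / 2 : ℝ)).congr_deriv ?_
      simp only [Nat.cast_ofNat, Nat.add_one_sub_one, pow_one]
      ring
    · refine ContinuousOn.intervalIntegrable ?_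
      rw [uIcc_of_le hT.le]
      exact huc'.mul huc
  have h0 : u 0 = 0 := hv0 x hx
  calc ∫ t in Ioo 0 T, dt (s ∘ G.Φinv) (stPoint x t) * (s ∘ G.Φinv) (stPoint x t)
      = ∫ t in Ioo 0 T, u' t * u t :=
        setIntegral_congr_fun measurableSet_Ioo fun t ht => by simp only [hdt t ht, hu]
    _ = ∫ t in (0 : ℝ)..T, u' t * u t := by
        rw [intervalIntegral.integral_of_le hT.le, integral_Ioc_eq_integral_Ioo]
    _ = 1 / 2 * (s ∘ G.Φinv) (stPoint x T) ^ 2 := by rw [hftc, h0]; simp [hu]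

/-! ### The boundary of the cylinder -/

/-- On the top and bottom of the cylinder the normal has no spatial component. -/
theorem adjugate_eq_zero_of_time (hp : 2 ≤ p) (hQ : G.Q = cylinder Ω T) {ξ : Param d}
    (hξ : ξ ∈ closedCube d) {α : Fin (d + 1)} (hα : ∀ β, β ≠ α → ξ β ∈ Ioo (0 : ℝ) 1)
    (ht : G.Φ ξ (Fin.last d) = 0 ∨ G.Φ ξ (Fin.last d) = T) (l : Fin d) :
    (G.jac ξ).adjugate α l.castSucc = 0 := by
  -- On the closed cube the time coordinate takes values in `[0, T]`. It is extremal at `ξ`, and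
  -- since `ξ` may move both ways in direction `β`, the derivative in that direction vanishes.
  have hrow : ∀ β, β ≠ α → G.jac ξ (Fin.last d) β = 0 := by
    intro β hβ
    set γ : ℝ → Param d := fun r => ξ + r • Pi.single β 1 with hγ
    have hγd : HasDerivAt γ (Pi.single β 1) 0 := by
      have h := ((hasDerivAt_id (0 : ℝ)).smul_const (Pi.single β (1 : ℝ) : Param d)).const_add ξ
      rw [one_smul] at h
      exact h
    have hγ0 : γ 0 = ξ := by simp [hγ]
    have hev : ∀ᶠ r in 𝓝 (0 : ℝ), γ r ∈ closedCube d := by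
      have hc : ContinuousAt (fun r : ℝ => ξ β + r) 0 := by fun_prop
      have := hc.eventually (show ∀ᶠ z in 𝓝 (ξ β + 0), z ∈ Ioo (0 : ℝ) 1 by
        rw [add_zero]; exact isOpen_Ioo.mem_nhds (hα β hβ))
      filter_upwards [this] with r hr
      rw [mem_closedCube]
      intro δ
      by_cases hδ : δ = β
      · subst hδ
        simpa [hγ] using Ioo_subset_Icc_self hr
      · simpa [hγ, hδ] using mem_closedCube.1 hξ δ
    have hd := (B.differentiableWithinAt_of_mem hp (S.space_le (G.Φ_mem (Fin.last d)))
      hξ).hasFDerivWithinAt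
    rw [← hγ0] at hd
    have hder := hd.comp_hasDerivAt 0 hγd hev
    rw [hγ0, ← G.jac_apply hp hξ] at hder
    have hbd : ∀ ζ ∈ closedCube d, G.Φ ζ (Fin.last d) ∈ Icc 0 T := fun ζ hζ =>
      (closure_cylinder_subset (hQ ▸ Φ_mem_closure_Q hp hζ)).2
    rcases ht with ht | ht
    · refine IsLocalMin.hasDerivAt_eq_zero ?_ hder
      filter_upwards [hev] with r hr
      simp only [Function.comp_apply, hγ0, ht]
      exact (hbd _ hr).1
    · refine IsLocalMax.hasDerivAt_eq_zero ?_ hder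
      filter_upwards [hev] with r hr
      simp only [Function.comp_apply, hγ0, ht]
      exact (hbd _ hr).2
  have hdet := G.jac_det_ne_zero hξ
  have hne : G.jac ξ (Fin.last d) α ≠ 0 := by
    intro h0
    refine hdet (Matrix.det_eq_zero_of_row_eq_zero (Fin.last d) fun β => ?_)
    by_cases h : β = α
    · rw [h, h0]
    · exact hrow β h
  -- In the time row of `J adj J = det J · 1` only column `α` survives; the off-diagonal entry is
  -- zero and the surviving factor of `J` is not.
  have hmul := congrFun (congrFun (Matrix.mul_adjugate (G.jac ξ)) (Fin.last d)) l.castSucc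
  rw [Matrix.mul_apply, Finset.sum_eq_single α (fun β _ h => by rw [hrow β h, zero_mul])
    (fun h => (h (Finset.mem_univ _)).elim)] at hmul
  rw [Matrix.smul_apply, Matrix.one_apply_ne (Fin.castSucc_lt_last l).ne', smul_zero] at hmul
  exact (mul_eq_zero.1 hmul).resolve_left hne

/-- The boundary flux of functions in `V_{0h}` vanishes on the boundary of the cylinder. -/
theorem boundary_flux_eq_zero (hp : 2 ≤ p) (hΩ : IsOpen Ω) (hT : 0 < T) (hQ : G.Q = cylinder Ω T)
    {s : Param d → ℝ} (hs : s ∈ S.space) (hv : s ∘ G.Φinv ∈ G.V0h Ω T) {ξ : Param d}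
    (hξ : ξ ∈ closedCube d) {α : Fin (d + 1)} (hα : ∀ β, β ≠ α → ξ β ∈ Ioo (0 : ℝ) 1)
    (hc : ξ α = 0 ∨ ξ α = 1) (l : Fin d) :
    (G.jac ξ).adjugate α l.castSucc * G.grad (Fin.last d) s ξ = 0 := by
  have hcl := closure_cylinder_subset (hQ ▸ Φ_mem_closure_Q hp hξ)
  set x := spacePart (G.Φ ξ) with hx
  set t := G.Φ ξ (Fin.last d) with ht
  have hy : G.Φ ξ = stPoint x t := (stPoint_spacePart _).symm
  have hnot : G.Φ ξ ∉ G.Q := by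
    rintro ⟨ζ, hζ, he⟩
    have := G.Φ_injOn (openCube_subset_closedCube d hζ) hξ he
    subst this
    have h := mem_openBox.1 hζ α
    simp only [Pi.zero_apply, Pi.one_apply] at h
    rcases hc with hc | hc <;> linarith [h.1, h.2]
  rcases hcl.2.1.eq_or_lt with h0 | h0
  · rw [adjugate_eq_zero_of_time hp hQ hξ hα (Or.inl h0.symm), zero_mul]
  rcases hcl.2.2.eq_or_lt with h1 | h1
  · rw [adjugate_eq_zero_of_time hp hQ hξ hα (Or.inr h1), zero_mul]
  -- Strictly between the two times a point of ∂Q lies over ∂Ω. There `v` vanishes on a vertical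
  -- segment, so its time derivative is zero.
  have hxf : x ∈ frontier Ω := by
    rw [hΩ.frontier_eq]
    refine ⟨hcl.1, fun hxΩ => hnot ?_⟩
    rw [hQ, hy]
    exact ⟨x, hxΩ, t, ⟨h0, h1⟩, rfl⟩
  have hev : ∀ᶠ r in 𝓝 t, r ∈ Ioo 0 T := isOpen_Ioo.mem_nhds ⟨h0, h1⟩
  have hder := hasDerivAt_stPoint_line hp hs hξ hy (hev.mono fun r hr =>
    stPoint_mem_image hp hQ hT hcl.1 (Ioo_subset_Icc_self hr))
  have hzero : HasDerivAt (fun r => (s ∘ G.Φinv) (stPoint x r)) 0 t :=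
    (hasDerivAt_const t (0 : ℝ)).congr_of_eventuallyEq (hev.mono fun r hr => hv.2.1 x hxf r hr)
  rw [hder.unique hzero, mul_zero]

/-! ### Integration by parts on an element -/

/-- A continuous determinant without zeros on the connected cube keeps its sign. -/
theorem exists_sign_det (hp : 2 ≤ p) :
    ∃ σ : ℝ, ∀ ξ ∈ closedCube d, (SignType.sign (G.jac ξ).det : ℝ) = σ
      ∧ |(G.jac ξ).det| = σ * (G.jac ξ).det := by
  have hpre : IsPreconnected (closedCube d) := (convex_Icc (0 : Param d) 1).isPreconnected
  have hcon := hpre.image _ (G.continuousOn_jac_det hp)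
  have hord := hcon.ordConnected
  have h0 : (0 : Param d) ∈ closedCube d := left_mem_Icc.2 zero_le_one
  rcases lt_or_gt_of_ne (G.jac_det_ne_zero h0) with h | h
  · refine ⟨-1, fun ξ hξ => ?_⟩
    have hlt : (G.jac ξ).det < 0 := by
      by_contra hcon
      obtain ⟨ζ, hζ, he⟩ := hord.out ⟨_, h0, rfl⟩ ⟨ξ, hξ, rfl⟩ ⟨h.le, not_lt.1 hcon⟩
      exact G.jac_det_ne_zero hζ he
    simp [sign_neg hlt, abs_of_neg hlt]
  · refine ⟨1, fun ξ hξ => ?_⟩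
    have hlt : 0 < (G.jac ξ).det := by
      by_contra hcon
      obtain ⟨ζ, hζ, he⟩ := hord.out ⟨ξ, hξ, rfl⟩ ⟨_, h0, rfl⟩ ⟨not_lt.1 hcon, h.le⟩
      exact G.jac_det_ne_zero hζ he
    simp [sign_pos hlt, abs_of_pos hlt]

open Classical in
-- `H` is the physical integrand, evaluated with `fderiv` and thus trustworthy only inside `Q`; `g`
-- is its continuous version from the lift. On inner faces they agree almost everywhere. On faces of
-- the cube the left side is an integral over null sets, and the right side vanishes because the
-- boundary flux does.
theorem sum_facePart_eq [Fintype ι] (hp : 2 ≤ p) (hQ : IsOpen G.Q) {K : ι}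
    {α : Fin (d + 1)} {c : ℝ} (hc : c = S.lo K α ∨ c = S.hi K α)
    {H g : (Fin d → ℝ) → ℝ} (hg : ContinuousOn g (S.face K α))
    (hHg : ∀ z ∈ S.face K α, (α.insertNth c z : Param d) ∈ openCube d → H z = g z)
    (hb : c = 0 ∨ c = 1 → ∀ z ∈ S.face K α, (∀ j, z j ∈ Ioo (0 : ℝ) 1) → g z = 0) :
    ∑ L, (if L ≠ K ∧ ¬ G.facet K L ⊆ frontier G.Q then
      ∫ z in G.facePart K α c (G.facet K L), H z else 0) = ∫ z in S.face K α, g z := by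
  have hm := (S.isCompact_face K α).measurableSet
  have hlh := (S.lo_lt_hi K α).le
  have hc' : c ∈ Icc (S.lo K α) (S.hi K α) := by
    rcases hc with rfl | rfl
    · exact ⟨le_rfl, hlh⟩
    · exact ⟨hlh, le_rfl⟩
  have hc0 : 0 ≤ c := (SplineSpace.lo_nonneg K α).trans hc'.1
  have hc1 : c ≤ 1 := hc'.2.trans (SplineSpace.hi_le_one K α)
  by_cases hbd : c = 0 ∨ c = 1
  · rw [Finset.sum_eq_zero]
    · rw [setIntegral_congr_ae (g := fun _ => (0 : ℝ)) hm, integral_zero]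
      filter_upwards [S.ae_isGeneric α] with z hz hzK
      exact hb hbd z hzK fun j => ⟨(SplineSpace.lo_nonneg K _).trans_lt (hz.lt hzK j).1,
        (hz.lt hzK j).2.trans_le (SplineSpace.hi_le_one K _)⟩
    · intro L _
      split_ifs with h
      · exact setIntegral_facePart_boundary hp hQ h.1 hc' hbd H
      · rfl
  · rw [not_or] at hbd
    have h0 : 0 < c := lt_of_le_of_ne hc0 (Ne.symm hbd.1)
    have h1 : c < 1 := lt_of_le_of_ne hc1 hbd.2
    have hae : ∀ᵐ z, z ∈ S.face K α → H z = g z := by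
      filter_upwards [S.ae_isGeneric α] with z hz hzK
      exact hHg z hzK (SplineSpace.insertNth_mem_openCube hz hzK h0 h1)
    have hgi : IntegrableOn g (S.face K α) := hg.integrableOn_compact (S.isCompact_face K α)
    have hHi : IntegrableOn H (S.face K α) := hgi.congr_fun_ae
      (((ae_restrict_iff' hm).2 hae).mono fun z hz => hz.symm)
    rw [sum_setIntegral_facePart hp hQ hc h0 h1 hHi]
    exact setIntegral_congr_ae hm hae

/-- Normalising the normal cancels against the surface element. -/
theorem unitNormal_flux (ξ : Param d) (α : Fin (d + 1)) (X : Fin d → ℝ) (Y : ℝ) :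
    (∑ l : Fin d, G.unitNormal ξ α l.castSucc * X l) * Y * ‖G.areaVec ξ α‖
      = ∑ l : Fin d, G.areaVec ξ α l.castSucc * (X l * Y) := by
  by_cases h : ‖G.areaVec ξ α‖ = 0
  · have : G.areaVec ξ α = 0 := norm_eq_zero.1 h
    simp [this]
  · simp only [unitNormal, PiLp.smul_apply, smul_eq_mul]
    rw [Finset.sum_mul, Finset.sum_mul]
    refine Finset.sum_congr rfl fun l _ => ?_
    field_simp

end Geometry

section PullPd

variable {d : ℕ} {ψ : Param d → Param d} {ξ : Param d}

theorem pullPd_mul {f g : Param d → ℝ} (hf : DifferentiableAt ℝ f ξ) (hg : DifferentiableAt ℝ g ξ)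
    (k : Fin (d + 1)) :
    pullPd ψ k (fun ξ => f ξ * g ξ) ξ = pullPd ψ k f ξ * g ξ + f ξ * pullPd ψ k g ξ := by
  simp only [pullPd, fderiv_fun_mul hf hg, Finset.sum_mul, Finset.mul_sum,
    ← Finset.sum_add_distrib]
  refine Finset.sum_congr rfl fun α _ => ?_
  simp only [add_apply, smul_apply, smul_eq_mul]
  ring

theorem pullPd_zero (k : Fin (d + 1)) : pullPd ψ k (0 : Param d → ℝ) ξ = 0 := by
  simp [pullPd]

end PullPd

namespace Geometry

variable {d p : ℕ} {B : NurbsBasis d p} {ι : Type*} {S : SplineSpace B ι} {G : Geometry S}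
  {Ω : Set (EuclideanSpace ℝ (Fin d))} {T : ℝ}

open Classical in
-- Regroups the facets by the faces of the box; the minus sign is the outer normal on the lower
-- face.
theorem interiorFacetSum_eq [Fintype ι] (K : ι) (u v : Phys d → ℝ) :
    G.interiorFacetSum K u v = ∑ α : Fin (d + 1),
      ((∑ L, if L ≠ K ∧ ¬ G.facet K L ⊆ frontier G.Q then
          ∫ z in G.facePart K α (S.hi K α) (G.facet K L),
            ∑ l : Fin d, G.areaVec (α.insertNth (S.hi K α) z) α l.castSucc
              * (dx l u (G.Φ (α.insertNth (S.hi K α) z)) * dt v (G.Φ (α.insertNth (S.hi K α) z)))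
          else 0)
        - ∑ L, if L ≠ K ∧ ¬ G.facet K L ⊆ frontier G.Q then
          ∫ z in G.facePart K α (S.lo K α) (G.facet K L),
            ∑ l : Fin d, G.areaVec (α.insertNth (S.lo K α) z) α l.castSucc
              * (dx l u (G.Φ (α.insertNth (S.lo K α) z)) * dt v (G.Φ (α.insertNth (S.lo K α) z)))
          else 0) := by
  simp only [← Finset.sum_sub_distrib]
  rw [interiorFacetSum, Finset.sum_comm]
  refine Finset.sum_congr rfl fun L _ => ?_
  by_cases h : L ≠ K ∧ ¬ G.facet K L ⊆ frontier G.Q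
  · simp only [if_pos h, facetTerm, surfInt]
    refine Finset.sum_congr rfl fun α _ => ?_
    rw [sub_eq_add_neg, ← integral_neg]
    simp only [unitNormal_flux, PiLp.neg_apply, neg_mul, Finset.sum_neg_distrib]
  · simp [if_neg h]

/-- Integration by parts on an element: the boundary terms are those of the interior facets. -/
theorem interiorFacetSum_self [Fintype ι] (hp : 2 ≤ p) (hΩ : IsOpen Ω) (hT : 0 < T)
    (hQ : G.Q = cylinder Ω T) {v : Phys d → ℝ} (hv : v ∈ G.V0h Ω T) (K : ι) :
    G.interiorFacetSum K v v
      = ip (G.elt K) (fun y => ∑ l, dx l (dx l v) y) (dt v) + ipGrad (G.elt K) v (dt v) := by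
  classical
  have hQo : IsOpen G.Q := hQ ▸ isOpen_cylinder hΩ T
  obtain ⟨χ⟩ := G.nonempty_chart_element hp K
  obtain ⟨s, hs, hvs⟩ := exists_eq_of_mem_Vh hv.1
  obtain ⟨f, hf, hfe⟩ := exists_isLift χ hs
  obtain ⟨σ, hσ⟩ := exists_sign_det (G := G) hp
  rw [← hvs] at hf
  have hlt := S.lo_lt_hi K
  have hsub := S.Icc_subset K
  have hdx : ∀ l : Fin d, IsLift χ (dx l v) _ := fun l => hf.pd hp hQo l.castSucc
  have hdt : IsLift χ (dt v) _ := hf.pd hp hQo (Fin.last d)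
  have hdxx : ∀ l : Fin d, IsLift χ (dx l (dx l v)) _ := fun l => (hdx l).pd hp hQo l.castSucc
  have hdxt : ∀ l : Fin d, IsLift χ (dx l (dt v)) _ := fun l => hdt.pd hp hQo l.castSucc
  set P : Fin d → Param d → ℝ := fun l ξ =>
    pullPd χ.ψ l.castSucc f ξ * pullPd χ.ψ (Fin.last d) f ξ with hP
  have hPs : ∀ l, ContDiffOn ℝ ∞ (P l) χ.U := fun l => (hdx l).1.mul hdt.1
  -- The flux field in parameter coordinates: spatial components ∂_{x_l} v ∂_t v and time component
  -- zero, so only the spatial normal enters.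
  set F : Fin (d + 1) → Param d → ℝ := Fin.snoc (α := fun _ => Param d → ℝ) P 0 with hF
  have hFs : ∀ k, ContDiffOn ℝ ∞ (F k) χ.U := by
    intro k
    refine Fin.lastCases ?_ (fun l => ?_) k
    · simp only [hF, Fin.snoc_last]; exact contDiffOn_const
    · simp only [hF, Fin.snoc_castSucc]; exact hPs l
  have hdiv := integral_det_mul_divergence χ.isOpen_U (fun α => (hlt α).le) χ.subset_U
    χ.contDiffOn_ψ χ.det_ne hFs
  have hadjF : ∀ (α : Fin (d + 1)) ξ, ∑ k, (jacMatrix χ.ψ ξ).adjugate α k * F k ξ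
      = ∑ l : Fin d, (jacMatrix χ.ψ ξ).adjugate α l.castSucc * P l ξ := by
    intro α ξ
    rw [Fin.sum_univ_castSucc]
    simp only [hF, Fin.snoc_castSucc, Fin.snoc_last, Pi.zero_apply, mul_zero, add_zero]
  -- Change of variables with |det J| = σ det J, followed by the product rule for each ∂_l (∂_l v
  -- ∂_t v).
  have hvol : ip (G.elt K) (fun y => ∑ l, dx l (dx l v) y) (dt v) + ipGrad (G.elt K) v (dt v)
      = σ * ∫ ξ in Icc (S.lo K) (S.hi K), (jacMatrix χ.ψ ξ).det * ∑ k, pullPd χ.ψ k (F k) ξ := by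
    have hae : openBox (S.lo K) (S.hi K) =ᵐ[volume] Icc (S.lo K) (S.hi K) :=
      Measure.univ_pi_Ioo_ae_eq_Icc
    rw [ip, ipGrad, ← integral_add
      (((IsLift.sum Finset.univ fun l => hdxx l).mul hdt).integrableOn hp)
      ((IsLift.sum Finset.univ fun l => (hdx l).mul (hdxt l)).integrableOn hp), elt,
      G.setIntegral_image hp (isOpen_openBox _ _).measurableSet
        ((openBox_subset_Icc _ _).trans hsub), ← integral_const_mul,
      ← setIntegral_congr_set hae]
    refine setIntegral_congr_fun (isOpen_openBox _ _).measurableSet fun ξ hξ => ?_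
    have hξ' := openBox_subset_Icc _ _ hξ
    rw [(hσ ξ (hsub hξ')).2, ← χ.jac_eq ξ hξ', mul_assoc]
    congr 2
    rw [Fin.sum_univ_castSucc]
    simp only [hF, Fin.snoc_castSucc, Fin.snoc_last, pullPd_zero, add_zero, Finset.sum_mul]
    rw [← Finset.sum_add_distrib]
    refine Finset.sum_congr rfl fun l _ => ?_
    rw [hP, pullPd_mul ((hdx l).differentiableAt (χ.subset_U hξ'))
      (hdt.differentiableAt (χ.subset_U hξ')), (hdxx l).2 ξ hξ, (hdx l).2 ξ hξ, hdt.2 ξ hξ,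
      (hdxt l).2 ξ hξ]
  have hface : ∀ (α : Fin (d + 1)) (c : ℝ), (c = S.lo K α ∨ c = S.hi K α) →
      (∑ L, if L ≠ K ∧ ¬ G.facet K L ⊆ frontier G.Q then
          ∫ z in G.facePart K α c (G.facet K L),
            ∑ l : Fin d, G.areaVec (α.insertNth c z) α l.castSucc
              * (dx l v (G.Φ (α.insertNth c z)) * dt v (G.Φ (α.insertNth c z))) else 0)
        = σ * ∫ z in S.face K α,
          ∑ k, (jacMatrix χ.ψ (α.insertNth c z)).adjugate α k * F k (α.insertNth c z) := by
    intro α c hc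
    have hc' : c ∈ Icc (S.lo K α) (S.hi K α) := by
      rcases hc with rfl | rfl
      · exact ⟨le_rfl, (hlt α).le⟩
      · exact ⟨(hlt α).le, le_rfl⟩
    have hmem : ∀ z ∈ S.face K α, (α.insertNth c z : Param d) ∈ Icc (S.lo K) (S.hi K) :=
      fun z hz => SplineSpace.insertNth_mem_Icc_iff.2 ⟨hc', hz⟩
    have hins : Continuous fun z : Fin d → ℝ => (α.insertNth c z : Param d) :=
      Continuous.finInsertNth α continuous_const continuous_id
    have hJ := contDiffOn_jacMatrix (m := ∞) χ.isOpen_U χ.contDiffOn_ψ (by simp)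
    -- On the closed element the lift has the one-sided derivatives `grad`, to which the vanishing
    -- of the boundary flux refers.
    have hgrad : ∀ k, ∀ ξ ∈ Icc (S.lo K) (S.hi K), pullPd χ.ψ k f ξ = G.grad k s ξ :=
      fun k ξ hξ => Chart.pullPd_eq G hp (by simp) χ hs hf.1 hfe k hξ
    rw [← integral_const_mul]
    refine sum_facePart_eq hp hQo hc ?_ ?_ ?_
    · refine continuousOn_const.mul (continuousOn_finsetSum _ fun k _ => ?_)
      exact ((contDiffOn_adjugate hJ α k).mul (hFs k)).continuousOn.comp hins.continuousOn
        fun z hz => χ.subset_U (hmem z hz)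
    · intro z hz hcube
      have hξ := hmem z hz
      rw [hadjF, Finset.mul_sum]
      refine Finset.sum_congr rfl fun l _ => ?_
      simp only [hP, hgrad _ _ hξ]
      rw [hvs, dx, dt, pd_comp_Φinv hp hQo hs hcube, pd_comp_Φinv hp hQo hs hcube, χ.jac_eq _ hξ,
        ← (hσ _ (hsub hξ)).1]
      simp only [areaVec]
      ring
    · intro hbd z hz hzj
      have hξ := hmem z hz
      rw [hadjF, Finset.sum_eq_zero, mul_zero]
      intro l _
      have hflux := boundary_flux_eq_zero hp hΩ hT hQ hs (hvs ▸ hv) (hsub hξ) (α := α)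
        (fun β hβ => ?_) ?_ l
      · simp only [hP, hgrad _ _ hξ, χ.jac_eq _ hξ]
        linear_combination G.grad l.castSucc s (α.insertNth c z) * hflux
      · obtain ⟨j, rfl⟩ := Fin.exists_succAbove_eq hβ
        rw [Fin.insertNth_apply_succAbove]
        exact hzj j
      · rwa [Fin.insertNth_apply_same]
  rw [interiorFacetSum_eq, hvol, hdiv, Finset.mul_sum]
  refine Finset.sum_congr rfl fun α _ => ?_
  rw [hface α _ (Or.inr rfl), hface α _ (Or.inl rfl), mul_sub]
  rfl

/-- The elements are disjoint parts of `Q` and the integrand is nonnegative. Coercivity uses only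
this inequality, so the mesh skeleton need not be shown to be null. -/
theorem sum_ipGrad_elt_le [Fintype ι] (hp : 2 ≤ p) (hQ : IsOpen G.Q) {v : Phys d → ℝ}
    (hv : v ∈ G.Vh) : ∑ K, ipGrad (G.elt K) v v ≤ ipGrad G.Q v v := by
  obtain ⟨s, hs, rfl⟩ := exists_eq_of_mem_Vh hv
  have hint : IntegrableOn (fun y => ∑ l : Fin d, dx l (s ∘ G.Φinv) y * dx l (s ∘ G.Φinv) y)
      G.Q := by
    refine G.integrableOn_of_continuousOn hp (a := 0) (b := 1) le_rfl
      (f := fun ξ => ∑ l : Fin d, G.grad l.castSucc s ξ * G.grad l.castSucc s ξ)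
      (continuousOn_finsetSum _ fun l _ =>
        (G.continuousOn_grad hp hs _).mul (G.continuousOn_grad hp hs _)) fun ξ hξ => ?_
    simp only [dx]
    exact Finset.sum_congr rfl fun l _ => by rw [pd_comp_Φinv hp hQ hs hξ]
  have hunion := integral_iUnion_fintype (fun K => (isOpen_elt (G := G) hp hQ K).measurableSet)
    (fun K L h => disjoint_elt h) fun K => hint.mono_set (elt_subset_Q K)
  simp only [ipGrad]
  rw [← hunion]
  exact setIntegral_mono_set hint (Filter.Eventually.of_forall fun y =>
    Finset.sum_nonneg fun l _ => mul_self_nonneg _)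
    (Filter.Eventually.of_forall fun _ h => iUnion_subset (fun K => elt_subset_Q K) h)

end Geometry
end SpaceTimeIgA

/-! ### Coercivity of the bilinear form. -/

theorem mainTheorem2 {d p : ℕ} (hd : 1 ≤ d) (hp : 2 ≤ p)
    {ι : Type*} [Fintype ι] (B : SpaceTimeIgA.NurbsBasis d p)
    (S : SpaceTimeIgA.SplineSpace B ι) (G : SpaceTimeIgA.Geometry S)
    (Ω : Set (EuclideanSpace ℝ (Fin d))) (hΩ : IsOpen Ω) (T : ℝ) (hT : 0 < T)
    (hQ : G.Q = SpaceTimeIgA.cylinder Ω T) :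
    (∃ C : ℝ, 0 < C ∧ ∀ K, G.IsInverseConst K C) ∧
    ∀ C : ι → ℝ, (∀ K, 0 < C K) → (∀ K, G.IsInverseConst K (C K)) →
      ∀ θ : ι → ℝ, (∀ K, θ K ∈ Set.Ioc 0 (G.h K / (d * C K ^ 2))) →
        ∀ v ∈ G.V0h Ω T, 1 / 2 * G.normLocSq Ω T θ v ≤ G.aloc θ v v := by
  open SpaceTimeIgA SpaceTimeIgA.Geometry in
  have hQo : IsOpen G.Q := hQ ▸ isOpen_cylinder hΩ T
  refine ⟨exists_uniform_isInverseConst hp hQo, fun C hC hinv θ hθ v hv => ?_⟩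
  have hsum := sum_ipGrad_elt_le hp hQo hv.1
  have hlap := Finset.sum_le_sum fun K (_ : K ∈ Finset.univ) =>
    laplacian_bound hp hd hQo (hC K) (hinv K) (hθ K) hv.1
  rw [Finset.sum_add_distrib, ← Finset.mul_sum, ← Finset.mul_sum] at hlap
  -- The form contains ½ of this integral, half the squared norm only ¼, so its sign is needed to
  -- discard the surplus.
  have hT0 : 0 ≤ ∫ x in Ω, v (stPoint x T) ^ 2 := integral_nonneg fun x => sq_nonneg _
  have htime := ip_dt_self hp hΩ hT hQ hv
  -- Integration by parts turns the facet terms into the mixed terms, which cancel, plus the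
  -- Laplacian residual.
  have hel : ∑ K, θ K * G.h K * (ip (G.elt K) (dt v) (dt v) + ipGrad (G.elt K) v (dt v))
      - ∑ K, θ K * G.h K * G.interiorFacetSum K v v
      = ∑ K, θ K * G.h K * ip (G.elt K) (dt v) (dt v)
        - ∑ K, θ K * G.h K * ip (G.elt K) (fun y => ∑ l, dx l (dx l v) y) (dt v) := by
    rw [← Finset.sum_sub_distrib, ← Finset.sum_sub_distrib]
    refine Finset.sum_congr rfl fun K _ => ?_
    rw [interiorFacetSum_self hp hΩ hT hQ hv K]
    ring
  rw [normLocSq, aloc, htime]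
  linarith
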